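/- **Setting.** Let $(W_{\mathrm{aff}},S_{\mathrm{aff}})$ be a Coxeter system, let $\Omega$ be a group acting on $W_{\mathrm{aff}}$ by automorphisms which preserve $S_{\mathrm{aff}}$, put $W=W_{\mathrm{aff}}\rtimes\Omega$, let $\ell$ be the length function of $W_{\mathrm{aff}}$, extended to $W$ by $\ell(w\omega)=\ell(w)$, and let $1\to Z_\kappa\to W(1)\to W\to 1$ be a group extension with $Z_\kappa$ finite and commutative; inflate $\ell$ to $W(1)$. Let $C$ be a field of characteristic $p>0$ with $p\nmid \#Z_\kappa$. Parameters are a family $(q_s)_{s\in S_{\mathrm{aff}}}$ in $C$ which is constant on $W$-conjugate simple reflections, and elements $c_{\tilde s}\in C[Z_\kappa]$, for $\tilde s\in W(1)$ lifting a reflection of $W_{\mathrm{aff}}$, such that $c_{w\tilde sw^{-1}}=w c_{\tilde s}w^{-1}$ for $w\in W(1)$ and $c_{t\tilde s}=t\,c_{\tilde s}$ for $t\in Z_\kappa$. The generic algebra $\mathcal H$ is the $C$-algebra with basis $(T_w)_{w\in W(1)}$ and relations $T_{vw}=T_vT_w$ if $\ell(vw)=\ell(v)+\ell(w)$, and $T_{\tilde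 s}^2=q_sT_{\tilde s^2}+c_{\tilde s}T_{\tilde s}$ for every lift $\tilde s\in W(1)$ of $s\in S_{\mathrm{aff}}$ (with $C[Z_\kappa]\subset\mathcal H$ through $t\mapsto T_t$). Assume that $q_s=0$ for all $s\in S_{\mathrm{aff}}$. All modules are right modules. Let $W^{\mathrm{aff}}(1)$ and $\Omega(1)$ be the inverse images in $W(1)$ of $W_{\mathrm{aff}}$ and $\Omega$, and let $\mathcal H^{\mathrm{aff}}=\bigoplus_{w\in W^{\mathrm{aff}}(1)}CT_w$. Let $\Xi,\Xi'\colon\mathcal H^{\mathrm{aff}}\to C$ be characters (homomorphisms of $C$-algebras). Let $\Omega(1)_\Xi$ be the group of all $\omega\in\Omega(1)$ with $\Xi(T_{\omega w\omega^{-1}})=\Xi(T_w)$ for all $w\in W^{\mathrm{aff}}(1)$, let $\Omega_\Xi$ be its image in $\Omega$, and let $\mathcal H_\Xi=\mathcal H^{\mathrm{aff}}C[\Omega(1)_\Xi]\subset\mathcal H$. Let $V$ be a simple $C[\Omega(1)_\Xi]$-module on which each $t\in Z_\kappa$ acts by the scalar $\Xi(T_t)$. Then $\Xi\otimes V$ is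 the $\mathcal H_\Xi$-module with underlying space $V$ and $v\cdot XT_\omega=\Xi(X)\,v\omega$ for $X\in\mathcal H^{\mathrm{aff}}$, $\omega\in\Omega(1)_\Xi$, and $\pi=(\Xi\otimes V)\otimes_{\mathcal H_\Xi}\mathcal H$. Let $V'$, $\Xi'\otimes V'$ and $\pi'$ be of the same kind for $\Xi'$. Put $\mathcal H_{\Xi,\Xi'}=\mathcal H_\Xi\cap\mathcal H_{\Xi'}$, $\Omega(1)_{\Xi,\Xi'}=\Omega(1)_\Xi\cap\Omega(1)_{\Xi'}$ and $\Omega_{\Xi,\Xi'}=\Omega_\Xi\cap\Omega_{\Xi'}$. For $\mathcal H$-modules $M,N$, the group $\Omega(1)$ acts on $\mathrm{Hom}_{\mathcal H^{\mathrm{aff}}}(M,N)$ by $(f\omega)(m)=f(mT_\omega^{-1})T_\omega$, and on $\mathrm{Ext}^1_{\mathcal H^{\mathrm{aff}}}(M,N)$ by twisting extensions by conjugation with $T_\omega$ and identifying the twists of $M$ and $N$ with $M$ and $N$ through $m\mapsto mT_\omega^{-1}$. These actions are trivial on $Z_\kappa$, so they are actions of $\Omega=\Omega(1)/Z_\kappa$.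 In the same way $\Omega_{\Xi,\Xi'}=\Omega(1)_{\Xi,\Xi'}/Z_\kappa$ acts on $\mathrm{Ext}^1_{\mathcal H^{\mathrm{aff}}}(M,N)$ for $\mathcal H_{\Xi,\Xi'}$-modules $M,N$. **Theorem.** (1) The restriction map $$\mathrm{Ext}^1_{\mathcal H_{\Xi,\Xi'}}(\Xi\otimes V,\Xi'\otimes V')\to\mathrm{Ext}^1_{\mathcal H^{\mathrm{aff}}}(\Xi\otimes V,\Xi'\otimes V')^{\Omega_{\Xi,\Xi'}}$$ is well defined and surjective; that is, the image of restriction to $\mathcal H^{\mathrm{aff}}$ is exactly the space of invariants. (2) The sequence $$0\to H^1(\Omega,\mathrm{Hom}_{\mathcal H^{\mathrm{aff}}}(\pi,\pi'))\to\mathrm{Ext}^1_{\mathcal H}(\pi,\pi')\to\mathrm{Ext}^1_{\mathcal H^{\mathrm{aff}}}(\pi,\pi')^{\Omega}\to0$$ is exact, where the second map is restriction and the first is inflation: it sends the class of a cocycle $z$ to the class of any extension $0\to\pi'\to E\to\pi\to0$ of $\mathcal H$-modules which has an $\mathcal H^{\mathrm{aff}}$-linear section $\sigma\colon\pi\to E$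 with $\sigma(mT_\gamma)T_\gamma^{-1}=\sigma(m)+z_{\bar\gamma}(m)$ for all $\gamma\in\Omega(1)$ with image $\bar\gamma\in\Omega$ and all $m\in\pi$. (Here $\mathrm{Hom}_{\mathcal H^{\mathrm{aff}}}(\pi,\pi')$ is regarded as a left module by $(\bar\gamma f)(m)=f(mT_\gamma)T_\gamma^{-1}$.) In particular $$\mathrm{Ext}^1_{\mathcal H}(\pi,\pi')\cong H^1(\Omega,\mathrm{Hom}_{\mathcal H^{\mathrm{aff}}}(\pi,\pi'))\oplus\mathrm{Ext}^1_{\mathcal H^{\mathrm{aff}}}(\pi,\pi')^{\Omega}$$ as vector spaces over $C$. -/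

import Mathlib

universe u

open CategoryTheory MulOpposite TensorProduct

noncomputable section

namespace CoxeterSystem

variable {B W : Type*} [Group W] {M : CoxeterMatrix B} (cs : CoxeterSystem M W)

open Classical in
/-- Auxiliary permutation used for the exchange condition. -/
def reflPerm (i : B) : Equiv.Perm (W × ZMod 2) :=
  Function.Involutive.toPerm
    (fun x => (cs.simple i * x.1 * cs.simple i, x.2 + if x.1 = cs.simple i then 1 else 0)) (by
      rintro ⟨t, e⟩
      have h : cs.simple i * t * cs.simple i = cs.simple i ↔ t = cs.simple i := by
        constructor
        · intro h
          have := congrArg (fun x => cs.simple i * x * cs.simple i) h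
          simpa [mul_assoc] using this
        · rintro rfl; simp
      have h2 : (1 : ZMod 2) + 1 = 0 := by decide
      ext
      · simp [mul_assoc]
      · by_cases ht : t = cs.simple i <;> simp [h, ht, add_assoc, h2])

open Classical in
theorem reflPerm_apply (i : B) (t : W) (e : ZMod 2) : cs.reflPerm i (t, e) =
    (cs.simple i * t * cs.simple i, e + if t = cs.simple i then 1 else 0) := rfl

open Classical in
theorem reflPerm_pow (i j : B) (n : ℕ) (t : W) (e : ZMod 2) :
    ((cs.reflPerm i * cs.reflPerm j) ^ n) (t, e) =
      ((cs.simple i * cs.simple j) ^ n * t * ((cs.simple i * cs.simple j) ^ n)⁻¹,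
        e + ∑ r ∈ Finset.range (2 * n),
          if t = cs.simple j * (cs.simple i * cs.simple j) ^ r then 1 else 0) := by
  induction n with
  | zero => simp
  | succ n ih =>
    set p := cs.simple i * cs.simple j with hp
    have hconj : ∀ k : ℕ, (p ^ k)⁻¹ * cs.simple j = cs.simple j * p ^ k := by
      intro k
      induction k with
      | zero => simp
      | succ k ih2 =>
        have h : p⁻¹ * cs.simple j = cs.simple j * p := by simp [hp, mul_assoc]
        calc (p ^ (k + 1))⁻¹ * cs.simple j = p⁻¹ * ((p ^ k)⁻¹ * cs.simple j) := by
              rw [pow_succ, mul_inv_rev, mul_assoc]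
          _ = cs.simple j * p ^ (k + 1) := by
              rw [ih2, ← mul_assoc, h, mul_assoc, ← pow_succ']
    have key : ∀ x : W, p ^ n * t * (p ^ n)⁻¹ = x ↔ t = (p ^ n)⁻¹ * x * p ^ n := by
      intro x
      constructor
      · rintro rfl; group
      · rintro h; rw [h]; group
    have e1 : (p ^ n * t * (p ^ n)⁻¹ = cs.simple j) ↔ t = cs.simple j * p ^ (2 * n) := by
      rw [key, hconj, mul_assoc, ← pow_add, two_mul]
    have e2 : (cs.simple j * (p ^ n * t * (p ^ n)⁻¹) * cs.simple j = cs.simple i) ↔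
        t = cs.simple j * p ^ (2 * n + 1) := by
      have : (cs.simple j * (p ^ n * t * (p ^ n)⁻¹) * cs.simple j = cs.simple i) ↔
          p ^ n * t * (p ^ n)⁻¹ = cs.simple j * p := by
        generalize p ^ n * t * (p ^ n)⁻¹ = y
        constructor
        · intro h
          rw [hp, ← h]; simp [mul_assoc]
        · intro h
          rw [h, hp]; simp [mul_assoc]
      rw [this, key, ← mul_assoc, hconj, mul_assoc, mul_assoc, ← pow_succ', ← pow_add]
      congr! 3
      ring
    rw [pow_succ', Equiv.Perm.mul_apply, ih, Equiv.Perm.mul_apply, reflPerm_apply, reflPerm_apply]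
    ext
    · simp only [pow_succ', hp, mul_inv_rev, inv_simple, mul_assoc]
    · simp only [e1, e2, mul_add, mul_one, Finset.sum_range_succ, add_assoc]

theorem reflPerm_liftable : M.IsLiftable cs.reflPerm := by
  classical
  intro i j
  ext x : 1
  obtain ⟨t, e⟩ := x
  rw [reflPerm_pow]
  have h1 := cs.simple_mul_simple_pow i j
  have h2 : (1 : ZMod 2) + 1 = 0 := by decide
  have h3 : ∀ x : ZMod 2, x + x = 0 := by decide
  rw [two_mul, Finset.sum_range_add]
  simp [pow_add, h1, h3]

/-- The permutation action of `W` on `W × ZMod 2` behind the exchange condition. -/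
def reflAction : W →* Equiv.Perm (W × ZMod 2) := cs.lift ⟨cs.reflPerm, cs.reflPerm_liftable⟩

open Classical in
theorem reflAction_wordProd (l : List B) (t : W) (e : ZMod 2) :
    cs.reflAction (cs.wordProd l) (t, e) =
      (cs.wordProd l * t * (cs.wordProd l)⁻¹, e + ((cs.rightInvSeq l).count t : ZMod 2)) := by
  induction l with
  | nil => simp
  | cons i l ih =>
    rw [wordProd_cons, map_mul, Equiv.Perm.mul_apply, ih]
    rw [reflAction, lift_apply_simple, reflPerm_apply]
    have : (cs.wordProd l * t * (cs.wordProd l)⁻¹ = cs.simple i) ↔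
        (cs.wordProd l)⁻¹ * cs.simple i * cs.wordProd l = t := by
      constructor
      · intro h; rw [← h]; group
      · rintro rfl; group
    ext
    · simp [mul_assoc]
    · by_cases h : (cs.wordProd l)⁻¹ * cs.simple i * cs.wordProd l = t
      · simp [this, rightInvSeq, h, add_assoc]
      · simp [this, rightInvSeq, h]

/-- The exchange condition. -/
theorem simple_mem_rightInvSeq (l : List B) (j : B)
    (h : cs.length (cs.wordProd l * cs.simple j) < cs.length (cs.wordProd l)) :
    cs.simple j ∈ cs.rightInvSeq l := by
  classical
  by_contra hn
  obtain ⟨l', hl', hw⟩ := cs.exists_isReduced (cs.wordProd l * cs.simple j)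
  have h1 : cs.reflAction (cs.wordProd l) (cs.simple j, 0) =
      (cs.wordProd l * cs.simple j * (cs.wordProd l)⁻¹, 0) := by
    rw [reflAction_wordProd, List.count_eq_zero_of_not_mem hn]; simp
  have h2 := cs.reflAction_wordProd l' (cs.simple j) 0
  rw [← hw, map_mul, Equiv.Perm.mul_apply] at h2
  have h3 : cs.reflAction (cs.simple j) (cs.simple j, 0) = (cs.simple j, 1) := by
    rw [reflAction, lift_apply_simple, reflPerm_apply]; simp
  rw [h3] at h2
  have h4 := cs.reflAction_wordProd l (cs.simple j) 1
  rw [h2, List.count_eq_zero_of_not_mem hn] at h4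
  have h5 : cs.simple j ∈ cs.rightInvSeq l' := by
    by_contra hn'
    rw [List.count_eq_zero_of_not_mem hn'] at h4
    have := congrArg Prod.snd h4
    simp at this
  have h6 := (cs.isRightInversion_of_mem_rightInvSeq hl' h5).2
  rw [← hw] at h6
  simp only [simple_mul_simple_cancel_right] at h6
  omega

theorem simple_mul_eq_mul_simple_aux {x : W} {i j : B}
    (h : cs.length x < cs.length (cs.simple i * x))
    (h1 : cs.length (cs.simple i * x) = cs.length (x * cs.simple j))
    (h2 : cs.length (cs.simple i * x * cs.simple j) = cs.length x) :
    cs.simple i * x = x * cs.simple j := by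
  obtain ⟨l, hl, rfl⟩ := cs.exists_isReduced x
  rw [← wordProd_cons] at h h1 h2
  have hm := cs.simple_mem_rightInvSeq (i :: l) j (by omega)
  rw [rightInvSeq, List.mem_cons] at hm
  rcases hm with hm | hm
  · rw [hm]; group
  · exfalso
    obtain ⟨k, hk, hk'⟩ := List.getElem_of_mem hm
    have := cs.wordProd_mul_getD_rightInvSeq l k
    rw [List.getD_eq_getElem _ _ hk, hk'] at this
    rw [this] at h1
    have h3 := cs.length_wordProd_le (l.eraseIdx k)
    have h4 : cs.length (cs.wordProd l) = l.length := hl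
    have h5 := List.length_eraseIdx_le l k
    omega

theorem simple_mul_eq_mul_simple {x : W} {i j : B}
    (h1 : cs.length (cs.simple i * x) = cs.length (x * cs.simple j))
    (h2 : cs.length (cs.simple i * x * cs.simple j) = cs.length x) :
    cs.simple i * x = x * cs.simple j := by
  rcases lt_or_gt_of_ne (cs.length_simple_mul_ne x i) with h | h
  · have := cs.simple_mul_eq_mul_simple_aux (x := cs.simple i * x) (i := i) (j := j)
      (by simpa using h) (by simp [h2]) (by simp [h1])
    rw [simple_mul_simple_cancel_left] at this
    rw [eq_comm]
    conv_lhs => rw [this]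
    simp
  · exact cs.simple_mul_eq_mul_simple_aux h h1 h2

end CoxeterSystem

/-! ### Restriction of right modules, twists, and the action on `Hom` and `Ext¹` -/

section RightModules

variable {C A B : Type u} [Field C] [Ring A] [Algebra C A] [Ring B] [Algebra C B]

/-- Restriction of right modules along an algebra homomorphism. -/
abbrev pull (f : A →ₐ[C] B) : ModuleCat.{u} Bᵐᵒᵖ ⥤ ModuleCat.{u} Aᵐᵒᵖ :=
  ModuleCat.restrictScalars (AlgHom.op f).toRingHom

theorem pull_map_exact (f : A →ₐ[C] B) (S : ShortComplex (ModuleCat.{u} Bᵐᵒᵖ)) (h : S.Exact) :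
    (S.map (pull f)).Exact := by
  rw [CategoryTheory.ShortComplex.ShortExact.moduleCat_exact_iff_function_exact] at h ⊢
  exact h

instance (f : A →ₐ[C] B) : Limits.PreservesFiniteLimits (pull f) :=
  (show _ ∧ _ from ((CategoryTheory.Functor.exact_tfae (pull f)).out 1 3).mp (pull_map_exact f)).1

instance (f : A →ₐ[C] B) : Limits.PreservesFiniteColimits (pull f) :=
  (show _ ∧ _ from ((CategoryTheory.Functor.exact_tfae (pull f)).out 1 3).mp (pull_map_exact f)).2

instance (f : A →ₐ[C] B) : (pull f).Linear C where
  map_smul {M N} g r := by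
    ext x
    change algebraMap C Bᵐᵒᵖ r • g x = (AlgHom.op f) (algebraMap C Aᵐᵒᵖ r) • g x
    rw [AlgHom.commutes]

/-- The restriction map `Ext¹_B(M, N) → Ext¹_A(M, N)` along `f : A → B`. -/
def extRes (f : A →ₐ[C] B) (M N : ModuleCat.{u} Bᵐᵒᵖ) :
    Abelian.Ext.{u} M N 1 →ₗ[C] Abelian.Ext.{u} ((pull f).obj M) ((pull f).obj N) 1 :=
  (pull f).mapExtLinearMap C M N 1

/-- The right action `m ↦ m b` of `b ∈ B` on a right `B`-module. -/
def ract (M : ModuleCat.{u} Bᵐᵒᵖ) (b : B) (m : M) : M := MulOpposite.op b • m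

theorem ract_add (M : ModuleCat.{u} Bᵐᵒᵖ) (b : B) (x y : M) :
    ract M b (x + y) = ract M b x + ract M b y := smul_add _ _ _

theorem ract_ract (M : ModuleCat.{u} Bᵐᵒᵖ) (a b : B) (x : M) :
    ract M b (ract M a x) = ract M (a * b) x := by
  rw [ract, ract, smul_smul, ← MulOpposite.op_mul, ract]

theorem ract_one (M : ModuleCat.{u} Bᵐᵒᵖ) (x : M) : ract M 1 x = x := one_smul _ _

variable (C A B) in
/-- An algebra `A` with an action of a group `G`, mapping to an algebra `B` in which the action of
`G` is realised by conjugation by units. -/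
structure ConjPair (G : Type u) [Group G] where
  /-- the map `A → B` -/
  incl : A →ₐ[C] B
  /-- the units of `B` attached to the elements of `G` -/
  unit : G →* Bˣ
  /-- the action of `G` on `A` -/
  conj : G →* (A ≃ₐ[C] A)
  compat : ∀ g a, incl (conj g a) = unit g * incl a * ((unit g)⁻¹ : Bˣ)

namespace ConjPair

variable {G : Type u} [Group G] (P : ConjPair C A B G)

theorem compat' (g : G) (a : A) : incl P a * ((P.unit g)⁻¹ : Bˣ) =
    ((P.unit g)⁻¹ : Bˣ) * P.incl (P.conj g a) := by
  rw [P.compat, mul_assoc, Units.inv_mul_cancel_left]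

/-- The map `m ↦ m g⁻¹`, an isomorphism of right `A`-modules from `M` onto `M` with the action
twisted by `g`, that is, with `a` acting by `g a g⁻¹`. -/
def twistEquiv (g : G) (M : ModuleCat.{u} Bᵐᵒᵖ) : ((pull P.incl).obj M) ≃ₗ[Aᵐᵒᵖ]
    ((pull (P.conj g : A →ₐ[C] A)).obj ((pull P.incl).obj M)) where
  toFun m := ract M ((P.unit g)⁻¹ : Bˣ) m
  invFun m := ract M (P.unit g : Bˣ) m
  map_add' x y := ract_add M _ x y
  map_smul' a x := by
    have key : ∀ y : M, ract M ((P.unit g)⁻¹ : Bˣ) (ract M (P.incl a.unop) y) =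
        ract M (P.incl (P.conj g a.unop)) (ract M ((P.unit g)⁻¹ : Bˣ) y) := fun y => by
      rw [ract_ract, ract_ract, P.compat']
    exact key x
  left_inv x := by
    have key : ∀ y : M, ract M (P.unit g : Bˣ) (ract M ((P.unit g)⁻¹ : Bˣ) y) = y := fun y => by
      rw [ract_ract, Units.inv_mul, ract_one]
    exact key x
  right_inv x := by
    have key : ∀ y : M, ract M ((P.unit g)⁻¹ : Bˣ) (ract M (P.unit g : Bˣ) y) = y := fun y => by
      rw [ract_ract, Units.mul_inv, ract_one]
    exact key x

/-- The isomorphism `m ↦ m g⁻¹` of `M` onto its twist, in the category of right `A`-modules. -/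
def twistIso (g : G) (M : ModuleCat.{u} Bᵐᵒᵖ) : (pull P.incl).obj M ≅
    (pull (P.conj g : A →ₐ[C] A)).obj ((pull P.incl).obj M) :=
  (P.twistEquiv g M).toModuleIso

/-- The right action of `g ∈ G` on `Ext¹_A(M, N)` for right `B`-modules `M`, `N`: twist an
extension by `g`, and identify the twists of `M` and `N` with `M` and `N` through `m ↦ m g⁻¹`.
In degree zero this is `(f g)(m) = f(m g⁻¹) g`. -/
def extAct (g : G) (M N : ModuleCat.{u} Bᵐᵒᵖ) :
    Abelian.Ext.{u} ((pull P.incl).obj M) ((pull P.incl).obj N) 1 →ₗ[C]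
      Abelian.Ext.{u} ((pull P.incl).obj M) ((pull P.incl).obj N) 1 :=
  (Abelian.Ext.precompOfLinear (Abelian.Ext.mk₀ (P.twistIso g M).hom) C
      ((pull P.incl).obj N) (zero_add 1)).comp
    ((Abelian.Ext.postcompOfLinear (Abelian.Ext.mk₀ (P.twistIso g N).inv) C
        ((pull (P.conj g : A →ₐ[C] A)).obj ((pull P.incl).obj M)) (add_zero 1)).comp
      (extRes (P.conj g : A →ₐ[C] A) ((pull P.incl).obj M) ((pull P.incl).obj N)))

/-- The `G`-invariants `Ext¹_A(M, N)^G`. -/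
def extInvariants (M N : ModuleCat.{u} Bᵐᵒᵖ) :
    Submodule C (Abelian.Ext.{u} ((pull P.incl).obj M) ((pull P.incl).obj N) 1) :=
  ⨅ g : G, LinearMap.eqLocus (P.extAct g M N) LinearMap.id

/-- The left action of `G` on `Hom_A(M, N)` attached to the right action
`(f g)(m) = f(m g⁻¹) g`, that is, `(g f)(m) = f(m g) g⁻¹`. -/
def homRep (M N : ModuleCat.{u} Bᵐᵒᵖ) :
    Representation C G ((pull P.incl).obj M ⟶ (pull P.incl).obj N) where
  toFun g :=
    { toFun := fun f => (P.twistIso g⁻¹ M).hom ≫ (pull (P.conj g⁻¹ : A →ₐ[C] A)).map f ≫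
        (P.twistIso g⁻¹ N).inv
      map_add' := fun f f' => by simp
      map_smul' := fun r f => by simp [Functor.map_smul] }
  map_one' := by
    ext f x
    have key : ∀ (F : M → N) (y : M),
        ract N (P.unit (1⁻¹) : Bˣ) (F (ract M ((P.unit (1⁻¹))⁻¹ : Bˣ) y)) = F y := by
      simp [ract_one]
    exact key f.hom x
  map_mul' g h := by
    ext f x
    have key : ∀ (F : M → N) (y : M),
        ract N (P.unit ((g * h)⁻¹) : Bˣ) (F (ract M ((P.unit ((g * h)⁻¹))⁻¹ : Bˣ) y)) =
          ract N (P.unit (g⁻¹) : Bˣ) (ract N (P.unit (h⁻¹) : Bˣ) (F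
            (ract M ((P.unit (h⁻¹))⁻¹ : Bˣ) (ract M ((P.unit (g⁻¹))⁻¹ : Bˣ) y)))) := by
      intro F y
      rw [ract_ract, ract_ract]
      simp
    exact key f.hom x

theorem homRep_apply (M N : ModuleCat.{u} Bᵐᵒᵖ) (g : G)
    (f : (pull P.incl).obj M ⟶ (pull P.incl).obj N) (x : M) :
    (P.homRep M N g f).hom x = ract N ((P.unit g)⁻¹ : Bˣ) (f.hom (ract M (P.unit g : Bˣ) x)) := by
  have key : ∀ (F : M → N), ract N (P.unit (g⁻¹) : Bˣ) (F (ract M ((P.unit (g⁻¹))⁻¹ : Bˣ) x)) =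
      ract N ((P.unit g)⁻¹ : Bˣ) (F (ract M (P.unit g : Bˣ) x)) := by
    intro F; simp
  exact key f.hom

/-- The underlying map `M → N` of an `A`-linear map between right `B`-modules. -/
def mapFun {M N : ModuleCat.{u} Bᵐᵒᵖ} (f : (pull P.incl).obj M ⟶ (pull P.incl).obj N) : M → N :=
  fun m => f.hom m

end ConjPair

/-- The right `B`-module `N ⊗_A B` induced from a right module `N` over a subalgebra `A` of `B`:
the quotient of `B ⊗_ℤ N` by the relations `a b ⊗ n = b ⊗ n a`. -/
def induced (A : Subalgebra C B) (N : ModuleCat.{u} Aᵐᵒᵖ) : ModuleCat.{u} Bᵐᵒᵖ :=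
  ModuleCat.of Bᵐᵒᵖ ((B ⊗[ℤ] N) ⧸ (Submodule.span Bᵐᵒᵖ
    {x : B ⊗[ℤ] N | ∃ (a : A) (b : B) (n : N), x = ((a : B) * b) ⊗ₜ[ℤ] n - b ⊗ₜ[ℤ] ract N a n}))

end RightModules

/-- The combinatorial data `(W_aff, S_aff, Ω, W, W(1), Z_κ)` together with the parameters `(q, c)`
over `C`.  Here `S_aff` is indexed by `B`, `W = W_aff ⋊ Ω`, and `W(1)` is written `W1`. -/
structure GenericDatum (C B Waff Ω Zk W1 : Type u) [CommRing C] [Group Waff] [Group Ω]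
    [CommGroup Zk] [Group W1] where
  /-- the Coxeter matrix of `(W_aff, S_aff)` -/
  M : CoxeterMatrix B
  /-- the Coxeter system `(W_aff, S_aff)` -/
  cs : CoxeterSystem M Waff
  /-- the action of `Ω` on `W_aff` -/
  act : Ω →* MulAut Waff
  /-- `Ω` preserves `S_aff` -/
  act_simple : ∀ (o : Ω) (i : B), ∃ j : B, act o (cs.simple i) = cs.simple j
  /-- the extension `1 → Z_κ → W(1) → W → 1` -/
  ext : GroupExtension Zk W1 (Waff ⋊[act] Ω)
  /-- the parameter `q` on `S_aff` -/
  q : B → C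
  q_conj : ∀ (w : Waff ⋊[act] Ω) (i j : B),
    w * SemidirectProduct.inl (cs.simple i) * w⁻¹ = SemidirectProduct.inl (cs.simple j) → q j = q i
  /-- the parameter `c`; only its values on the inverse image in `W(1)` of the set of reflections
  of `W_aff` matter -/
  c : W1 → MonoidAlgebra C Zk
  c_conj : ∀ (w s : W1), (∃ r, cs.IsReflection r ∧ ext.rightHom s = SemidirectProduct.inl r) →
    c (w * s * w⁻¹) = MonoidAlgebra.mapDomain (ext.conjAct w) (c s)
  c_mul : ∀ (t : Zk) (s : W1), (∃ r, cs.IsReflection r ∧ ext.rightHom s = SemidirectProduct.inl r) →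
    c (ext.inl t * s) = MonoidAlgebra.single t 1 * c s

namespace GenericDatum

variable {C B Waff Ω Zk W1 : Type u} [CommRing C] [Group Waff] [Group Ω] [CommGroup Zk] [Group W1]
  (D : GenericDatum C B Waff Ω Zk W1)

/-- The inclusion `Z_κ → W(1)`. -/
abbrev z : Zk →* W1 := D.ext.inl

/-- The projection `W(1) → W`. -/
abbrev pr : W1 →* Waff ⋊[D.act] Ω := D.ext.rightHom

/-- The length function of `W_aff`, inflated to `W(1)`. -/
def len (w : W1) : ℕ := D.cs.length (D.pr w).left

/-- `s ∈ W(1)` is a lift of the simple reflection with index `i`. -/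
def IsLift (i : B) (s : W1) : Prop := D.pr s = SemidirectProduct.inl (D.cs.simple i)

/-- `Ω(1)`, the inverse image of `Ω` in `W(1)`. -/
def Omega1 : Subgroup W1 := (SemidirectProduct.inr : Ω →* Waff ⋊[D.act] Ω).range.comap D.pr

/-- The projection `W(1) → W → Ω`. -/
def toOmega : W1 →* Ω := (SemidirectProduct.rightHom : Waff ⋊[D.act] Ω →* Ω).comp D.pr

/-- `W^aff(1)`, the inverse image of `W_aff` in `W(1)`. -/
def Waff1 : Subgroup W1 := (SemidirectProduct.inl : Waff →* Waff ⋊[D.act] Ω).range.comap D.pr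

/-- The image of an element of `C[Z_κ]` in the free algebra on the symbols `T_w`. -/
def freeZ (a : MonoidAlgebra C Zk) : FreeAlgebra C W1 :=
  a.coeff.sum fun t r => r • FreeAlgebra.ι C (D.z t)

/-- The defining relations of the generic algebra (with `T_1 = 1` and `T_w` the generators). -/
inductive Rel : FreeAlgebra C W1 → FreeAlgebra C W1 → Prop
  | one : Rel (FreeAlgebra.ι C 1) 1
  | quadratic (i : B) (s : W1) (hs : D.IsLift i s) :
      Rel (FreeAlgebra.ι C s * FreeAlgebra.ι C s)
        (D.q i • FreeAlgebra.ι C (s * s) + D.freeZ (D.c s) * FreeAlgebra.ι C s)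
  | braid (v w : W1) (h : D.len (v * w) = D.len v + D.len w) :
      Rel (FreeAlgebra.ι C (v * w)) (FreeAlgebra.ι C v * FreeAlgebra.ι C w)

/-- The generic algebra `ℋ`.  It is a free `C`-module with basis `(T_w)`, see
`GenericDatum.basis`. -/
def Hecke : Type u := RingQuot D.Rel

instance : Ring D.Hecke := inferInstanceAs (Ring (RingQuot D.Rel))

instance : Algebra C D.Hecke := inferInstanceAs (Algebra C (RingQuot D.Rel))

/-- The projection from the free algebra. -/
def proj : FreeAlgebra C W1 →ₐ[C] D.Hecke := RingQuot.mkAlgHom C D.Rel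

theorem proj_surjective : Function.Surjective D.proj := RingQuot.mkAlgHom_surjective C D.Rel

theorem proj_rel {x y : FreeAlgebra C W1} (h : D.Rel x y) : D.proj x = D.proj y :=
  RingQuot.mkAlgHom_rel C h

/-- The element `T_w` of `ℋ`. -/
def T (w : W1) : D.Hecke := D.proj (FreeAlgebra.ι C w)

/-! ### Elementary facts on lengths -/

theorem pr_z (t : Zk) : D.pr (D.z t) = 1 := D.ext.rightHom_inl t

theorem len_z_mul (t : Zk) (w : W1) : D.len (D.z t * w) = D.len w := by
  simp [len]

theorem len_mul_left_lift {i : B} {s : W1} (hs : D.IsLift i s) (w : W1) :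
    D.len (s * w) = D.cs.length (D.cs.simple i * (D.pr w).left) := by
  rw [len, map_mul, hs]; simp

theorem exists_lift (i : B) : ∃ s, D.IsLift i s := D.ext.rightHom_surjective _

theorem len_lift_mul {i : B} {s : W1} (hs : D.IsLift i s) (w : W1) :
    D.len (s * w) = D.len w + 1 ∨ D.len (s * w) + 1 = D.len w := by
  rw [len_mul_left_lift D hs]
  exact D.cs.length_simple_mul _ _

theorem left_mul_lift {i : B} {s : W1} (hs : D.IsLift i s) (w : W1) :
    ∃ j, D.act (D.pr w).right (D.cs.simple i) = D.cs.simple j ∧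
      (D.pr (w * s)).left = (D.pr w).left * D.cs.simple j := by
  obtain ⟨j, hj⟩ := D.act_simple (D.pr w).right i
  refine ⟨j, hj, ?_⟩
  rw [map_mul, hs]; simp [hj]

theorem len_mul_lift {i : B} {s : W1} (hs : D.IsLift i s) (w : W1) :
    D.len (w * s) = D.len w + 1 ∨ D.len (w * s) + 1 = D.len w := by
  obtain ⟨j, -, hj⟩ := D.left_mul_lift hs w
  rw [len, hj]
  exact D.cs.length_mul_simple _ _

theorem mem_Omega1 {w : W1} : w ∈ D.Omega1 ↔ (D.pr w).left = 1 := by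
  constructor
  · rintro ⟨o, ho⟩
    rw [← ho]; simp
  · intro h
    refine ⟨(D.pr w).right, ?_⟩
    ext <;> simp [h]

theorem mem_Waff1 {w : W1} : w ∈ D.Waff1 ↔ D.toOmega w = 1 := by
  constructor
  · rintro ⟨o, ho⟩
    simp [toOmega, ← ho]
  · intro h
    refine ⟨(D.pr w).left, ?_⟩
    simp only [toOmega, MonoidHom.comp_apply, SemidirectProduct.rightHom_eq_right] at h
    ext <;> simp [h]

theorem len_eq_zero {w : W1} : D.len w = 0 ↔ w ∈ D.Omega1 := by
  rw [mem_Omega1, len, CoxeterSystem.length_eq_zero_iff]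

theorem length_act (o : Ω) (x : Waff) : D.cs.length (D.act o x) = D.cs.length x := by
  have key : ∀ (o : Ω) (x : Waff), D.cs.length (D.act o x) ≤ D.cs.length x := by
    intro o x
    obtain ⟨l, hl, rfl⟩ := D.cs.exists_isReduced x
    choose f hf using D.act_simple o
    have : D.act o (D.cs.wordProd l) = D.cs.wordProd (l.map f) := by
      clear hl
      induction l with
      | nil => simp
      | cons i l ih => simp [CoxeterSystem.wordProd_cons, hf, ih]
    rw [this, hl.eq]
    exact (D.cs.length_wordProd_le _).trans (by simp)
  refine le_antisymm (key o x) ?_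
  have := key o⁻¹ (D.act o x)
  simpa using this

theorem len_mul_le (v w : W1) : D.len (v * w) ≤ D.len v + D.len w := by
  rw [len, map_mul, SemidirectProduct.mul_left]
  refine (D.cs.length_mul_le _ _).trans ?_
  rw [length_act, len, len]

theorem len_Omega1_mul {u : W1} (hu : u ∈ D.Omega1) (w : W1) : D.len (u * w) = D.len w := by
  rw [mem_Omega1] at hu
  simp [len, hu, length_act]

theorem len_mul_Omega1 {u : W1} (hu : u ∈ D.Omega1) (w : W1) : D.len (w * u) = D.len w := by
  rw [mem_Omega1] at hu
  simp [len, hu]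

theorem z_mem_Omega1 (t : Zk) : D.z t ∈ D.Omega1 := by
  rw [mem_Omega1, pr_z]; simp

theorem z_mem_Waff1 (t : Zk) : D.z t ∈ D.Waff1 := by
  rw [mem_Waff1, toOmega, MonoidHom.comp_apply, pr_z]; simp

theorem exists_z_mul {v w : W1} (h : D.pr v = D.pr w) : ∃ t, v = D.z t * w := by
  have : v * w⁻¹ ∈ D.ext.rightHom.ker := by
    rw [MonoidHom.mem_ker, map_mul, map_inv, mul_inv_eq_one]; exact h
  rw [← D.ext.range_inl_eq_ker_rightHom] at this
  obtain ⟨t, ht⟩ := this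
  exact ⟨t, by rw [ht]; simp⟩

theorem exists_left_descent {w : W1} (h : D.len w ≠ 0) :
    ∃ i s v, D.IsLift i s ∧ w = s * v ∧ D.len w = D.len v + 1 := by
  have h1 : (D.pr w).left ≠ 1 := by
    intro h2; apply h; rw [len, h2, CoxeterSystem.length_one]
  obtain ⟨i, hi⟩ := D.cs.exists_leftDescent_of_ne_one h1
  obtain ⟨s, hs⟩ := D.exists_lift i
  have hs' : D.IsLift i s⁻¹ := by
    rw [IsLift, map_inv, hs, ← map_inv, CoxeterSystem.inv_simple]
  refine ⟨i, s, s⁻¹ * w, hs, by simp, ?_⟩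
  rw [len_mul_left_lift D hs']
  have := D.cs.isLeftDescent_iff.mp hi
  rw [len]; omega

theorem exists_right_descent {w : W1} (h : D.len w ≠ 0) :
    ∃ i s v, D.IsLift i s ∧ w = v * s ∧ D.len w = D.len v + 1 := by
  have h1 : (D.pr w).left ≠ 1 := by
    intro h2; apply h; rw [len, h2, CoxeterSystem.length_one]
  obtain ⟨i, hi⟩ := D.cs.exists_rightDescent_of_ne_one h1
  obtain ⟨j, hj⟩ := D.act_simple (D.pr w).right⁻¹ i
  obtain ⟨s, hs⟩ := D.exists_lift j
  have hs' : D.IsLift j s⁻¹ := by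
    rw [IsLift, map_inv, hs, ← map_inv, CoxeterSystem.inv_simple]
  refine ⟨j, s, w * s⁻¹, hs, by simp, ?_⟩
  obtain ⟨k, hk, hk'⟩ := D.left_mul_lift hs' w
  have h2 : D.cs.simple k = D.cs.simple i := by
    rw [← hk, ← hj]; simp
  rw [len, len, hk', h2]
  have := D.cs.isRightDescent_iff.mp hi
  omega

/-! ### The regular representation, and the basis theorem -/

theorem isLift_refl {i : B} {s : W1} (hs : D.IsLift i s) (w : W1) :
    ∃ r, D.cs.IsReflection r ∧ D.ext.rightHom (w * s * w⁻¹) = SemidirectProduct.inl r := by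
  obtain ⟨j, hj⟩ := D.act_simple (D.pr w).right i
  refine ⟨(D.pr w).left * D.cs.simple j * (D.pr w).left⁻¹, ⟨_, _, rfl⟩, ?_⟩
  have : D.ext.rightHom s = SemidirectProduct.inl (D.cs.simple i) := hs
  rw [map_mul, map_mul, map_inv, this]
  ext
  · simp [hj]
  · simp

theorem isLift_refl' {i : B} {s : W1} (hs : D.IsLift i s) :
    ∃ r, D.cs.IsReflection r ∧ D.ext.rightHom s = SemidirectProduct.inl r := by
  simpa using D.isLift_refl hs 1

theorem eq_of_len {i j : B} {s r w : W1} (hs : D.IsLift i s) (hr : D.IsLift j r)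
    (h1 : D.len (s * w) = D.len (w * r)) (h2 : D.len (s * w * r) = D.len w) :
    ∃ t, s * w = D.z t * (w * r) := by
  apply D.exists_z_mul
  obtain ⟨k, hk, hk'⟩ := D.left_mul_lift hr w
  have e1 : (D.pr (s * w)).left = D.cs.simple i * (D.pr w).left := by
    rw [map_mul, hs]; simp
  obtain ⟨k2, hk2, hk2'⟩ := D.left_mul_lift hr (s * w)
  have e2 : D.cs.simple k2 = D.cs.simple k := by
    rw [← hk2, ← hk, map_mul, hs]; simp
  have := D.cs.simple_mul_eq_mul_simple (x := (D.pr w).left) (i := i) (j := k)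
    (by rw [len, len, e1, hk'] at h1; exact h1)
    (by rw [len, len, hk2', e1, e2] at h2; exact h2)
  ext
  · rw [e1, hk', this]
  · rw [map_mul, map_mul, hs, hr]; simp

/-- The free module on `W(1)`. -/
abbrev Free (_ : GenericDatum C B Waff Ω Zk W1) : Type u := W1 →₀ C

/-- Left translation on the free module. -/
def lam : W1 →* Module.End C D.Free where
  toFun g := Finsupp.lmapDomain C C (g * ·)
  map_one' := by ext; simp
  map_mul' a b := by ext; simp [mul_assoc]

/-- Right translation on the free module. -/
def rho (g : W1) : Module.End C D.Free := Finsupp.lmapDomain C C (· * g)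

/-- The action of `C[Z_κ]` on the free module. -/
def Zl : MonoidAlgebra C Zk →ₐ[C] Module.End C D.Free :=
  MonoidAlgebra.lift C _ _ (D.lam.comp D.z)

open Classical in
/-- Left multiplication by `T_s`. -/
def Lop (i : B) (s : W1) : Module.End C D.Free :=
  Finsupp.linearCombination C fun w => if D.len w < D.len (s * w) then Finsupp.single (s * w) 1
    else D.q i • Finsupp.single (s * w) 1 + D.Zl (D.c s) (Finsupp.single w 1)

open Classical in
/-- Right multiplication by `T_r`. -/
def Rop (j : B) (r : W1) : Module.End C D.Free :=
  Finsupp.linearCombination C fun w => if D.len w < D.len (w * r) then Finsupp.single (w * r) 1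
    else D.q j • Finsupp.single (w * r) 1 + D.Zl (D.c (w * r * w⁻¹)) (Finsupp.single w 1)

@[simp] theorem lam_single (g w : W1) (a : C) :
    D.lam g (Finsupp.single w a) = Finsupp.single (g * w) a := by simp [lam]

@[simp] theorem rho_single (g w : W1) (a : C) :
    D.rho g (Finsupp.single w a) = Finsupp.single (w * g) a := by simp [rho]

theorem Zl_single (t : Zk) (a : C) : D.Zl (MonoidAlgebra.single t a) = a • D.lam (D.z t) := by
  simp [Zl]

theorem Zl_rho (a : MonoidAlgebra C Zk) (g : W1) (x : D.Free) :
    D.Zl a (D.rho g x) = D.rho g (D.Zl a x) := by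
  induction a using MonoidAlgebra.induction_linear with
  | zero => simp
  | add f g hf hg => simp [hf, hg]
  | single t r =>
    induction x using Finsupp.induction_linear with
    | zero => simp
    | add f g hf hg => simp only [map_add, hf, hg]
    | single w b => simp only [Zl_single, LinearMap.smul_apply, rho_single, lam_single, map_smul,
        mul_assoc]

theorem lam_Zl (a : MonoidAlgebra C Zk) (g : W1) (x : D.Free) :
    D.lam g (D.Zl a x) = D.Zl (MonoidAlgebra.mapDomain (D.ext.conjAct g) a) (D.lam g x) := by
  induction a using MonoidAlgebra.induction_linear with
  | zero => simp
  | add f g hf hg => simp [hf, hg, MonoidAlgebra.mapDomain_add]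
  | single t r =>
    induction x using Finsupp.induction_linear with
    | zero => simp
    | add f g hf hg => simp only [map_add, hf, hg]
    | single w b =>
      simp only [Zl_single, MonoidAlgebra.mapDomain_single, LinearMap.smul_apply, lam_single,
        map_smul, D.ext.inl_conjAct_comm]
      congr 2; group

theorem Zl_comm (a b : MonoidAlgebra C Zk) (x : D.Free) :
    D.Zl a (D.Zl b x) = D.Zl b (D.Zl a x) := by
  rw [← Module.End.mul_apply, ← map_mul, mul_comm, map_mul, Module.End.mul_apply]

theorem Lop_up (i : B) {s w : W1} (h : D.len w < D.len (s * w)) :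
    D.Lop i s (Finsupp.single w 1) = Finsupp.single (s * w) 1 := by
  simp [Lop, h]

theorem Lop_down (i : B) {s w : W1} (h : D.len (s * w) < D.len w) :
    D.Lop i s (Finsupp.single w 1) =
      D.q i • Finsupp.single (s * w) 1 + D.Zl (D.c s) (Finsupp.single w 1) := by
  rw [Lop, Finsupp.linearCombination_single, if_neg (by omega), one_smul]

theorem Rop_up (i : B) {s w : W1} (h : D.len w < D.len (w * s)) :
    D.Rop i s (Finsupp.single w 1) = Finsupp.single (w * s) 1 := by
  simp [Rop, h]

theorem Rop_down (i : B) {s w : W1} (h : D.len (w * s) < D.len w) :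
    D.Rop i s (Finsupp.single w 1) =
      D.q i • Finsupp.single (w * s) 1 + D.Zl (D.c (w * s * w⁻¹)) (Finsupp.single w 1) := by
  rw [Rop, Finsupp.linearCombination_single, if_neg (by omega), one_smul]

theorem mul_z (s : W1) (t : Zk) (w : W1) :
    s * (D.z t * w) = D.z (D.ext.conjAct s t) * (s * w) := by
  rw [D.ext.inl_conjAct_comm]; group

theorem Lop_Zl_up (i : B) {s w : W1} (h : D.len w < D.len (s * w)) (a : MonoidAlgebra C Zk) :
    D.Lop i s (D.Zl a (Finsupp.single w 1)) =
      D.Zl (MonoidAlgebra.mapDomain (D.ext.conjAct s) a) (Finsupp.single (s * w) 1) := by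
  induction a using MonoidAlgebra.induction_linear with
  | zero => simp
  | add f g hf hg => simp only [map_add, LinearMap.add_apply, MonoidAlgebra.mapDomain_add, hf, hg]
  | single t r =>
    simp only [Zl_single, MonoidAlgebra.mapDomain_single, LinearMap.smul_apply, lam_single, map_smul]
    rw [Lop_up, mul_z]
    rw [mul_z, len_z_mul, len_z_mul]; exact h

theorem Lop_Zl_down (i : B) {s w : W1} (h : D.len (s * w) < D.len w) (a : MonoidAlgebra C Zk) :
    D.Lop i s (D.Zl a (Finsupp.single w 1)) =
      D.q i • D.Zl (MonoidAlgebra.mapDomain (D.ext.conjAct s) a) (Finsupp.single (s * w) 1) +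
        D.Zl (D.c s) (D.Zl a (Finsupp.single w 1)) := by
  induction a using MonoidAlgebra.induction_linear with
  | zero => simp
  | add f g hf hg =>
    simp only [map_add, LinearMap.add_apply, MonoidAlgebra.mapDomain_add, hf, hg, smul_add]
    abel
  | single t r =>
    simp only [Zl_single, MonoidAlgebra.mapDomain_single, LinearMap.smul_apply, lam_single, map_smul]
    rw [Lop_down, mul_z, smul_add, smul_comm]
    rw [mul_z, len_z_mul, len_z_mul]; exact h

theorem conjAct_z (t : Zk) : D.ext.conjAct (D.z t) = 1 := by
  ext u
  apply D.ext.inl_injective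
  rw [D.ext.inl_conjAct_comm, ← map_mul, ← map_inv, ← map_mul, mul_comm t, mul_inv_cancel_right]
  rfl

theorem c_z_conj (t : Zk) {s : W1}
    (hs : ∃ r, D.cs.IsReflection r ∧ D.ext.rightHom s = SemidirectProduct.inl r) :
    D.c (D.z t * s * (D.z t)⁻¹) = D.c s := by
  rw [D.c_conj _ _ hs, conjAct_z]
  ext; simp [MonoidAlgebra.mapDomain]

theorem Rop_lam_z (j : B) {r : W1} (hr : D.IsLift j r) (t : Zk) (w : W1) :
    D.Rop j r (Finsupp.single (D.z t * w) 1) =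
      D.lam (D.z t) (D.Rop j r (Finsupp.single w 1)) := by
  rcases D.len_mul_lift hr w with h | h
  · rw [D.Rop_up j (w := w) (by omega), Rop_up, lam_single, mul_assoc]
    rw [mul_assoc, len_z_mul, len_z_mul]; omega
  · rw [D.Rop_down j (w := w) (by omega), Rop_down, map_add, map_smul, lam_single, lam_Zl,
      lam_single, conjAct_z, mul_assoc]
    · congr 2
      have h1 : D.z t * (w * r) * (D.z t * w)⁻¹ = D.z t * (w * r * w⁻¹) * (D.z t)⁻¹ := by group
      rw [h1, c_z_conj _ _ (D.isLift_refl hr w)]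
      congr 1
      ext; simp [MonoidAlgebra.mapDomain]
    · rw [mul_assoc, len_z_mul, len_z_mul]; omega

theorem Rop_Zl (j : B) {r : W1} (hr : D.IsLift j r) (a : MonoidAlgebra C Zk) (w : W1) :
    D.Rop j r (D.Zl a (Finsupp.single w 1)) = D.Zl a (D.Rop j r (Finsupp.single w 1)) := by
  induction a using MonoidAlgebra.induction_linear with
  | zero => simp
  | add f g hf hg => simp only [map_add, LinearMap.add_apply, hf, hg]
  | single t b =>
    simp only [Zl_single, LinearMap.smul_apply, lam_single, map_smul, Rop_lam_z D j hr]

theorem Lop_Rop (i j : B) {s r : W1} (hs : D.IsLift i s) (hr : D.IsLift j r) :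
    D.Lop i s * D.Rop j r = D.Rop j r * D.Lop i s := by
  ext w : 1
  apply LinearMap.ext_ring
  simp only [LinearMap.comp_apply, Finsupp.lsingle_apply, Module.End.mul_apply]
  have hx := D.isLift_refl hr w
  have hcx : D.c (s * w * r * (s * w)⁻¹) =
      MonoidAlgebra.mapDomain (D.ext.conjAct s) (D.c (w * r * w⁻¹)) := by
    rw [← D.c_conj _ _ hx]; congr 1; group
  have special : D.len (s * w) = D.len (w * r) → D.len (s * w * r) = D.len w →
      D.q i = D.q j ∧ D.Zl (D.c s) (Finsupp.single (w * r) 1) =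
        D.Zl (D.c (s * w * r * (s * w)⁻¹)) (Finsupp.single (s * w) 1) := by
    intro h1 h2
    obtain ⟨t, ht⟩ := D.eq_of_len hs hr h1 h2
    have hs' : s = D.z t * (w * r * w⁻¹) := by
      rw [← mul_assoc, ← mul_assoc, mul_assoc (D.z t) w r, ← ht]; group
    constructor
    · refine D.q_conj (D.pr w) j i ?_
      have h3 : D.pr s = SemidirectProduct.inl (D.cs.simple i) := hs
      have h4 : D.pr r = SemidirectProduct.inl (D.cs.simple j) := hr
      rw [← h3, ← h4, hs']
      simp
    · have h5 : s * w * r * (s * w)⁻¹ = D.z t * (w * r * w⁻¹) * (D.z t)⁻¹ := by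
        rw [ht]; group
      rw [h5, c_z_conj _ _ hx, ht]
      conv_lhs => rw [hs', D.c_mul _ _ hx, mul_comm, map_mul, Module.End.mul_apply, Zl_single]
      simp
  have ha : s * (w * r) = s * w * r := (mul_assoc _ _ _).symm
  rcases D.len_lift_mul hs w with h1 | h1 <;> rcases D.len_mul_lift hr w with h2 | h2 <;>
    rcases D.len_mul_lift hr (s * w) with h3 | h3
  · rw [D.Lop_up i (by omega), D.Rop_up j (by omega), D.Lop_up i (by rw [ha]; omega),
      D.Rop_up j (by omega), ha]
  · obtain ⟨hq, hc⟩ := special (by omega) (by omega)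
    rw [D.Lop_up i (by omega), D.Rop_up j (by omega), D.Lop_down i (by rw [ha]; omega),
      D.Rop_down j (by omega), ha, hc, hq]
  · have := D.len_lift_mul hs (w * r)
    rw [ha] at this
    omega
  · rw [D.Lop_up i (by omega), D.Rop_down j (by omega), map_add, map_smul,
      D.Lop_up i (by rw [ha]; omega), D.Rop_down j (by omega), D.Lop_Zl_up i (by omega),
      hcx, ha]
  · rw [D.Rop_up j (by omega), D.Lop_down i (w := w * r) (by rw [ha]; omega),
      D.Lop_down i (w := w) (by omega), map_add, map_smul, D.Rop_up j (by omega),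
      D.Rop_Zl j hr, D.Rop_up j (by omega), ha]
  · have := D.len_lift_mul hs (w * r)
    rw [ha] at this
    omega
  · obtain ⟨hq, hc⟩ := special (by omega) (by omega)
    rw [D.Rop_down j (w := w) (by omega), D.Lop_down i (w := w) (by omega), map_add, map_add,
      map_smul, map_smul, D.Rop_up j (by omega), D.Rop_Zl j hr, D.Rop_down j (by omega),
      D.Lop_up i (by rw [ha]; omega), D.Lop_Zl_down i (by omega), ← hcx, map_add, map_smul, hc, hq,
      ha]
  · rw [D.Rop_down j (w := w) (by omega), D.Lop_down i (w := w) (by omega), map_add, map_add,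
      map_smul, map_smul, D.Rop_down j (w := s * w) (by omega), D.Rop_Zl j hr,
      D.Rop_down j (w := w) (by omega), D.Lop_down i (w := w * r) (by rw [ha]; omega),
      D.Lop_Zl_down i (by omega), ← hcx, map_add, map_smul, ha, smul_add, smul_add,
      smul_comm (D.q i) (D.q j)]
    abel

/-- The operators of left multiplication by the `T_s` and the `T_u` with `u ∈ Ω(1)` generate the
image of the regular representation. -/
def regAlg : Subalgebra C (Module.End C D.Free) :=
  Algebra.adjoin C ({x | ∃ i s, D.IsLift i s ∧ x = D.Lop i s} ∪ {x | ∃ u ∈ D.Omega1, x = D.lam u})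

theorem regAlg_comm_Rop {a : Module.End C D.Free} (ha : a ∈ D.regAlg) {j : B} {r : W1}
    (hr : D.IsLift j r) : a * D.Rop j r = D.Rop j r * a := by
  have : D.regAlg ≤ Subalgebra.centralizer C {D.Rop j r} := by
    refine Algebra.adjoin_le ?_
    rintro x (⟨i, s, hs, rfl⟩ | ⟨u, hu, rfl⟩)
    · rw [SetLike.mem_coe, Subalgebra.mem_centralizer_iff]
      rintro _ rfl
      exact (D.Lop_Rop i j hs hr).symm
    · rw [SetLike.mem_coe, Subalgebra.mem_centralizer_iff]
      rintro _ rfl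
      ext w : 1
      apply LinearMap.ext_ring
      simp only [LinearMap.comp_apply, Finsupp.lsingle_apply, Module.End.mul_apply, lam_single]
      have h1 := D.len_Omega1_mul hu w
      have h2 := D.len_Omega1_mul hu (w * r)
      rw [← mul_assoc] at h2
      rcases D.len_mul_lift hr w with h | h
      · rw [D.Rop_up j (by omega), D.Rop_up j (by omega), lam_single, mul_assoc]
      · rw [D.Rop_down j (by omega), D.Rop_down j (by omega), map_add, map_smul, lam_single, lam_Zl,
          ← D.c_conj _ _ (D.isLift_refl hr w), lam_single, mul_assoc]
        have e : u * (w * r * w⁻¹) * u⁻¹ = u * w * r * (u * w)⁻¹ := by group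
        rw [e, mul_assoc u w r]
  have := (Subalgebra.mem_centralizer_iff C).mp (this ha) _ rfl
  exact this.symm

theorem regAlg_comm_rho {a : Module.End C D.Free} (ha : a ∈ D.regAlg) {u : W1}
    (hu : u ∈ D.Omega1) : a * D.rho u = D.rho u * a := by
  have : D.regAlg ≤ Subalgebra.centralizer C {D.rho u} := by
    refine Algebra.adjoin_le ?_
    rintro x (⟨i, s, hs, rfl⟩ | ⟨v, hv, rfl⟩)
    · rw [SetLike.mem_coe, Subalgebra.mem_centralizer_iff]
      rintro _ rfl
      ext w : 1
      apply LinearMap.ext_ring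
      simp only [LinearMap.comp_apply, Finsupp.lsingle_apply, Module.End.mul_apply, rho_single]
      have h1 := D.len_mul_Omega1 hu w
      have h2 := D.len_mul_Omega1 hu (s * w)
      rw [mul_assoc] at h2
      rcases D.len_lift_mul hs w with h | h
      · rw [D.Lop_up i (by omega), D.Lop_up i (by omega), rho_single, mul_assoc]
      · rw [D.Lop_down i (by omega), D.Lop_down i (by omega), map_add, map_smul, rho_single,
          ← Zl_rho, rho_single, mul_assoc]
    · rw [SetLike.mem_coe, Subalgebra.mem_centralizer_iff]
      rintro _ rfl
      ext w : 1
      apply LinearMap.ext_ring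
      simp [mul_assoc]
  have := (Subalgebra.mem_centralizer_iff C).mp (this ha) _ rfl
  exact this.symm

theorem regAlg_ext {a b : Module.End C D.Free} (ha : a ∈ D.regAlg) (hb : b ∈ D.regAlg)
    (h : a (Finsupp.single 1 1) = b (Finsupp.single 1 1)) : a = b := by
  have key : ∀ (n : ℕ) (w : W1), D.len w = n →
      a (Finsupp.single w 1) = b (Finsupp.single w 1) := by
    intro n
    induction n with
    | zero =>
      intro w hw
      rw [len_eq_zero] at hw
      have h1 : (Finsupp.single w 1 : D.Free) = D.rho w (Finsupp.single 1 1) := by simp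
      rw [h1, ← Module.End.mul_apply, D.regAlg_comm_rho ha hw, ← Module.End.mul_apply,
        D.regAlg_comm_rho hb hw, Module.End.mul_apply, Module.End.mul_apply, h]
    | succ n ih =>
      intro w hw
      obtain ⟨j, r, v, hr, rfl, hv⟩ := D.exists_right_descent (w := w) (by omega)
      have h1 : (Finsupp.single (v * r) 1 : D.Free) = D.Rop j r (Finsupp.single v 1) :=
        (D.Rop_up j (by omega)).symm
      rw [h1, ← Module.End.mul_apply, D.regAlg_comm_Rop ha hr, ← Module.End.mul_apply,
        D.regAlg_comm_Rop hb hr, Module.End.mul_apply, Module.End.mul_apply, ih v (by omega)]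
  ext w : 1
  apply LinearMap.ext_ring
  exact key _ w rfl

theorem Lop_mem (i : B) {s : W1} (hs : D.IsLift i s) : D.Lop i s ∈ D.regAlg :=
  Algebra.subset_adjoin (Or.inl ⟨i, s, hs, rfl⟩)

theorem lam_mem {u : W1} (hu : u ∈ D.Omega1) : D.lam u ∈ D.regAlg :=
  Algebra.subset_adjoin (Or.inr ⟨u, hu, rfl⟩)

theorem exists_regOp (w : W1) :
    ∃ a ∈ D.regAlg, a (Finsupp.single 1 1) = Finsupp.single w 1 := by
  have key : ∀ (n : ℕ) (w : W1), D.len w = n →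
      ∃ a ∈ D.regAlg, a (Finsupp.single 1 1) = Finsupp.single w 1 := by
    intro n
    induction n with
    | zero =>
      intro w hw
      exact ⟨D.lam w, D.lam_mem (D.len_eq_zero.mp hw), by simp⟩
    | succ n ih =>
      intro w hw
      obtain ⟨i, s, v, hs, rfl, hv⟩ := D.exists_left_descent (w := w) (by omega)
      obtain ⟨a, ha, ha'⟩ := ih v (by omega)
      refine ⟨D.Lop i s * a, mul_mem (D.Lop_mem i hs) ha, ?_⟩
      rw [Module.End.mul_apply, ha', D.Lop_up i (by omega)]
  exact key _ w rfl

/-- The operator of left multiplication by `T_w`. -/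
def regOp (w : W1) : Module.End C D.Free := (D.exists_regOp w).choose

theorem regOp_mem (w : W1) : D.regOp w ∈ D.regAlg := (D.exists_regOp w).choose_spec.1

theorem regOp_one (w : W1) : D.regOp w (Finsupp.single 1 1) = Finsupp.single w 1 :=
  (D.exists_regOp w).choose_spec.2

theorem regOp_Omega1 {u : W1} (hu : u ∈ D.Omega1) : D.regOp u = D.lam u :=
  D.regAlg_ext (D.regOp_mem u) (D.lam_mem hu) (by simp [regOp_one])

theorem regOp_lift_mul {i : B} {s v : W1} (hs : D.IsLift i s) (h : D.len v < D.len (s * v)) :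
    D.regOp (s * v) = D.Lop i s * D.regOp v :=
  D.regAlg_ext (D.regOp_mem _) (mul_mem (D.Lop_mem i hs) (D.regOp_mem v)) (by
    rw [regOp_one, Module.End.mul_apply, regOp_one, D.Lop_up i h])

theorem regOp_single {v w : W1} (h : D.len (v * w) = D.len v + D.len w) :
    D.regOp v (Finsupp.single w 1) = Finsupp.single (v * w) 1 := by
  have key : ∀ (n : ℕ) (v : W1), D.len v = n → D.len (v * w) = D.len v + D.len w →
      D.regOp v (Finsupp.single w 1) = Finsupp.single (v * w) 1 := by
    intro n
    induction n with
    | zero =>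
      intro v hv _
      rw [D.regOp_Omega1 (D.len_eq_zero.mp hv), lam_single]
    | succ n ih =>
      intro v hv h
      obtain ⟨i, s, x, hs, rfl, hx⟩ := D.exists_left_descent (w := v) (by omega)
      rw [mul_assoc] at h
      have h1 := D.len_lift_mul hs (x * w)
      have h2 := D.len_mul_le x w
      rw [D.regOp_lift_mul hs (by omega), Module.End.mul_apply, ih x (by omega) (by omega),
        D.Lop_up i (by omega), mul_assoc]
  exact key _ v rfl h

theorem regOp_mul {v w : W1} (h : D.len (v * w) = D.len v + D.len w) :
    D.regOp (v * w) = D.regOp v * D.regOp w :=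
  D.regAlg_ext (D.regOp_mem _) (mul_mem (D.regOp_mem v) (D.regOp_mem w)) (by
    rw [regOp_one, Module.End.mul_apply, regOp_one, D.regOp_single h])

theorem len_one : D.len 1 = 0 := by simp [len]

theorem len_lift {i : B} {s : W1} (hs : D.IsLift i s) : D.len s = 1 := by
  rw [len, hs]; simp

theorem regOp_lift {i : B} {s : W1} (hs : D.IsLift i s) : D.regOp s = D.Lop i s := by
  refine D.regAlg_ext (D.regOp_mem s) (D.Lop_mem i hs) ?_
  rw [regOp_one, D.Lop_up i (by rw [mul_one, D.len_one, D.len_lift hs]; omega), mul_one]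

theorem lift_mul_self {i : B} {s : W1} (hs : D.IsLift i s) : ∃ t, s * s = D.z t := by
  have h : D.pr s = SemidirectProduct.inl (D.cs.simple i) := hs
  obtain ⟨t, ht⟩ := D.exists_z_mul (v := s * s) (w := 1) (by
    rw [map_mul, h, ← map_mul]; simp)
  exact ⟨t, by simpa using ht⟩

theorem lift_freeZ (f : W1 → Module.End C D.Free) (hf : ∀ t, f (D.z t) = D.lam (D.z t))
    (a : MonoidAlgebra C Zk) : FreeAlgebra.lift C f (D.freeZ a) = D.Zl a := by
  simp only [freeZ, Finsupp.sum, map_sum, map_smul, FreeAlgebra.lift_ι_apply, Zl,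
    MonoidAlgebra.lift_apply, hf]
  rfl

/-- The left regular representation of `ℋ`. -/
def regRep : D.Hecke →ₐ[C] Module.End C D.Free :=
  RingQuot.liftAlgHom C ⟨FreeAlgebra.lift C D.regOp, by
    intro x y h
    have hz : ∀ t, D.regOp (D.z t) = D.lam (D.z t) := fun t => D.regOp_Omega1 (D.z_mem_Omega1 t)
    induction h with
    | one => simp [D.regOp_Omega1 (one_mem D.Omega1)]
    | braid v w h => simp [D.regOp_mul h]
    | quadratic i s hs =>
      simp only [map_mul, map_add, map_smul, FreeAlgebra.lift_ι_apply, D.lift_freeZ D.regOp hz]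
      have hm : D.Zl (D.c s) ∈ D.regAlg := by
        rw [Zl, MonoidAlgebra.lift_apply]
        exact Subalgebra.sum_mem _ fun t _ => Subalgebra.smul_mem _
          (D.lam_mem (D.z_mem_Omega1 t)) _
      refine D.regAlg_ext (mul_mem (D.regOp_mem s) (D.regOp_mem s)) (add_mem
        (Subalgebra.smul_mem _ (D.regOp_mem _) _) (mul_mem hm (D.regOp_mem s))) ?_
      obtain ⟨t, ht⟩ := D.lift_mul_self hs
      have h0 : D.len (s * s) = 0 := by rw [len_eq_zero, ht]; exact D.z_mem_Omega1 t
      have h1 := D.len_lift hs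
      rw [Module.End.mul_apply, LinearMap.add_apply, LinearMap.smul_apply, Module.End.mul_apply,
        regOp_one, regOp_one, D.regOp_lift hs, D.Lop_down i (by omega)]⟩

@[simp] theorem regRep_T (w : W1) : D.regRep (D.T w) = D.regOp w :=
  (RingQuot.liftAlgHom_mkAlgHom_apply C _ _ _).trans (FreeAlgebra.lift_ι_apply _ _)

theorem T_one : D.T 1 = 1 := by
  rw [T, D.proj_rel Rel.one, map_one]

theorem T_mul {v w : W1} (h : D.len (v * w) = D.len v + D.len w) :
    D.T (v * w) = D.T v * D.T w := by
  rw [T, D.proj_rel (Rel.braid v w h), map_mul, T, T]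

theorem T_quadratic {i : B} {s : W1} (hs : D.IsLift i s) :
    D.T s * D.T s = D.q i • D.T (s * s) +
      (D.c s).coeff.sum (fun t r => r • D.T (D.z t)) * D.T s := by
  have := D.proj_rel (Rel.quadratic (D := D) i s hs)
  rw [map_mul] at this
  rw [T, this]
  simp [T, freeZ, Finsupp.sum]

theorem T_linearIndependent : LinearIndependent C D.T := by
  let f : D.Hecke →ₗ[C] D.Free :=
    (LinearMap.applyₗ (Finsupp.single (1 : W1) (1 : C))).comp D.regRep.toLinearMap
  have hf : ∀ w, f (D.T w) = Finsupp.single w 1 := fun w => by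
    simp [f, regOp_one]
  refine LinearIndependent.of_comp f ?_
  have : (f ∘ D.T) = fun w => (Finsupp.basisSingleOne (R := C)) w := by
    ext1 w; simp [hf]
  rw [this]
  exact Finsupp.basisSingleOne.linearIndependent

theorem T_Omega1_mul {u : W1} (hu : u ∈ D.Omega1) (w : W1) : D.T u * D.T w = D.T (u * w) := by
  rw [T_mul]
  rw [D.len_Omega1_mul hu, D.len_eq_zero.mpr hu, zero_add]

theorem T_mul_Omega1 {u : W1} (hu : u ∈ D.Omega1) (w : W1) : D.T w * D.T u = D.T (w * u) := by
  rw [T_mul]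
  rw [D.len_mul_Omega1 hu, D.len_eq_zero.mpr hu, add_zero]

/-- A subgroup containing `Z_κ` and stable by the multiplication of reduced decompositions spans a
subspace stable by multiplication by `T_s`. -/
theorem T_lift_mul_mem (G : Subgroup W1) (hz : ∀ t, D.z t ∈ G) {i : B} {s w : W1}
    (hs : D.IsLift i s) (hsG : s ∈ G) (hw : w ∈ G) :
    D.T s * D.T w ∈ Submodule.span C (D.T '' G) := by
  have mem : ∀ x ∈ G, D.T x ∈ Submodule.span C (D.T '' G) := fun x hx =>
    Submodule.subset_span ⟨x, hx, rfl⟩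
  have h1 := D.len_lift hs
  rcases D.len_lift_mul hs w with h | h
  · rw [← D.T_mul (by omega)]
    exact mem _ (mul_mem hsG hw)
  · have hv : w = s * (s⁻¹ * w) := by group
    obtain ⟨t, ht⟩ := D.lift_mul_self hs
    have h2 : D.len (s⁻¹ * w) = D.len (s * w) := by
      have : s * w = D.z t * (s⁻¹ * w) := by rw [← ht]; group
      rw [this, len_z_mul]
    have h3 : D.T w = D.T s * D.T (s⁻¹ * w) := by
      conv_lhs => rw [hv]
      rw [D.T_mul]
      rw [← hv]; omega
    rw [h3, ← mul_assoc, D.T_quadratic hs, add_mul, mul_assoc, ← h3, ht, smul_mul_assoc,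
      D.T_Omega1_mul (D.z_mem_Omega1 t), Finsupp.sum, Finset.sum_mul]
    refine add_mem (Submodule.smul_mem _ _ (mem _ (mul_mem (hz t) (mul_mem (inv_mem hsG) hw)))) ?_
    refine Submodule.sum_mem _ fun t _ => ?_
    rw [smul_mul_assoc, D.T_Omega1_mul (D.z_mem_Omega1 t)]
    exact Submodule.smul_mem _ _ (mem _ (mul_mem (hz t) hw))

theorem mem_Waff1_of_lift {i : B} {s : W1} (hs : D.IsLift i s) : s ∈ D.Waff1 := ⟨_, hs.symm⟩

/-- If `G` contains `W^aff(1)`, then the span of the `T_w`, `w ∈ G`, is stable by products. -/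
theorem T_mul_mem (G : Subgroup W1) (hG : D.Waff1 ≤ G) {v w : W1} (hv : v ∈ G) (hw : w ∈ G) :
    D.T v * D.T w ∈ Submodule.span C (D.T '' G) := by
  have key : ∀ (n : ℕ) (v : W1), D.len v = n → v ∈ G → ∀ x ∈ Submodule.span C (D.T '' G),
      D.T v * x ∈ Submodule.span C (D.T '' G) := by
    intro n
    induction n with
    | zero =>
      intro v hv hvG x hx
      induction hx using Submodule.span_induction with
      | mem x h =>
        obtain ⟨w, hw, rfl⟩ := h
        rw [D.T_Omega1_mul (D.len_eq_zero.mp hv)]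
        exact Submodule.subset_span ⟨_, mul_mem hvG hw, rfl⟩
      | zero => simp
      | add x y _ _ h1 h2 => rw [mul_add]; exact add_mem h1 h2
      | smul a x _ h => rw [mul_smul_comm]; exact Submodule.smul_mem _ _ h
    | succ n ih =>
      intro v hv hvG x hx
      obtain ⟨i, s, y, hs, rfl, hy⟩ := D.exists_left_descent (w := v) (by omega)
      have hsG := hG (D.mem_Waff1_of_lift hs)
      have h1 := D.len_lift hs
      have hyG : y ∈ G := (mul_mem_cancel_left hsG).mp hvG
      rw [D.T_mul (by omega), mul_assoc]
      have := ih y (by omega) hyG x hx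
      generalize D.T y * x = x' at this
      induction this using Submodule.span_induction with
      | mem x h =>
        obtain ⟨w, hw, rfl⟩ := h
        exact D.T_lift_mul_mem G (fun t => hG (D.z_mem_Waff1 t)) hs hsG hw
      | zero => simp
      | add x y _ _ h1 h2 => rw [mul_add]; exact add_mem h1 h2
      | smul a x _ h => rw [mul_smul_comm]; exact Submodule.smul_mem _ _ h
  exact key _ v rfl hv _ (Submodule.subset_span ⟨w, hw, rfl⟩)

/-- For a subgroup `G` of `W(1)` containing `W^aff(1)`, the subalgebra `⨁_{w ∈ G} C T_w`. -/
def sub (G : Subgroup W1) (hG : D.Waff1 ≤ G) : Subalgebra C D.Hecke :=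
  Submodule.toSubalgebra (Submodule.span C (D.T '' G))
    (by rw [← D.T_one]; exact Submodule.subset_span ⟨1, one_mem G, rfl⟩)
    (by
      intro x y hx hy
      induction hx, hy using Submodule.span_induction₂ with
      | mem_mem x y hx hy =>
        obtain ⟨v, hv, rfl⟩ := hx
        obtain ⟨w, hw, rfl⟩ := hy
        exact D.T_mul_mem G hG hv hw
      | zero_left => simp
      | zero_right => simp
      | add_left x y z _ _ _ h1 h2 => rw [add_mul]; exact add_mem h1 h2
      | add_right x y z _ _ _ h1 h2 => rw [mul_add]; exact add_mem h1 h2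
      | smul_left a x y _ _ h => rw [smul_mul_assoc]; exact Submodule.smul_mem _ _ h
      | smul_right a x y _ _ h => rw [mul_smul_comm]; exact Submodule.smul_mem _ _ h)

theorem T_span : ⊤ ≤ Submodule.span C (Set.range D.T) := by
  rintro x -
  obtain ⟨y, rfl⟩ := D.proj_surjective x
  have : D.proj y ∈ D.sub ⊤ le_top := by
    induction y using FreeAlgebra.induction with
    | grade0 r => rw [AlgHom.commutes]; exact Subalgebra.algebraMap_mem _ r
    | grade1 w => exact Submodule.subset_span ⟨w, trivial, rfl⟩
    | mul a b ha hb => rw [map_mul]; exact mul_mem ha hb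
    | add a b ha hb => rw [map_add]; exact add_mem ha hb
  have h2 : D.proj y ∈ Submodule.span C (D.T '' (⊤ : Subgroup W1)) := this
  simpa using h2

/-- `ℋ` is a free `C`-module with basis `(T_w)_{w ∈ W(1)}`. -/
def basis : Module.Basis W1 C D.Hecke := Module.Basis.mk D.T_linearIndependent D.T_span

@[simp] theorem basis_apply (w : W1) : D.basis w = D.T w := by simp [basis]

/-! ### The affine subalgebra, stabilizers of characters, and the modules `Ξ ⊗ V` -/

instance : D.Waff1.Normal := by
  have : D.Waff1 = D.toOmega.ker := by
    ext w; rw [mem_Waff1, MonoidHom.mem_ker]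
  rw [this]; infer_instance

/-- The affine subalgebra `ℋ^aff = ⨁_{w ∈ W^aff(1)} C T_w`. -/
def aff : Subalgebra C D.Hecke := D.sub D.Waff1 le_rfl

theorem T_mem_sub {G : Subgroup W1} {hG : D.Waff1 ≤ G} {w : W1} (hw : w ∈ G) :
    D.T w ∈ D.sub G hG := Submodule.subset_span ⟨w, hw, rfl⟩

theorem T_mem_aff {w : W1} (hw : w ∈ D.Waff1) : D.T w ∈ D.aff := D.T_mem_sub hw

/-- `T_w` as an element of `ℋ^aff`, for `w ∈ W^aff(1)`. -/
def affT (w : D.Waff1) : D.aff := ⟨D.T w, D.T_mem_aff w.2⟩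

/-- The conjugate `o w o⁻¹ ∈ W^aff(1)` of `w ∈ W^aff(1)`. -/
def cnj (o : W1) (w : D.Waff1) : D.Waff1 :=
  ⟨o * w * o⁻¹, Subgroup.Normal.conj_mem inferInstance _ w.2 o⟩

/-- The stabilizer `Ω(1)_Ξ` of a character `Ξ` of `ℋ^aff`, for the action
`(Ξ ω)(T_w) = Ξ(T_{ω w ω⁻¹})`. -/
def stab (Xi : D.aff →ₐ[C] C) : Subgroup W1 where
  carrier := {o | o ∈ D.Omega1 ∧ ∀ w : D.Waff1, Xi (D.affT (D.cnj o w)) = Xi (D.affT w)}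
  one_mem' := ⟨one_mem _, fun w => by congr 2; ext; simp [cnj]⟩
  mul_mem' {a b} ha hb := ⟨mul_mem ha.1 hb.1, fun w => by
    rw [← hb.2 w, ← ha.2 (D.cnj b w)]; congr 2; ext; simp [cnj, mul_assoc]⟩
  inv_mem' {a} ha := ⟨inv_mem ha.1, fun w => by
    rw [← ha.2 (D.cnj a⁻¹ w)]; congr 2; ext; simp [cnj, mul_assoc]⟩

theorem T_mul_inv {o : W1} (ho : o ∈ D.Omega1) : D.T o * D.T o⁻¹ = 1 := by
  rw [D.T_Omega1_mul ho, mul_inv_cancel, T_one]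

theorem T_inv_mul {o : W1} (ho : o ∈ D.Omega1) : D.T o⁻¹ * D.T o = 1 := by
  rw [D.T_Omega1_mul (inv_mem ho), inv_mul_cancel, T_one]

theorem T_conj {o : W1} (ho : o ∈ D.Omega1) (w : W1) :
    D.T o * D.T w * D.T o⁻¹ = D.T (o * w * o⁻¹) := by
  rw [D.T_Omega1_mul ho, D.T_mul_Omega1 (inv_mem ho)]

theorem z_mem_stab (Xi : D.aff →ₐ[C] C) (t : Zk) : D.z t ∈ D.stab Xi := by
  refine ⟨D.z_mem_Omega1 t, fun w => ?_⟩
  have h1 : D.affT (D.cnj (D.z t) w) = D.affT ⟨D.z t, D.z_mem_Waff1 t⟩ * D.affT w *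
      D.affT ⟨D.z t⁻¹, D.z_mem_Waff1 _⟩ := by
    ext
    simp only [affT, cnj, MulMemClass.mk_mul_mk, map_inv]
    exact (D.T_conj (D.z_mem_Omega1 t) w).symm
  have h2 : D.affT ⟨D.z t, D.z_mem_Waff1 t⟩ * D.affT ⟨D.z t⁻¹, D.z_mem_Waff1 _⟩ = 1 := by
    ext
    simp only [affT, MulMemClass.mk_mul_mk, map_inv]
    exact D.T_mul_inv (D.z_mem_Omega1 t)
  rw [h1, map_mul, map_mul, mul_right_comm, ← map_mul, h2, map_one, one_mul]

theorem stab_le (Xi : D.aff →ₐ[C] C) : D.stab Xi ≤ D.Omega1 := fun _ h => h.1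

/-- The subalgebra `ℋ_Ξ = ℋ^aff C[Ω(1)_Ξ]` of `ℋ`. -/
def HXi (Xi : D.aff →ₐ[C] C) : Subalgebra C D.Hecke :=
  D.aff ⊔ Algebra.adjoin C (D.T '' (D.stab Xi : Set W1))

theorem HXi_le (Xi : D.aff →ₐ[C] C) :
    D.HXi Xi ≤ D.sub (D.Waff1 ⊔ D.stab Xi) le_sup_left := by
  refine sup_le ?_ (Algebra.adjoin_le ?_)
  · exact Submodule.span_mono (Set.image_mono (SetLike.coe_subset_coe.mpr le_sup_left))
  · rintro _ ⟨w, hw, rfl⟩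
    exact D.T_mem_sub (Subgroup.mem_sup_right hw)

theorem aff_le_HXi (Xi : D.aff →ₐ[C] C) : D.aff ≤ D.HXi Xi := le_sup_left

theorem T_mem_HXi (Xi : D.aff →ₐ[C] C) {o : W1} (ho : o ∈ D.stab Xi) : D.T o ∈ D.HXi Xi :=
  (le_sup_right : _ ≤ D.HXi Xi) (Algebra.subset_adjoin ⟨o, ho, rfl⟩)

section XiModule

variable (Xi : D.aff →ₐ[C] C) {E : Type*} [Ring E] [Algebra C E] (tau : D.stab Xi →* E)

open Classical in
/-- Auxiliary linear map `T_x T_ω ↦ Ξ(T_x) τ(ω)`. -/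
def actLin : D.Hecke →ₗ[C] E :=
  D.basis.constr C fun w =>
    if h : ∃ o : D.stab Xi, ∃ x : D.Waff1, w = x * o then
      Xi (D.affT h.choose_spec.choose) • tau h.choose
    else 0

theorem actLin_T (htau : ∀ t : Zk, tau ⟨D.z t, D.z_mem_stab Xi t⟩ =
    Xi (D.affT ⟨D.z t, D.z_mem_Waff1 t⟩) • 1) (x : D.Waff1) (o : D.stab Xi) :
    D.actLin Xi tau (D.T (x * o)) = Xi (D.affT x) • tau o := by
  have h : ∃ o' : D.stab Xi, ∃ x' : D.Waff1, (x * o : W1) = x' * o' := ⟨o, x, rfl⟩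
  rw [actLin, ← basis_apply, Module.Basis.constr_basis, dif_pos h]
  set o' := h.choose
  set x' := h.choose_spec.choose
  have hx : (x * o : W1) = x' * o' := h.choose_spec.choose_spec
  have hpr : D.pr (o : W1) = D.pr o' := by
    have h1 := D.mem_Omega1.mp (D.stab_le Xi o.2)
    have h2 := D.mem_Omega1.mp (D.stab_le Xi o'.2)
    have h3 := congrArg D.toOmega hx
    rw [map_mul, map_mul, D.mem_Waff1.mp x.2, D.mem_Waff1.mp x'.2, one_mul, one_mul] at h3
    ext
    · rw [h1, h2]
    · exact h3
  obtain ⟨t, ht⟩ := D.exists_z_mul hpr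
  have e1 : o = ⟨D.z t, D.z_mem_stab Xi t⟩ * o' := Subtype.ext ht
  have e2 : x' = x * ⟨D.z t, D.z_mem_Waff1 t⟩ := by
    ext
    rw [ht, ← mul_assoc] at hx
    exact (mul_right_cancel hx).symm
  have e3 : D.affT x' = D.affT x * D.affT ⟨D.z t, D.z_mem_Waff1 t⟩ := by
    rw [e2]
    ext
    simp only [affT, MulMemClass.mk_mul_mk, Subgroup.coe_mul]
    exact (D.T_mul_Omega1 (D.z_mem_Omega1 t) x).symm
  have e4 : tau o = Xi (D.affT ⟨D.z t, D.z_mem_Waff1 t⟩) • tau o' := by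
    rw [congrArg tau e1, map_mul, htau, smul_mul_assoc, one_mul]
  rw [e4, e3, map_mul, mul_smul]

theorem actLin_mul_T (htau : ∀ t : Zk, tau ⟨D.z t, D.z_mem_stab Xi t⟩ =
    Xi (D.affT ⟨D.z t, D.z_mem_Waff1 t⟩) • 1) (X : D.aff) (o : D.stab Xi) :
    D.actLin Xi tau ((X : D.Hecke) * D.T o) = Xi X • tau o := by
  obtain ⟨X, hX⟩ := X
  have hX' : X ∈ Submodule.span C (D.T '' (D.Waff1 : Set W1)) := hX
  induction hX' using Submodule.span_induction with
  | mem x h =>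
    obtain ⟨w, hw, rfl⟩ := h
    have := D.actLin_T Xi tau htau ⟨w, hw⟩ o
    rw [← D.T_mul_Omega1 (D.stab_le Xi o.2)] at this
    exact this
  | zero =>
    have : (⟨0, hX⟩ : D.aff) = 0 := rfl
    rw [this]; simp
  | add x y hx hy h1 h2 =>
    have : (⟨x + y, hX⟩ : D.aff) = ⟨x, hx⟩ + ⟨y, hy⟩ := rfl
    rw [this, map_add, add_smul, ← h1 hx, ← h2 hy, ← map_add, ← add_mul]; rfl
  | smul a x hx h =>
    have : (⟨a • x, hX⟩ : D.aff) = a • ⟨x, hx⟩ := rfl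
    rw [this, map_smul, smul_assoc, ← h hx, ← map_smul, ← smul_mul_assoc]; rfl

theorem actLin_mul (htau : ∀ t : Zk, tau ⟨D.z t, D.z_mem_stab Xi t⟩ =
    Xi (D.affT ⟨D.z t, D.z_mem_Waff1 t⟩) • 1) {x y : D.Hecke} (hx : x ∈ D.sub (D.Waff1 ⊔ D.stab Xi) le_sup_left)
    (hy : y ∈ D.sub (D.Waff1 ⊔ D.stab Xi) le_sup_left) :
    D.actLin Xi tau (x * y) = D.actLin Xi tau x * D.actLin Xi tau y := by
  have hx' : x ∈ Submodule.span C (D.T '' ((D.Waff1 ⊔ D.stab Xi : Subgroup W1) : Set W1)) := hx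
  have hy' : y ∈ Submodule.span C (D.T '' ((D.Waff1 ⊔ D.stab Xi : Subgroup W1) : Set W1)) := hy
  clear hx hy
  induction hx', hy' using Submodule.span_induction₂ with
  | mem_mem x y hx hy =>
    obtain ⟨v, hv, rfl⟩ := hx
    obtain ⟨w, hw, rfl⟩ := hy
    rw [SetLike.mem_coe, Subgroup.mem_sup_of_normal_left] at hv hw
    obtain ⟨x, hx, o, ho, rfl⟩ := hv
    obtain ⟨y, hy, o', ho', rfl⟩ := hw
    have hO := D.stab_le Xi ho
    have hO' := D.stab_le Xi ho'
    have e1 := D.actLin_T Xi tau htau ⟨x, hx⟩ ⟨o, ho⟩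
    have e2 := D.actLin_T Xi tau htau ⟨y, hy⟩ ⟨o', ho'⟩
    have e3 : D.T (x * o) * D.T (y * o') =
        ((D.affT ⟨x, hx⟩ * D.affT (D.cnj o ⟨y, hy⟩) : D.aff) : D.Hecke) * D.T (o * o') := by
      have : ((D.affT ⟨x, hx⟩ * D.affT (D.cnj o ⟨y, hy⟩) : D.aff) : D.Hecke) =
        D.T x * D.T (o * y * o⁻¹) := rfl
      rw [this, mul_assoc, D.T_mul_Omega1 (mul_mem hO hO'), ← D.T_mul_Omega1 hO, mul_assoc,
        D.T_Omega1_mul hO]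
      congr 2; group
    have e4 := D.actLin_mul_T Xi tau htau (D.affT ⟨x, hx⟩ * D.affT (D.cnj o ⟨y, hy⟩))
      (⟨o, ho⟩ * ⟨o', ho'⟩)
    rw [e3, e1, e2]
    refine e4.trans ?_
    rw [map_mul, map_mul, ho.2, smul_mul_smul_comm]
  | zero_left => simp
  | zero_right => simp
  | add_left x y z _ _ _ h1 h2 => rw [add_mul, map_add, h1, h2, map_add, add_mul]
  | add_right x y z _ _ _ h1 h2 => rw [mul_add, map_add, h1, h2, map_add, mul_add]
  | smul_left a x y _ _ h => rw [smul_mul_assoc, map_smul, h, map_smul, smul_mul_assoc]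
  | smul_right a x y _ _ h => rw [mul_smul_comm, map_smul, h, map_smul, mul_smul_comm]

theorem actLin_one (htau : ∀ t : Zk, tau ⟨D.z t, D.z_mem_stab Xi t⟩ =
    Xi (D.affT ⟨D.z t, D.z_mem_Waff1 t⟩) • 1) : D.actLin Xi tau 1 = 1 := by
  have := D.actLin_mul_T Xi tau htau 1 1
  simpa [T_one] using this

/-- The algebra homomorphism `X T_ω ↦ Ξ(X) τ(ω)` on `ℋ_Ξ`. -/
def actHom (htau : ∀ t : Zk, tau ⟨D.z t, D.z_mem_stab Xi t⟩ =
    Xi (D.affT ⟨D.z t, D.z_mem_Waff1 t⟩) • 1) : D.HXi Xi →ₐ[C] E :=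
  AlgHom.ofLinearMap ((D.actLin Xi tau).comp (D.HXi Xi).val.toLinearMap)
    (by simpa using D.actLin_one Xi tau htau)
    (fun x y => D.actLin_mul Xi tau htau (D.HXi_le Xi x.2) (D.HXi_le Xi y.2))

end XiModule

end GenericDatum

namespace GenericDatum

variable {C B Waff Ω Zk W1 : Type u} [Field C] [Group Waff] [Group Ω] [CommGroup Zk] [Group W1]
  (D : GenericDatum C B Waff Ω Zk W1)

/-- The units `T_ω`, `ω ∈ Ω(1)`, of `ℋ`. -/
def unitT : D.Omega1 →* D.Heckeˣ where
  toFun o := ⟨D.T o, D.T (o : W1)⁻¹, D.T_mul_inv o.2, D.T_inv_mul o.2⟩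
  map_one' := Units.ext D.T_one
  map_mul' a b := Units.ext (D.T_Omega1_mul a.2 b).symm

theorem conj_mem_aff {o : W1} (ho : o ∈ D.Omega1) {X : D.Hecke} (hX : X ∈ D.aff) :
    D.T o * X * D.T o⁻¹ ∈ D.aff := by
  have hX' : X ∈ Submodule.span C (D.T '' (D.Waff1 : Set W1)) := hX
  induction hX' using Submodule.span_induction with
  | mem x h =>
    obtain ⟨w, hw, rfl⟩ := h
    rw [D.T_conj ho]
    exact D.T_mem_aff (Subgroup.Normal.conj_mem inferInstance _ hw o)
  | zero => simp
  | add x y hx hy h1 h2 => rw [mul_add, add_mul]; exact add_mem (h1 hx) (h2 hy)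
  | smul a x hx h =>
    rw [mul_smul_comm, smul_mul_assoc]; exact D.aff.smul_mem (h hx) a

/-- The conjugation `X ↦ T_ω X T_ω⁻¹` on `ℋ^aff`. -/
def affConjHom (o : D.Omega1) : D.aff →ₐ[C] D.aff where
  toFun X := ⟨D.T o * X * D.T (o : W1)⁻¹, D.conj_mem_aff o.2 X.2⟩
  map_one' := Subtype.ext (by simp [D.T_mul_inv o.2])
  map_zero' := Subtype.ext (by simp)
  map_add' X Y := Subtype.ext (by simp [mul_add, add_mul])
  map_mul' X Y := Subtype.ext (by
    have h : ∀ X Y : D.Hecke, D.T o * (X * Y) * D.T (o : W1)⁻¹ =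
        D.T o * X * D.T (o : W1)⁻¹ * (D.T o * Y * D.T (o : W1)⁻¹) := fun X Y => by
      have := D.T_inv_mul o.2
      calc _ = D.T o * X * 1 * (Y * D.T (o : W1)⁻¹) := by simp only [mul_assoc, mul_one]
        _ = _ := by rw [← this]; simp only [mul_assoc]
    exact h X Y)
  commutes' r := Subtype.ext (by
    have h : D.T o * algebraMap C D.Hecke r * D.T (o : W1)⁻¹ = algebraMap C D.Hecke r := by
      rw [← Algebra.commutes, mul_assoc, D.T_mul_inv o.2, mul_one]
    exact h)

theorem affConjHom_one : D.affConjHom 1 = AlgHom.id C _ := by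
  ext X
  simp [affConjHom, T_one]

theorem affConjHom_mul (a b : D.Omega1) :
    D.affConjHom (a * b) = (D.affConjHom a).comp (D.affConjHom b) := by
  ext X
  have h : D.T (a * b : W1) * X * D.T (a * b : W1)⁻¹ =
      D.T a * (D.T b * X * D.T (b : W1)⁻¹) * D.T (a : W1)⁻¹ := by
    rw [mul_inv_rev, ← D.T_Omega1_mul a.2, ← D.T_Omega1_mul (inv_mem b.2)]
    simp only [mul_assoc]
  exact h

/-- The action of `Ω(1)` on `ℋ^aff` by `X ↦ T_ω X T_ω⁻¹`. -/
def affConj : D.Omega1 →* (D.aff ≃ₐ[C] D.aff) where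
  toFun o := AlgEquiv.ofAlgHom (D.affConjHom o) (D.affConjHom o⁻¹)
    (by rw [← affConjHom_mul, mul_inv_cancel, affConjHom_one])
    (by rw [← affConjHom_mul, inv_mul_cancel, affConjHom_one])
  map_one' := by
    ext X : 1
    exact DFunLike.congr_fun D.affConjHom_one X
  map_mul' a b := by
    ext X : 1
    exact DFunLike.congr_fun (D.affConjHom_mul a b) X

/-- `ℋ^aff ⊆ ℋ` with the action of `Ω(1)`. -/
def pair : ConjPair C D.aff D.Hecke D.Omega1 where
  incl := D.aff.val
  unit := D.unitT
  conj := D.affConj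
  compat _ _ := rfl

section Two

variable (Xi Xi' : D.aff →ₐ[C] C)

/-- The algebra `ℋ_{Ξ,Ξ'} = ℋ_Ξ ∩ ℋ_{Ξ'}`. -/
def HXi2 : Subalgebra C D.Hecke := D.HXi Xi ⊓ D.HXi Xi'

/-- The group `Ω(1)_{Ξ,Ξ'} = Ω(1)_Ξ ∩ Ω(1)_{Ξ'}`. -/
def stab2 : Subgroup W1 := D.stab Xi ⊓ D.stab Xi'

theorem T_mem_HXi2 {o : W1} (ho : o ∈ D.stab2 Xi Xi') : D.T o ∈ D.HXi2 Xi Xi' :=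
  ⟨D.T_mem_HXi Xi ho.1, D.T_mem_HXi Xi' ho.2⟩

/-- `ℋ^aff ⊆ ℋ_{Ξ,Ξ'}` with the action of `Ω(1)_{Ξ,Ξ'}`. -/
def pair2 : ConjPair C D.aff (D.HXi2 Xi Xi') (D.stab2 Xi Xi') where
  incl := Subalgebra.inclusion (le_inf (D.aff_le_HXi Xi) (D.aff_le_HXi Xi'))
  unit :=
    { toFun := fun o => ⟨⟨D.T o, D.T_mem_HXi2 Xi Xi' o.2⟩,
        ⟨D.T (o : W1)⁻¹, D.T_mem_HXi2 Xi Xi' (inv_mem o.2)⟩,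
        Subtype.ext (D.T_mul_inv (D.stab_le Xi o.2.1)),
        Subtype.ext (D.T_inv_mul (D.stab_le Xi o.2.1))⟩
      map_one' := Units.ext (Subtype.ext D.T_one)
      map_mul' := fun a b => Units.ext (Subtype.ext (D.T_Omega1_mul (D.stab_le Xi a.2.1) b).symm) }
  conj := D.affConj.comp (Subgroup.inclusion (inf_le_left.trans (D.stab_le Xi)))
  compat _ _ := rfl

end Two

/-- The condition that the right `C[Ω(1)_Ξ]`-module `V` and the character `Ξ` agree on `Z_κ`.
Right modules are written as representations of the opposite group. -/
def Compatible (Xi : D.aff →ₐ[C] C) {V : Type u} [AddCommGroup V] [Module C V]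
    (ρ : Representation C (D.stab Xi)ᵐᵒᵖ V) : Prop :=
  ∀ (t : Zk) (v : V), ρ (op ⟨D.z t, D.z_mem_stab Xi t⟩) v =
    Xi (D.affT ⟨D.z t, D.z_mem_Waff1 t⟩) • v

section Modules

variable (Xi : D.aff →ₐ[C] C) {V : Type u} [AddCommGroup V] [Module C V]
  (ρ : Representation C (D.stab Xi)ᵐᵒᵖ V) (hρ : D.Compatible Xi ρ)

/-- The multiplicative map `ω ↦ (v ↦ v ω)`. -/
def tauV : D.stab Xi →* (Module.End C V)ᵐᵒᵖ where
  toFun o := op (ρ (op o))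
  map_one' := by simp
  map_mul' a b := by simp

/-- The algebra homomorphism describing the right action of `ℋ_Ξ` on `Ξ ⊗ V`. -/
def actXi : (D.HXi Xi)ᵐᵒᵖ →ₐ[C] Module.End C V :=
  AlgHom.opComm (D.actHom Xi (D.tauV Xi ρ) (fun t => by
    apply MulOpposite.unop_injective
    ext v
    exact hρ t v))

/-- The right `ℋ_Ξ`-module `Ξ ⊗ V`: its underlying space is `V`, and
`v · (X T_ω) = Ξ(X) (v ω)` for `X ∈ ℋ^aff` and `ω ∈ Ω(1)_Ξ`. -/
def xiMod : ModuleCat.{u} (D.HXi Xi)ᵐᵒᵖ :=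
  letI := Module.compHom V (D.actXi Xi ρ hρ).toRingHom
  ModuleCat.of (D.HXi Xi)ᵐᵒᵖ V

/-- The formula describing the action on `Ξ ⊗ V`. -/
theorem xiMod_apply (X : D.aff) (o : D.stab Xi) (v : V) :
    (show V from ract (D.xiMod Xi ρ hρ)
      ⟨X * D.T o, mul_mem (D.aff_le_HXi Xi X.2) (D.T_mem_HXi Xi o.2)⟩ v) =
      Xi X • ρ (op o) v := by
  have h := D.actLin_mul_T Xi (D.tauV Xi ρ) (fun t => by
    apply MulOpposite.unop_injective
    ext v
    exact hρ t v) X o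
  exact LinearMap.congr_fun (congrArg MulOpposite.unop h) v

/-- The right `ℋ`-module `π = (Ξ ⊗ V) ⊗_{ℋ_Ξ} ℋ`. -/
def piMod : ModuleCat.{u} D.Heckeᵐᵒᵖ := induced (D.HXi Xi) (D.xiMod Xi ρ hρ)

end Modules

/-! ### The action of `Ω` on `Hom_{ℋ^aff}(M, N)`, and inflation -/

section Omega

theorem toOmega_surjective (o : Ω) : ∃ g : D.Omega1, D.toOmega g = o := by
  obtain ⟨w, hw⟩ := D.ext.rightHom_surjective (SemidirectProduct.inr o)
  refine ⟨⟨w, o, hw.symm⟩, ?_⟩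
  have : D.pr w = SemidirectProduct.inr o := hw
  simp [toOmega, this]

/-- A lift to `Ω(1)` of an element of `Ω`. -/
def liftOmega (o : Ω) : D.Omega1 := (D.toOmega_surjective o).choose

theorem toOmega_liftOmega (o : Ω) : D.toOmega (D.liftOmega o) = o :=
  (D.toOmega_surjective o).choose_spec

variable (M N : ModuleCat.{u} D.Heckeᵐᵒᵖ)

/-- `Z_κ` acts trivially on `Hom_{ℋ^aff}(M, N)`. -/
theorem homRep_eq_one {g : D.Omega1} (hg : D.toOmega g = 1) :
    D.pair.homRep M N g = 1 := by
  ext f x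
  have hmem : D.T (g : W1) ∈ D.aff := D.T_mem_aff (D.mem_Waff1.mpr hg)
  have h1 := f.hom.map_smul (MulOpposite.op (⟨D.T (g : W1), hmem⟩ : D.aff)) x
  have key : ∀ F : M → N, F (ract M (D.T (g : W1)) x) = ract N (D.T (g : W1)) (F x) →
      ract N ((D.unitT g)⁻¹ : D.Heckeˣ) (F (ract M (D.unitT g : D.Heckeˣ) x)) = F x := by
    intro F hF
    have h2 : ((D.unitT g : D.Heckeˣ) : D.Hecke) = D.T (g : W1) := rfl
    rw [h2, hF, ← h2, ract_ract, Units.mul_inv, ract_one]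
  exact (D.pair.homRep_apply M N g f x).trans (key f.hom h1)

/-- `homRep` depends only on the image in `Ω`. -/
theorem homRep_congr {g h : D.Omega1} (hgh : D.toOmega g = D.toOmega h) :
    D.pair.homRep M N g = D.pair.homRep M N h := by
  have h1 : D.pair.homRep M N (g * h⁻¹) = 1 := D.homRep_eq_one M N (by
    simp [hgh])
  calc _ = D.pair.homRep M N (g * h⁻¹ * h) := by rw [inv_mul_cancel_right]
    _ = _ := by rw [map_mul, h1, one_mul]

/-- The representation of `Ω` on `Hom_{ℋ^aff}(M, N)`, for right `ℋ`-modules `M` and `N`: if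
`γ ∈ Ω(1)` lifts `o ∈ Ω`, then `(o f)(m) = f(m T_γ) T_γ⁻¹`. -/
def omegaRep : Representation C Ω
    ((pull D.pair.incl).obj M ⟶ (pull D.pair.incl).obj N) where
  toFun o := D.pair.homRep M N (D.liftOmega o)
  map_one' := D.homRep_eq_one M N (D.toOmega_liftOmega 1)
  map_mul' a b := by
    rw [← map_mul]
    exact D.homRep_congr M N (by simp [toOmega_liftOmega])

theorem omegaRep_toOmega (g : D.Omega1) :
    D.omegaRep M N (D.toOmega g) = D.pair.homRep M N g :=
  D.homRep_congr M N (D.toOmega_liftOmega _)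

/-- The group cohomology `H¹(Ω, Hom_{ℋ^aff}(M, N))`. -/
abbrev H1Omega : ModuleCat.{u} C := groupCohomology.H1 (Rep.of (D.omegaRep M N))

/-- `ι` is the inflation map `H¹(Ω, Hom_{ℋ^aff}(M, N)) → Ext¹_ℋ(M, N)` of the
Hochschild–Serre exact sequence: it sends the class of a cocycle `z` to the class of an extension
`0 → N → E → M → 0` of right `ℋ`-modules that has an `ℋ^aff`-linear section `σ` such that
`σ(m T_γ) T_γ⁻¹ = σ(m) + z_γ(m)` for `γ ∈ Ω(1)`. -/
def IsInflation (ι : D.H1Omega M N →ₗ[C] Abelian.Ext.{u} M N 1) : Prop :=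
  ∀ (z : groupCohomology.cocycles₁ (Rep.of (D.omegaRep M N)))
    (E : ModuleCat.{u} D.Heckeᵐᵒᵖ) (i : N ⟶ E) (p : E ⟶ M) (w : i ≫ p = 0)
    (hS : (ShortComplex.mk i p w).ShortExact)
    (σ : (pull D.pair.incl).obj M ⟶ (pull D.pair.incl).obj E),
    σ ≫ (pull D.pair.incl).map p = 𝟙 _ →
    (∀ (g : D.Omega1) (m : M),
      ract E (D.T (g : W1)⁻¹) (D.pair.mapFun σ (ract M (D.T (g : W1)) m)) =
        D.pair.mapFun σ m + i.hom (D.pair.mapFun (M := M) (N := N) (z (D.toOmega g)) m)) →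
    ι ((groupCohomology.H1π (Rep.of (D.omegaRep M N))).hom z) = hS.extClass

/-- The restriction map `Ext¹_ℋ(M, N) → Ext¹_{ℋ^aff}(M, N)`. -/
abbrev resAff : Abelian.Ext.{u} M N 1 →ₗ[C]
    Abelian.Ext.{u} ((pull D.pair.incl).obj M) ((pull D.pair.incl).obj N) 1 :=
  extRes D.pair.incl M N

end Omega

end GenericDatum

end

noncomputable section

/-! ### Derivations and `Ext¹` of modules -/

section Derivations

open Abelian

variable {R : Type u} [Ring R]

/-! Everything is computed with derivations. Over an algebra `R` over a field, every short exact
sequence of modules has an additive (even scalar-linear) section, so `Ext¹_R(M, N)` is the group of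
derivations `R → Hom_ℤ(M, N)` modulo the inner ones (`ModDer.extClass_surjective`,
`ModDer.extClass_eq_zero_iff`). Restriction of `Ext¹` becomes restriction of derivations, and `g`
acts by `(d g)(X)(m) = d(g X g⁻¹)(m g⁻¹) g` (`ConjPair.extAct_extClass`).

Both surjectivity statements are one statement about `A = ℋ^aff` inside `B`, where `B` is `ℋ` with
`G = Ω(1)`, or `ℋ_{Ξ,Ξ'}` with `G = Ω(1)_{Ξ,Ξ'}`. By the basis theorem, `B` is generated by `A` and
the `T_g` subject only to the multiplication of `G`, to `T_g X = (g X g⁻¹) T_g` and to the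
identification of the two copies of `Z_κ` (`isCrossed_of_span`). Hence a derivation `d` of `A`
extends to `B` once there are values `h_g : M → N` at the `T_g` which respect these three kinds of
relations (`IsCrossed.exists_extension`).

Invariance of the class of `d` under `g` says exactly that some `h_g` respects the commutation with
`A` (`extAct_extClass_eq_iff`). Two such values differ by an `A`-linear map followed by `g`, so the
usual obstruction to a multiplicative choice is a 2-cocycle with values in `Hom_A(M, N)`. It
disappears because `M` and `N` are sums of eigenspaces for characters of `A`: keeping only the
blocks between equal characters projects the `C`-linear maps onto the `A`-linear ones, and this
projection is equivariant because `G` permutes the eigenspaces (`diagProjection`). Demanding that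
the projection of `h_g g⁻¹` be zero makes `h_g` unique, and uniqueness forces the product rule. For
`t` in `Z_κ` the value must be `d(T_t)`; it is normalised as well, since the projection of `d(T_t)
t⁻¹` is a homomorphism in `t` from a finite group, of order invertible in `C`, to a `C`-vector space
(`IsCrossed.proj_aval`). This gives `IsCrossed.range_extRes`.

The eigenspace condition holds because `ℋ^aff` acts on `Ξ ⊗ V` through `Ξ`, and `π` is the sum of
the images of `Ξ ⊗ V` under the `T_g`, on which `ℋ^aff` acts through conjugates of `Ξ`
(`piMod_eigenspace`).

For the kernel of restriction, subtracting an inner derivation makes a derivation of `ℋ` vanish on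
`ℋ^aff`. Then `m ↦ d(T_g)(m) g⁻¹` is `ℋ^aff`-linear and depends only on the image of `g` in `Ω`; it
is a 1-cocycle, and a coboundary exactly when the derivation is inner (`exists_eq_inflDer`,
`inflLin_eq_zero_iff`). The direct sum decomposition is then linear algebra over `C`. -/

/-- The derivations of a ring `R` with values in `Hom_ℤ(M, N)`, for left `R`-modules `M`, `N`. -/
def modDerSubgroup (M N : ModuleCat.{u} R) : AddSubgroup (R → M → N) where
  carrier := {d | (∀ r s m, d (r + s) m = d r m + d s m) ∧
    (∀ r m m', d r (m + m') = d r m + d r m') ∧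
    ∀ r s m, d (r * s) m = d r (s • m) + r • d s m}
  zero_mem' := by simp
  add_mem' {d d'} h h' := by
    refine ⟨fun r s m => ?_, fun r m m' => ?_, fun r s m => ?_⟩
    · simp only [Pi.add_apply, h.1, h'.1]; abel
    · simp only [Pi.add_apply, h.2.1, h'.2.1]; abel
    · simp only [Pi.add_apply, h.2.2, h'.2.2, smul_add]; abel
  neg_mem' {d} h := by
    refine ⟨fun r s m => ?_, fun r m m' => ?_, fun r s m => ?_⟩
    · simp only [Pi.neg_apply, h.1]; abel
    · simp only [Pi.neg_apply, h.2.1]; abel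
    · simp only [Pi.neg_apply, h.2.2, smul_neg]; abel

/-- The type of derivations of `R` with values in `Hom_ℤ(M, N)`. -/
abbrev ModDer (M N : ModuleCat.{u} R) : Type u := modDerSubgroup M N

namespace ModDer

variable {M N : ModuleCat.{u} R} (d : ModDer M N)

theorem add_left (r s : R) (m : M) : d.1 (r + s) m = d.1 r m + d.1 s m := d.2.1 r s m

theorem add_right (r : R) (m m' : M) : d.1 r (m + m') = d.1 r m + d.1 r m' := d.2.2.1 r m m'

theorem mul (r s : R) (m : M) : d.1 (r * s) m = d.1 r (s • m) + r • d.1 s m := d.2.2.2 r s m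

theorem zero_left (m : M) : d.1 0 m = 0 := by
  have := d.add_left 0 0 m
  simpa using this

theorem zero_right (r : R) : d.1 r 0 = 0 := by
  have := d.add_right r 0 0
  simpa using this

theorem one (m : M) : d.1 1 m = 0 := by
  have := d.mul 1 1 m
  simpa using this

/-! ### The extension defined by a derivation, and its class. -/

/-- The extension of `M` by `N` attached to a derivation: the action on `N × M` is
`r (n, m) = (r n - d(r)(m), r m)`. -/
def Total (_ : ModDer M N) : Type u := N × M

instance : AddCommGroup d.Total := inferInstanceAs (AddCommGroup (N × M))

instance : Module R d.Total where
  smul r x := (r • x.1 - d.1 r x.2, r • x.2)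
  one_smul x := Prod.ext
    (show (1 : R) • x.1 - d.1 1 x.2 = x.1 by rw [one, one_smul, sub_zero]) (one_smul R x.2)
  mul_smul r s x := Prod.ext
    (show (r * s) • x.1 - d.1 (r * s) x.2 = r • (s • x.1 - d.1 s x.2) - d.1 r (s • x.2) by
      rw [d.mul, mul_smul, smul_sub]; abel) (mul_smul r s x.2)
  smul_zero r := Prod.ext
    (show r • (0 : N) - d.1 r (0 : M) = 0 by rw [zero_right, smul_zero, sub_zero])
    (smul_zero (A := M) r)
  smul_add r x y := Prod.ext
    (show r • (x.1 + y.1) - d.1 r (x.2 + y.2) = r • x.1 - d.1 r x.2 + (r • y.1 - d.1 r y.2) by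
      rw [add_right, smul_add]; abel) (smul_add r x.2 y.2)
  add_smul r s x := Prod.ext
    (show (r + s) • x.1 - d.1 (r + s) x.2 = r • x.1 - d.1 r x.2 + (s • x.1 - d.1 s x.2) by
      rw [add_left, add_smul]; abel) (add_smul r s x.2)
  zero_smul x := Prod.ext
    (show (0 : R) • x.1 - d.1 0 x.2 = 0 by rw [zero_left, zero_smul, sub_zero])
    (zero_smul R x.2)

/-- The inclusion `N → N × M`. -/
def inlHom : N →ₗ[R] d.Total where
  toFun n := (n, (0 : M))
  map_add' n n' := Prod.ext rfl (add_zero (0 : M)).symm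
  map_smul' r n := Prod.ext
    (show r • n = r • n - d.1 r 0 by rw [zero_right, sub_zero]) (smul_zero (A := M) r).symm

/-- The projection `N × M → M`. -/
def sndHom : d.Total →ₗ[R] M where
  toFun x := x.2
  map_add' _ _ := rfl
  map_smul' _ _ := rfl

/-- The extension attached to a derivation. -/
def complex : ShortComplex (ModuleCat.{u} R) :=
  ShortComplex.mk (X₁ := N) (X₂ := ModuleCat.of R d.Total) (X₃ := M) (ModuleCat.ofHom d.inlHom)
    (ModuleCat.ofHom d.sndHom) (by ext; rfl)

theorem complex_shortExact : d.complex.ShortExact where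
  exact := by
    rw [ShortComplex.ShortExact.moduleCat_exact_iff_function_exact]
    intro x
    constructor
    · intro h
      exact ⟨x.1, Prod.ext rfl h.symm⟩
    · rintro ⟨n, rfl⟩; rfl
  mono_f := (ModuleCat.mono_iff_injective _).mpr fun _ _ h => congrArg Prod.fst h
  epi_g := (ModuleCat.epi_iff_surjective _).mpr fun m => ⟨((0 : N), m), rfl⟩

/-- The class in `Ext¹` of a derivation. -/
def extClass : Ext.{u} M N 1 := d.complex_shortExact.extClass

/-- Naturality of `extClass` in extensions with a given additive section. -/
theorem extClass_comp_eq {S : ShortComplex (ModuleCat.{u} R)} (hS : S.ShortExact)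
    (α : N ⟶ S.X₁) (β : M ⟶ S.X₃) (s : M → S.X₂) (hs : ∀ m m', s (m + m') = s m + s m')
    (hg : ∀ m, S.g (s m) = β m) (h : ∀ r m, s (r • m) - r • s m = S.f (α (d.1 r m))) :
    d.extClass.comp (Ext.mk₀ α) (add_zero 1) = (Ext.mk₀ β).comp hS.extClass (zero_add 1) := by
  -- The additive map that is `α` on `N` and `s` on `M`; the hypothesis `h` is what makes it
  -- `R`-linear, hence the middle arrow of a morphism of extensions.
  let F : d.Total →ₗ[R] S.X₂ :=
    { toFun := fun x => S.f (α x.1) + s x.2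
      map_add' := fun x y => by
        change S.f (α (x.1 + y.1)) + s (x.2 + y.2) = _
        rw [map_add, map_add, hs]; abel
      map_smul' := fun r x => by
        change S.f (α (r • x.1 - d.1 r x.2)) + s (r • x.2) = r • (S.f (α x.1) + s x.2)
        rw [map_sub, map_sub, ← h, map_smul, map_smul, smul_add]; abel }
  have hfg : ∀ y, S.g (S.f y) = 0 := fun y => by
    have := congrArg (fun φ => φ.hom y) S.zero
    exact this
  have hs0 : s 0 = 0 := by simpa using hs 0 0
  let φ : d.complex ⟶ S :=
    { τ₁ := α
      τ₂ := ModuleCat.ofHom F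
      τ₃ := β
      comm₁₂ := by
        ext n
        change S.f (α n) = S.f (α n) + s 0
        rw [hs0, add_zero]
      comm₂₃ := by
        ext x
        change S.g (S.f (α x.1) + s x.2) = β x.2
        rw [map_add, hfg, hg, zero_add] }
  exact ShortComplex.ShortExact.extClass_naturality d.complex_shortExact hS φ

/-- The class of an extension is the class of the derivation attached to an additive section. -/
theorem extClass_eq {S : ShortComplex (ModuleCat.{u} R)} (hS : S.ShortExact)
    (d : ModDer S.X₃ S.X₁) (s : S.X₃ → S.X₂) (hs : ∀ m m', s (m + m') = s m + s m')
    (hg : ∀ m, S.g (s m) = m) (h : ∀ r m, s (r • m) - r • s m = S.f (d.1 r m)) :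
    d.extClass = hS.extClass := by
  have := d.extClass_comp_eq hS (𝟙 _) (𝟙 _) s hs hg h
  simpa using this

/-- Naturality of `extClass`. -/
theorem extClass_comp {M' N' : ModuleCat.{u} R} (d' : ModDer M' N') (α : N ⟶ N') (β : M ⟶ M')
    (f : M → N') (hf : ∀ m m', f (m + m') = f m + f m')
    (h : ∀ r m, α (d.1 r m) = d'.1 r (β m) + (f (r • m) - r • f m)) :
    d.extClass.comp (Ext.mk₀ α) (add_zero 1) =
      (Ext.mk₀ β).comp d'.extClass (zero_add 1) := by
  refine d.extClass_comp_eq d'.complex_shortExact α β (fun m => (f m, β m))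
    (fun m m' => Prod.ext (hf m m') (map_add β.hom m m')) (fun m => rfl) (fun r m => ?_)
  refine Prod.ext ?_ ?_
  · change f (r • m) - (r • f m - d'.1 r (β m)) = α (d.1 r m)
    rw [h]; abel
  · change β (r • m) - r • β m = 0
    rw [map_smul, sub_self]

/-- Composition of a derivation with a linear map. -/
def postcomp {N' : ModuleCat.{u} R} (α : N ⟶ N') : ModDer M N' :=
  ⟨fun r m => α (d.1 r m), fun r r' m => by rw [← map_add, ← d.add_left],
    fun r m m' => by rw [← map_add, ← d.add_right],
    fun r r' m => by rw [← map_smul, ← map_add, ← d.mul]⟩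

theorem extClass_postcomp {N' : ModuleCat.{u} R} (α : N ⟶ N') :
    (d.postcomp α).extClass = d.extClass.comp (Ext.mk₀ α) (add_zero 1) := by
  have h := d.extClass_comp (d.postcomp α) α (𝟙 M) (fun _ => 0) (by simp) (fun r m => by
    change α (d.1 r m) = α (d.1 r m) + _
    simp)
  rw [Ext.mk₀_id_comp] at h
  exact h.symm

/-- The inner derivations. -/
def inner (f : M →+ N) : ModDer M N :=
  ⟨fun r m => f (r • m) - r • f m,
    fun r s m => by dsimp only; rw [add_smul, add_smul, map_add]; abel,
    fun r m m' => by dsimp only; rw [smul_add, map_add, map_add, smul_add]; abel,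
    fun r s m => by dsimp only; rw [mul_smul, mul_smul, smul_sub]; abel⟩

theorem extClass_congr (d d' : ModDer M N) (f : M → N) (hf : ∀ m m', f (m + m') = f m + f m')
    (h : ∀ r m, d.1 r m = d'.1 r m + (f (r • m) - r • f m)) : d.extClass = d'.extClass := by
  have := d.extClass_comp d' (𝟙 _) (𝟙 _) f hf h
  simpa using this

/-- Both derivations are components of one derivation into `N × N`. Pushing its class out along the
two projections and along their sum gives the three classes, and composition with degree zero
classes is additive. -/
theorem extClass_add (d d' : ModDer M N) : (d + d').extClass = d.extClass + d'.extClass := by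
  let NN : ModuleCat.{u} R := ModuleCat.of R (N × N)
  let e : ModDer M NN := ⟨fun r m => ((d.1 r m, d'.1 r m) : N × N), by
    refine ⟨fun r s m => ?_, fun r m m' => ?_, fun r s m => ?_⟩
    · exact Prod.ext (d.add_left r s m) (d'.add_left r s m)
    · exact Prod.ext (d.add_right r m m') (d'.add_right r m m')
    · exact Prod.ext (d.mul r s m) (d'.mul r s m)⟩
  let p1 : NN ⟶ N := ModuleCat.ofHom (LinearMap.fst R N N)
  let p2 : NN ⟶ N := ModuleCat.ofHom (LinearMap.snd R N N)
  have key : ∀ (p : NN ⟶ N) (d₀ : ModDer M N), (∀ r m, p (e.1 r m) = d₀.1 r m) →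
      e.extClass.comp (Ext.mk₀ p) (add_zero 1) = d₀.extClass := fun p d₀ h => by
    have := e.extClass_comp d₀ p (𝟙 _) (fun _ => 0) (by simp) (fun r m => by
      rw [h]; simp)
    simpa using this
  rw [← key p1 d (fun _ _ => rfl), ← key p2 d' (fun _ _ => rfl),
    ← key (p1 + p2) (d + d') (fun _ _ => rfl), Ext.mk₀_add, Ext.comp_add]

variable (M N) in
/-- The class in `Ext¹` of a derivation, as an additive map. -/
def extClassHom : ModDer M N →+ Ext.{u} M N 1 := AddMonoidHom.mk' extClass extClass_add

theorem extClass_sub (d d' : ModDer M N) : (d - d').extClass = d.extClass - d'.extClass :=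
  map_sub (extClassHom M N) d d'

theorem extClass_zero : (0 : ModDer M N).extClass = 0 := map_zero (extClassHom M N)

/-! ### Inner derivations, and derivations from additive sections. -/

/-- The class of a derivation is zero if and only if it is inner. -/
theorem extClass_eq_zero_iff : d.extClass = 0 ↔ ∃ f : M →+ N,
    ∀ r m, d.1 r m = f (r • m) - r • f m := by
  constructor
  · intro h
    -- If the class vanishes, the identity of `M` lifts to a linear splitting `g(m) = (u(m), m)` of
    -- the extension. Linearity reads `u(r m) = r u(m) - d(r)(m)`, so `f = -u` exhibits `d` as
    -- inner.
    obtain ⟨x, hx⟩ := Ext.covariant_sequence_exact₃ M d.complex_shortExact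
      (Ext.mk₀ (𝟙 M)) (zero_add 1) ((Ext.mk₀_id_comp _).trans h)
    obtain ⟨g, rfl⟩ := (Ext.mk₀_bijective _ _).2 x
    rw [Ext.mk₀_comp_mk₀] at hx
    have hg := (Ext.mk₀_bijective _ _).1 hx
    have hg2 : ∀ m : M, (g.hom m : N × M).2 = m := fun m =>
      congrArg (fun φ : M ⟶ M => φ.hom m) hg
    refine ⟨-(AddMonoidHom.mk' (fun m : M => (g.hom m : N × M).1) fun m m' =>
      congrArg Prod.fst (map_add g.hom m m')), fun r m => ?_⟩
    have h1 : (g.hom (r • m) : N × M).1 = r • (g.hom m : N × M).1 - d.1 r (g.hom m : N × M).2 :=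
      congrArg Prod.fst (map_smul g.hom r m)
    rw [hg2] at h1
    change d.1 r m = -(g.hom (r • m) : N × M).1 - r • (-(g.hom m : N × M).1)
    rw [h1, smul_neg]; abel
  · rintro ⟨f, hf⟩
    rw [← extClass_zero]
    refine extClass_congr d 0 f (map_add f) fun r m => ?_
    rw [hf]
    exact (zero_add _).symm

theorem extClass_eq_iff (d d' : ModDer M N) : d.extClass = d'.extClass ↔ ∃ f : M →+ N,
    ∀ r m, d.1 r m - d'.1 r m = f (r • m) - r • f m := by
  rw [← sub_eq_zero, ← extClass_sub, extClass_eq_zero_iff]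
  rfl

/-- The derivation attached to a short exact sequence with an additive section. -/
theorem exists_of_section {S : ShortComplex (ModuleCat.{u} R)} (hS : S.ShortExact)
    (s : S.X₃ → S.X₂) (hs : ∀ m m', s (m + m') = s m + s m') (hg : ∀ m, S.g (s m) = m) :
    ∃ d : ModDer S.X₃ S.X₁, ∀ r m, s (r • m) - r • s m = S.f (d.1 r m) := by
  have hinj : Function.Injective S.f := (ModuleCat.mono_iff_injective _).mp hS.mono_f
  have hex := (CategoryTheory.ShortComplex.ShortExact.moduleCat_exact_iff_function_exact S).mp
    hS.exact
  have h : ∀ (r : R) (m : S.X₃), ∃ n, S.f n = s (r • m) - r • s m := fun r m => by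
    refine (hex (s (r • m) - r • s m)).mp ?_
    rw [map_sub, map_smul, hg, hg, sub_self]
  choose d hd using h
  refine ⟨⟨d, fun r r' m => hinj ?_, fun r m m' => hinj ?_, fun r r' m => hinj ?_⟩,
    fun r m => (hd r m).symm⟩
  · rw [map_add, hd, hd, hd, add_smul, add_smul, hs]; abel
  · rw [map_add, hd, hd, hd, smul_add, hs, hs, smul_add]; abel
  · rw [map_add, map_smul, hd, hd, hd, mul_smul, mul_smul, smul_sub]; abel

/-- Over an algebra over a field, surjections of modules have additive sections. -/
theorem exists_additive_section (C : Type u) [Field C] [Algebra C R] {P Q : Type u}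
    [AddCommGroup P] [AddCommGroup Q] [Module R P] [Module R Q] (g : P →ₗ[R] Q)
    (hg : Function.Surjective g) : ∃ s : Q → P, (∀ m m', s (m + m') = s m + s m') ∧
      (∀ (c : C) m, s (algebraMap C R c • m) = algebraMap C R c • s m) ∧ ∀ m, g (s m) = m := by
  let := Module.compHom P (algebraMap C R)
  let := Module.compHom Q (algebraMap C R)
  let g' : P →ₗ[C] Q :=
    { toFun := g, map_add' := map_add g, map_smul' := fun c x => map_smul g (algebraMap C R c) x }
  obtain ⟨s, hs⟩ := LinearMap.exists_rightInverse_of_surjective g' (LinearMap.range_eq_top.mpr hg)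
  exact ⟨s, map_add s, map_smul s, LinearMap.congr_fun hs⟩

/-- The derivation comes from a `C`-linear section, pushed out along `f`. Linearity of the section
over `C` is the reason why it kills the scalars. -/
theorem exists_extClass_eq_comp (C : Type u) [Field C] [Algebra C R]
    {S : ShortComplex (ModuleCat.{u} R)} (hS : S.ShortExact) (f : S.X₁ ⟶ N) :
    ∃ d : ModDer S.X₃ N, (∀ (c : C) m, d.1 (algebraMap C R c) m = 0) ∧
      d.extClass = hS.extClass.comp (Ext.mk₀ f) (add_zero 1) := by
  obtain ⟨s, hs, hsC, hs'⟩ := exists_additive_section C S.g.hom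
    ((ModuleCat.epi_iff_surjective _).mp hS.epi_g)
  obtain ⟨d, hd⟩ := exists_of_section hS s hs hs'
  refine ⟨d.postcomp f, fun c m => ?_, ?_⟩
  · have h3 : d.1 (algebraMap C R c) m = 0 := (ModuleCat.mono_iff_injective _).mp hS.mono_f (by
      rw [← hd, hsC, sub_self, map_zero])
    exact (congrArg f h3).trans (map_zero f.hom)
  · rw [extClass_postcomp, extClass_eq hS d s hs hs' hd]

/-- Over an algebra over a field, every class in `Ext¹` is the class of a derivation. -/
theorem extClass_surjective (C : Type u) [Field C] [Algebra C R] (x : Ext.{u} M N 1) :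
    ∃ d : ModDer M N, (∀ (c : C) m, d.1 (algebraMap C R c) m = 0) ∧ d.extClass = x := by
  -- With a projective in the middle of `0 → K → P → M → 0`, every class in `Ext¹(M, N)` is the
  -- pushout of this one extension along a map `K → N`.
  have hP := ModuleCat.shortExact_projectiveShortComplex M
  obtain ⟨y, rfl⟩ := precomp_extClass_surjective_of_projective_X₂ N hP 0 x
  obtain ⟨f, rfl⟩ := (Ext.mk₀_bijective _ _).2 y
  exact exists_extClass_eq_comp C hP f

end ModDer

end Derivations
end

noncomputable section

/-! ### Derivations of an algebra with a group action -/

section RightModules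

open Abelian

variable {C A B : Type u} [Field C] [Ring A] [Algebra C A] [Ring B] [Algebra C B]

theorem ract_zero (M : ModuleCat.{u} Bᵐᵒᵖ) (b : B) : ract M b 0 = 0 := smul_zero _

theorem ract_neg (M : ModuleCat.{u} Bᵐᵒᵖ) (b : B) (x : M) : ract M b (-x) = -ract M b x :=
  smul_neg _ _

theorem ract_sub (M : ModuleCat.{u} Bᵐᵒᵖ) (b : B) (x y : M) :
    ract M b (x - y) = ract M b x - ract M b y := smul_sub _ _ _

theorem add_ract (M : ModuleCat.{u} Bᵐᵒᵖ) (b b' : B) (x : M) :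
    ract M (b + b') x = ract M b x + ract M b' x := add_smul _ _ _

theorem neg_ract (M : ModuleCat.{u} Bᵐᵒᵖ) (b : B) (x : M) : ract M (-b) x = -ract M b x :=
  neg_smul (op b) x

theorem zero_ract (M : ModuleCat.{u} Bᵐᵒᵖ) (x : M) : ract M (0 : B) x = 0 := zero_smul _ _

@[simp] theorem ract_inv_ract (M : ModuleCat.{u} Bᵐᵒᵖ) (u : Bˣ) (x : M) :
    ract M ((u⁻¹ : Bˣ) : B) (ract M (u : B) x) = x := by
  rw [ract_ract, Units.mul_inv, ract_one]

@[simp] theorem ract_ract_inv (M : ModuleCat.{u} Bᵐᵒᵖ) (u : Bˣ) (x : M) :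
    ract M (u : B) (ract M ((u⁻¹ : Bˣ) : B) x) = x := by
  rw [ract_ract, Units.inv_mul, ract_one]

/-- The right action of an element, as an additive map. -/
def ractHom (M : ModuleCat.{u} Bᵐᵒᵖ) (b : B) : M →+ M := AddMonoidHom.mk' (ract M b) (ract_add M b)

@[simp] theorem ractHom_apply (M : ModuleCat.{u} Bᵐᵒᵖ) (b : B) (m : M) :
    ractHom M b m = ract M b m := rfl

/-! ### Restriction of derivations, and notation for right modules. -/

namespace ModDer

/-- Restriction of derivations along an algebra homomorphism. -/
def restrict (f : A →ₐ[C] B) {M N : ModuleCat.{u} Bᵐᵒᵖ} (d : ModDer M N) :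
    ModDer ((pull f).obj M) ((pull f).obj N) :=
  ⟨fun r m => d.1 (AlgHom.op f r) m,
    fun r s m => (congrArg (fun x => d.1 x m) (map_add (AlgHom.op f) r s)).trans (d.add_left _ _ m),
    fun _ m m' => d.add_right _ m m',
    fun r s m => (congrArg (fun x => d.1 x m) (map_mul (AlgHom.op f) r s)).trans (d.mul _ _ m)⟩

/-- Restriction does not change the underlying group of the extension, and `m ↦ (0, m)` is still an
additive section of it; its derivation is the restricted one. -/
theorem extRes_extClass (f : A →ₐ[C] B) {M N : ModuleCat.{u} Bᵐᵒᵖ} (d : ModDer M N) :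
    extRes f M N d.extClass = (d.restrict f).extClass := by
  refine (Abelian.Ext.mapExactFunctor_extClass (pull f) d.complex_shortExact).trans ?_
  refine (extClass_eq (d.complex_shortExact.map_of_exact (pull f)) (d.restrict f)
    (fun m => ((0 : N), m)) (fun m m' => Prod.ext (add_zero (0 : N)).symm rfl)
    (fun m => rfl) fun r m => ?_).symm
  refine Prod.ext ?_ ?_
  · change (0 : N) - ((AlgHom.op f r) • (0 : N) - d.1 (AlgHom.op f r) m) = d.1 (AlgHom.op f r) m
    rw [smul_zero]; abel
  · exact sub_self (AlgHom.op f r • (show M from m))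

section Right

variable {M N : ModuleCat.{u} Bᵐᵒᵖ}

/-- A derivation, as a function on the algebra acting from the right. -/
def val (d : ModDer M N) (b : B) (m : M) : N := d.1 (op b) m

theorem val_add (d : ModDer M N) (b : B) (m m' : M) :
    d.val b (m + m') = d.val b m + d.val b m' := d.add_right _ _ _

theorem add_val (d : ModDer M N) (b b' : B) (m : M) :
    d.val (b + b') m = d.val b m + d.val b' m := d.add_left _ _ _

theorem zero_val (d : ModDer M N) (m : M) : d.val 0 m = 0 := d.zero_left _

theorem neg_val (d : ModDer M N) (b : B) (m : M) : d.val (-b) m = -d.val b m := by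
  rw [eq_neg_iff_add_eq_zero, ← add_val, neg_add_cancel, zero_val]

/-- The opposite ring reverses the factors: on right modules `a b` acts by `a` first and then by
`b`. -/
theorem val_mul (d : ModDer M N) (a b : B) (m : M) :
    d.val (a * b) m = d.val b (ract M a m) + ract N b (d.val a m) := d.mul (op b) (op a) m

theorem ext_val {d d' : ModDer M N} (h : ∀ b m, d.val b m = d'.val b m) : d = d' :=
  Subtype.ext (funext fun b => funext fun m => h b.unop m)

theorem inner_val (f : M →+ N) (b : B) (m : M) :
    (inner f).val b m = f (ract M b m) - ract N b (f m) := rfl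

theorem extClass_eq_zero_iff_val (d : ModDer M N) : d.extClass = 0 ↔ ∃ f : M →+ N,
    ∀ b m, d.val b m = f (ract M b m) - ract N b (f m) := by
  rw [extClass_eq_zero_iff]
  exact ⟨fun ⟨f, hf⟩ => ⟨f, fun b m => hf (op b) m⟩, fun ⟨f, hf⟩ => ⟨f, fun b m => hf b.unop m⟩⟩

end Right

end ModDer

/-! ### The group action on derivations, and invariant classes. -/

namespace ConjPair

variable {G : Type u} [Group G] (P : ConjPair C A B G) {M N : ModuleCat.{u} Bᵐᵒᵖ}

/-- The value of a derivation of `A` with values in `Hom(M, N)`, for right `B`-modules `M`, `N`. -/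
def aval (d : ModDer ((pull P.incl).obj M) ((pull P.incl).obj N)) (a : A) (m : M) : N :=
  d.1 (op a) m

section aval

variable (d d' : ModDer ((pull P.incl).obj M) ((pull P.incl).obj N))

theorem aval_add (a : A) (m m' : M) : P.aval d a (m + m') = P.aval d a m + P.aval d a m' :=
  d.add_right _ _ _

theorem add_aval (a a' : A) (m : M) : P.aval d (a + a') m = P.aval d a m + P.aval d a' m :=
  d.add_left _ _ _

theorem aval_mul (a b : A) (m : M) : P.aval d (a * b) m =
    P.aval d b (ract M (P.incl a) m) + ract N (P.incl b) (P.aval d a m) :=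
  d.mul (op b) (op a) m

theorem aval_one (m : M) : P.aval d 1 m = 0 := d.one _

theorem aval_restrict (D : ModDer M N) (a : A) (m : M) :
    P.aval (D.restrict P.incl) a m = D.val (P.incl a) m := rfl

variable {P d d'} in
theorem ext_aval (h : ∀ a m, P.aval d a m = P.aval d' a m) : d = d' :=
  Subtype.ext (funext fun a => funext fun m => h a.unop m)

theorem extClass_eq_iff_aval : d.extClass = d'.extClass ↔ ∃ f : M →+ N, ∀ a m,
    P.aval d a m - P.aval d' a m = f (ract M (P.incl a) m) - ract N (P.incl a) (f m) := by
  rw [ModDer.extClass_eq_iff]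
  exact ⟨fun ⟨f, hf⟩ => ⟨f, fun b m => hf (op b) m⟩, fun ⟨f, hf⟩ => ⟨f, fun b m => hf b.unop m⟩⟩

end aval

theorem ract_conj (g : G) (X : A) (m : M) : ract M (P.incl X) (ract M (P.unit g : B) m) =
    ract M (P.unit g : B) (ract M (P.incl (P.conj g X)) m) := by
  rw [ract_ract, ract_ract, P.compat, Units.inv_mul_cancel_right]

theorem ract_conj_inv (g : G) (X : A) (m : M) :
    ract M (P.incl (P.conj g X)) (ract M ((P.unit g)⁻¹ : Bˣ) m) =
      ract M ((P.unit g)⁻¹ : Bˣ) (ract M (P.incl X) m) := by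
  rw [ract_ract, ract_ract, P.compat']

/-- The right action of `g` on derivations: `(d g)(X)(m) = d(g X g⁻¹)(m g⁻¹) g`. -/
def derAct (g : G) (d : ModDer ((pull P.incl).obj M) ((pull P.incl).obj N)) :
    ModDer ((pull P.incl).obj M) ((pull P.incl).obj N) :=
  ⟨fun X m => (ract N (P.unit g : B) (P.aval d (P.conj g X.unop)
      (ract M ((P.unit g)⁻¹ : Bˣ) m)) : N), by
    refine ⟨fun r s m => ?_, fun r m m' => ?_, fun r s m => ?_⟩
    · have key : ∀ (a b : A) (m : M), ract N (P.unit g : B) (P.aval d (P.conj g (a + b)) m) =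
          ract N (P.unit g : B) (P.aval d (P.conj g a) m) +
            ract N (P.unit g : B) (P.aval d (P.conj g b) m) := by
        intro a b m
        rw [map_add, P.add_aval, ract_add]
      exact key _ _ _
    · exact (congrArg _ ((congrArg _ (ract_add M _ _ _)).trans (P.aval_add d _ _ _))).trans
        (ract_add N _ _ _)
    · have key : ∀ (a b : A) (m : M), ract N (P.unit g : B) (P.aval d (P.conj g (b * a))
          (ract M ((P.unit g)⁻¹ : Bˣ) m)) = ract N (P.unit g : B) (P.aval d (P.conj g a)
          (ract M ((P.unit g)⁻¹ : Bˣ) (ract M (P.incl b) m))) + ract N (P.incl a)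
            (ract N (P.unit g : B) (P.aval d (P.conj g b) (ract M ((P.unit g)⁻¹ : Bˣ) m))) := by
        intro a b m
        rw [map_mul, P.aval_mul, ract_add, ract_conj_inv, ract_conj]
      exact key r.unop s.unop m⟩

theorem aval_derAct (g : G) (d : ModDer ((pull P.incl).obj M) ((pull P.incl).obj N)) (X : A)
    (m : M) : P.aval (P.derAct g d) X m =
      ract N (P.unit g : B) (P.aval d (P.conj g X) (ract M ((P.unit g)⁻¹ : Bˣ) m)) := rfl

/-- The maps `m ↦ m g⁻¹` onto the twists intertwine `derAct g d` with `d` restricted along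
conjugation, with no inner correction, so naturality of the class applies with the additive map
zero. -/
theorem extAct_extClass (g : G) (d : ModDer ((pull P.incl).obj M) ((pull P.incl).obj N)) :
    P.extAct g M N d.extClass = (P.derAct g d).extClass := by
  have h := (P.derAct g d).extClass_comp (d.restrict (P.conj g : A →ₐ[C] A))
    (P.twistIso g N).hom (P.twistIso g M).hom (fun _ => 0) (by simp) (fun r m => by
      rw [smul_zero, sub_zero, add_zero]
      exact ract_inv_ract N (P.unit g) _)
  have h1 : P.extAct g M N d.extClass = (Ext.mk₀ (P.twistIso g M).hom).comp
      ((extRes (P.conj g : A →ₐ[C] A) _ _ d.extClass).comp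
        (Ext.mk₀ (P.twistIso g N).inv) (add_zero 1)) (zero_add 1) := rfl
  rw [h1, ModDer.extRes_extClass, ← Ext.comp_assoc_of_third_deg_zero, ← h,
    Ext.comp_assoc_of_third_deg_zero, Ext.mk₀_comp_mk₀, Iso.hom_inv_id, Ext.comp_mk₀_id]

/-- `h` is a possible value at `T_g` of an extension to `B` of the derivation `d` of `A`. -/
def IsValue (d : ModDer ((pull P.incl).obj M) ((pull P.incl).obj N)) (g : G) (h : M →+ N) : Prop :=
  ∀ X m, ract N (P.incl X) (h m) + P.aval d X (ract M (P.unit g : B) m) =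
    h (ract M (P.incl (P.conj g X)) m) + ract N (P.unit g : B) (P.aval d (P.conj g X) m)

/-- Invariance means that `d g - d` is inner, given by some `f`. The substitutions `h(m) = -f(m g)`
and `f(m) = -h(m g⁻¹)` turn this identity into the one for a value at `T_g`, and back. -/
theorem extAct_extClass_eq_iff (g : G) (d : ModDer ((pull P.incl).obj M) ((pull P.incl).obj N)) :
    P.extAct g M N d.extClass = d.extClass ↔ ∃ h : M →+ N, P.IsValue d g h := by
  rw [extAct_extClass, extClass_eq_iff_aval]
  constructor
  · rintro ⟨f, hf⟩
    refine ⟨-(f.comp (ractHom M (P.unit g : B))), fun X m => ?_⟩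
    have := hf X (ract M (P.unit g : B) m)
    rw [aval_derAct, ract_inv_ract, ract_conj] at this
    simp only [AddMonoidHom.neg_apply, AddMonoidHom.comp_apply, ractHom_apply, ract_neg]
    rw [sub_eq_iff_eq_add] at this
    rw [this]; abel
  · rintro ⟨h, hh⟩
    refine ⟨-(h.comp (ractHom M ((P.unit g)⁻¹ : Bˣ))), fun X m => ?_⟩
    have := hh X (ract M ((P.unit g)⁻¹ : Bˣ) m)
    rw [ract_ract_inv, ract_conj_inv] at this
    simp only [AddMonoidHom.neg_apply, AddMonoidHom.comp_apply, ractHom_apply, ract_neg]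
    rw [aval_derAct, sub_eq_iff_eq_add, ← sub_eq_iff_eq_add.mpr ((add_comm _ _).trans this).symm]
    abel

/-- The defining identity of a value is the Leibniz rule applied to the two factorisations `g X = (g
X g⁻¹) g`. -/
theorem isValue_of_der (D : ModDer M N) (g : G) :
    P.IsValue (D.restrict P.incl) g
      (AddMonoidHom.mk' (D.val (P.unit g : B)) (D.val_add (P.unit g : B))) := by
  intro X m
  have h : (P.unit g : B) * P.incl X = P.incl (P.conj g X) * (P.unit g : B) := by
    rw [P.compat, Units.inv_mul_cancel_right]
  have h1 := D.val_mul (P.unit g : B) (P.incl X) m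
  rw [h, D.val_mul] at h1
  simp only [AddMonoidHom.mk'_apply, aval_restrict]
  rw [add_comm, ← h1]

theorem mem_extInvariants {x : Ext.{u} ((pull P.incl).obj M) ((pull P.incl).obj N) 1} :
    x ∈ P.extInvariants M N ↔ ∀ g, P.extAct g M N x = x := by
  simp [extInvariants, Submodule.mem_iInf, LinearMap.mem_eqLocus]

/-- The restriction of a class in `Ext¹_B` to `A` is invariant. -/
theorem range_extRes_le : LinearMap.range (extRes P.incl M N) ≤ P.extInvariants M N := by
  rintro _ ⟨x, rfl⟩
  obtain ⟨D, -, rfl⟩ := ModDer.extClass_surjective C x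
  rw [mem_extInvariants]
  intro g
  rw [ModDer.extRes_extClass, extAct_extClass_eq_iff]
  exact ⟨_, P.isValue_of_der D g⟩

/-- The left action of `g` on additive maps, `(g f)(m) = f(m g) g⁻¹`. -/
def homAct (g : G) (f : M →+ N) : M →+ N :=
  (ractHom N ((P.unit g)⁻¹ : Bˣ)).comp (f.comp (ractHom M (P.unit g : B)))

theorem homAct_apply (g : G) (f : M →+ N) (m : M) :
    P.homAct g f m = ract N ((P.unit g)⁻¹ : Bˣ) (f (ract M (P.unit g : B) m)) := rfl

variable (C) in
/-- Linearity over the base field of an additive map between `B`-modules. -/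
def IsScalarLinear (f : M →+ N) : Prop :=
  ∀ (c : C) m, f (ract M (algebraMap C B c) m) = ract N (algebraMap C B c) (f m)

theorem ract_algebraMap_comm (c : C) (b : B) (m : M) : ract M (algebraMap C B c) (ract M b m) =
    ract M b (ract M (algebraMap C B c) m) := by
  rw [ract_ract, ract_ract, Algebra.commutes]

theorem IsScalarLinear.ractHom_comp {f : M →+ N} (hf : IsScalarLinear C f) (b : B) :
    IsScalarLinear C ((ractHom N b).comp f) := fun c m => by
  simp only [AddMonoidHom.comp_apply, ractHom_apply]
  rw [hf, ract_algebraMap_comm]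

variable (M N) in
/-- An equivariant additive endomorphism of the additive maps `M → N` that projects the
`C`-linear maps onto the `A`-linear maps. -/
structure EquivariantProjection where
  /-- the projection -/
  proj : (M →+ N) →+ (M →+ N)
  linear : ∀ f, IsScalarLinear C f → ∀ X m, proj f (ract M (P.incl X) m) = ract N (P.incl X) (proj f m)
  eq_self : ∀ f, (∀ X m, f (ract M (P.incl X) m) = ract N (P.incl X) (f m)) → proj f = f
  equivariant : ∀ g f, proj (P.homAct g f) = P.homAct g (proj f)

/-- `B` is generated by `A` and `G` subject to the relations given by the action of `G` on `A` and
by the identification of the image in `G` of a group `Z` with units of `A`. -/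
structure IsCrossed {Z : Type u} [Group Z] (z : Z →* G) (a : Z → A) : Prop where
  incl_a : ∀ t, P.incl (a t) = P.unit (z t)
  injective : Function.Injective P.incl
  span : ∀ b : B, b ∈ AddSubgroup.closure {b | ∃ X g, b = P.incl X * P.unit g}
  lift : ∀ (E : Type u) [Ring E] [Algebra C E] (φ : A →ₐ[C] E) (τ : G →* E),
    (∀ g X, τ g * φ X = φ (P.conj g X) * τ g) → (∀ t, τ (z t) = φ (a t)) →
      ∃ Φ : B →ₐ[C] E, (∀ X, Φ (P.incl X) = φ X) ∧ ∀ g, Φ (P.unit g) = τ g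

end ConjPair

end RightModules
end

noncomputable section

/-! ### Extending derivations from `A` to `B` -/

section RightModules

open Abelian

variable {C A B : Type u} [Field C] [Ring A] [Algebra C A] [Ring B] [Algebra C B]

namespace ConjPair

variable {G : Type u} [Group G] {P : ConjPair C A B G} {M N : ModuleCat.{u} Bᵐᵒᵖ}
variable {Z : Type u} [Group Z] {z : Z →* G} {a : Z → A}

theorem IsCrossed.a_mul (hP : P.IsCrossed z a) (t t' : Z) : a (t * t') = a t * a t' := by
  apply hP.injective
  rw [map_mul, hP.incl_a, hP.incl_a, hP.incl_a, map_mul, map_mul, Units.val_mul]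

theorem IsCrossed.a_one (hP : P.IsCrossed z a) : a 1 = 1 := by
  apply hP.injective
  rw [hP.incl_a, map_one, map_one, map_one, Units.val_one]

theorem IsCrossed.a_mul_comm (hP : P.IsCrossed z a) (t : Z) (X : A) :
    a t * X = P.conj (z t) X * a t := by
  apply hP.injective
  rw [map_mul, map_mul, hP.incl_a, P.compat, Units.inv_mul_cancel_right]

/-- A derivation of `B` is determined by its values on `A` and `G`. -/
theorem IsCrossed.der_ext (hP : P.IsCrossed z a) {D D' : ModDer M N}
    (h1 : ∀ X m, D.val (P.incl X) m = D'.val (P.incl X) m)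
    (h2 : ∀ g m, D.val (P.unit g : B) m = D'.val (P.unit g : B) m) : D = D' := by
  refine ModDer.ext_val fun b => ?_
  induction hP.span b using AddSubgroup.closure_induction with
  | mem b hb =>
    obtain ⟨X, g, rfl⟩ := hb
    intro m
    rw [ModDer.val_mul, ModDer.val_mul, h1, h2]
  | zero => intro m; rw [ModDer.zero_val, ModDer.zero_val]
  | add x y _ _ hx hy => intro m; rw [ModDer.add_val, ModDer.add_val, hx, hy]
  | neg x _ hx => intro m; rw [ModDer.neg_val, ModDer.neg_val, hx]

/-! ### Gluing a derivation of `A` and values on `G` to a derivation of `B`. -/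

section Extend

variable (d : ModDer ((pull P.incl).obj M) ((pull P.incl).obj N)) (h : G → M →+ N)

/-- The operator `(n, m) ↦ (n g - h(g)(m), m g)` on the extension attached to a derivation. -/
def totalFun (g : G) : d.Total →+ d.Total where
  toFun x := ((ract N (P.unit g : B) x.1 - h g x.2 : N), (ract M (P.unit g : B) x.2 : M))
  map_zero' := Prod.ext
    (show ract N (P.unit g : B) 0 - h g 0 = 0 by rw [ract_zero, map_zero, sub_zero])
    (ract_zero M _)
  map_add' x y := Prod.ext
    (show ract N (P.unit g : B) (x.1 + y.1) - h g (x.2 + y.2) =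
        ract N (P.unit g : B) x.1 - h g x.2 + (ract N (P.unit g : B) y.1 - h g y.2) by
      refine (congrArg₂ _ (ract_add N _ _ _) (map_add (h g) _ _)).trans ?_
      abel)
    (ract_add M _ _ _)

variable {d h}

/-- On the extension defined by `d`, the condition of being a value is the relation `T_g X = (g X
g⁻¹) T_g` between the operators of `g` and of `X`. -/
theorem totalFun_smul (hc : ∀ g, P.IsValue d g (h g)) (g : G) (X : A) (x : d.Total) :
    op X • totalFun d h g x = totalFun d h g (op (P.conj g X) • x) := by
  have key : ∀ (n : N) (m : M), ract N (P.incl X) (ract N (P.unit g : B) n - h g m) -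
      P.aval d X (ract M (P.unit g : B) m) =
      ract N (P.unit g : B) (ract N (P.incl (P.conj g X)) n - P.aval d (P.conj g X) m) -
        h g (ract M (P.incl (P.conj g X)) m) := by
    intro n m
    rw [ract_sub, ract_sub, ract_conj, sub_sub, hc g X m]
    abel
  exact Prod.ext (key x.1 x.2) (P.ract_conj g X x.2)

/-- A derivation of `A` together with compatible values on `G` extends to `B`. -/
theorem IsCrossed.exists_extension (hP : P.IsCrossed z a) (hc : ∀ g, P.IsValue d g (h g))
    (hmul : ∀ g g' m, h (g * g') m =
      ract N (P.unit g' : B) (h g m) + h g' (ract M (P.unit g : B) m))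
    (hz : ∀ t m, h (z t) m = P.aval d (a t) m) :
    ∃ D : ModDer M N, D.restrict P.incl = d ∧ ∀ g m, D.val (P.unit g : B) m = h g m := by
  let : Module C d.Total := Module.compHom d.Total (algebraMap C Aᵐᵒᵖ)
  have hC : ∀ (c : C) (x : d.Total), c • x = op (algebraMap C A c) • x := fun _ _ => rfl
  have : IsScalarTower C Aᵐᵒᵖ d.Total := IsScalarTower.of_algebraMap_smul fun _ _ => rfl
  -- Right actions are homomorphisms into the opposite of the endomorphism ring; the actions of `A`
  -- and of `G` on the extension will be combined into one of `B`.
  let φ : A →ₐ[C] (Module.End C d.Total)ᵐᵒᵖ := AlgHom.opComm.symm (Algebra.lsmul C C d.Total)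
  have hφ : ∀ X x, (φ X).unop x = op X • x := fun _ _ => rfl
  have hcomm : ∀ g X x, op X • totalFun d h g x = totalFun d h g (op (P.conj g X) • x) :=
    fun g X x => totalFun_smul hc g X x
  -- Conjugation by `g` fixes the scalars of `A`, so the commutation rule for scalar `X` is the
  -- `C`-linearity of the operator of `g`.
  let L : G → Module.End C d.Total := fun g =>
    { totalFun d h g with
      map_smul' := fun c x => by
        have := hcomm g (algebraMap C A c) x
        rw [AlgEquiv.commutes] at this
        exact this.symm }
  have hL : ∀ g x, L g x = totalFun d h g x := fun _ _ => rfl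
  have h_one : ∀ m, h 1 m = 0 := fun m => by
    have := hmul 1 1 m
    rw [mul_one, map_one, Units.val_one, ract_one, ract_one] at this
    simpa using this
  let τ : G →* (Module.End C d.Total)ᵐᵒᵖ :=
    { toFun := fun g => op (L g)
      map_one' := by
        apply unop_injective
        refine LinearMap.ext fun x => ?_
        have key : ∀ (n : N) (m : M), ract N (P.unit 1 : B) n - h 1 m = n := fun n m => by
          rw [map_one, Units.val_one, ract_one, h_one, sub_zero]
        have key2 : ∀ (m : M), ract M (P.unit 1 : B) m = m := fun m => by
          rw [map_one, Units.val_one, ract_one]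
        exact Prod.ext (key x.1 x.2) (key2 x.2)
      map_mul' := fun g g' => by
        apply unop_injective
        refine LinearMap.ext fun x => ?_
        have key : ∀ (n : N) (m : M), ract N (P.unit (g * g') : B) n - h (g * g') m =
            ract N (P.unit g' : B) (ract N (P.unit g : B) n - h g m) -
              h g' (ract M (P.unit g : B) m) := fun n m => by
          rw [hmul, map_mul, Units.val_mul, ← ract_ract, ract_sub]
          abel
        have key2 : ∀ (m : M), ract M (P.unit (g * g') : B) m =
            ract M (P.unit g' : B) (ract M (P.unit g : B) m) := fun m => by
          rw [map_mul, Units.val_mul, ract_ract]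
        exact Prod.ext (key x.1 x.2) (key2 x.2) }
  -- The presentation of `B` applies: `hcomm` is its commutation relation, and `hz` says that `Z`
  -- acts in the same way through `G` and through `A`.
  obtain ⟨Φ, hΦ1, hΦ2⟩ := hP.lift _ φ τ
    (fun g X => unop_injective (LinearMap.ext fun x => hcomm g X x))
    (fun t => unop_injective (LinearMap.ext fun x => by
      have key : ∀ (n : N) (m : M), ract N (P.unit (z t) : B) n - h (z t) m =
          ract N (P.incl (a t)) n - P.aval d (a t) m := fun n m => by
        rw [hz, hP.incl_a]
      have key2 : ∀ (m : M), ract M (P.unit (z t) : B) m = ract M (P.incl (a t)) m := fun m => by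
        rw [hP.incl_a]
      exact Prod.ext (key x.1 x.2) (key2 x.2)))
  let Ψ : B → N × M → N × M := fun b x => (Φ b).unop x
  have Ψ_add : ∀ b x y, Ψ b (x + y) = Ψ b x + Ψ b y := fun b x y => map_add (Φ b).unop x y
  have add_Ψ : ∀ b b' x, Ψ (b + b') x = Ψ b x + Ψ b' x := fun b b' x => by
    change (Φ (b + b')).unop x = _
    rw [map_add]; rfl
  have zero_Ψ : ∀ x, Ψ 0 x = 0 := fun x => by
    change (Φ 0).unop x = _
    rw [map_zero]; rfl
  have neg_Ψ : ∀ b x, Ψ (-b) x = -Ψ b x := fun b x => by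
    rw [eq_neg_iff_add_eq_zero, ← add_Ψ, neg_add_cancel, zero_Ψ]
  have mul_Ψ : ∀ b b' x, Ψ (b * b') x = Ψ b' (Ψ b x) := fun b b' x => by
    change (Φ (b * b')).unop x = _
    rw [map_mul]; rfl
  have Ψ_incl : ∀ X x, Ψ (P.incl X) x =
      (ract N (P.incl X) x.1 - P.aval d X x.2, ract M (P.incl X) x.2) := fun X x => by
    change (Φ (P.incl X)).unop x = _
    rw [hΦ1]; rfl
  have Ψ_unit : ∀ g x, Ψ (P.unit g : B) x =
      (ract N (P.unit g : B) x.1 - h g x.2, ract M (P.unit g : B) x.2) := fun g x => by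
    change (Φ (P.unit g : B)).unop x = _
    rw [hΦ2]; rfl
  have haval0 : ∀ X, P.aval d X 0 = 0 := fun X => d.zero_right _
  -- The new action of `B` is an extension of the given module `M` by the given module `N`. This
  -- holds for the products `X T_g`, which generate `B` additively.
  have hsub : ∀ b, (∀ n, Ψ b (n, 0) = (ract N b n, 0)) ∧ ∀ x, (Ψ b x).2 = ract M b x.2 := by
    intro b
    induction hP.span b using AddSubgroup.closure_induction with
    | mem b hb =>
      obtain ⟨X, g, rfl⟩ := hb
      refine ⟨fun n => ?_, fun x => ?_⟩
      · rw [mul_Ψ, Ψ_incl, Ψ_unit, haval0, ract_zero, ract_zero, map_zero, sub_zero, sub_zero,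
          ract_ract]
      · rw [mul_Ψ, Ψ_incl, Ψ_unit, ract_ract]
    | zero => exact ⟨fun n => by rw [zero_Ψ, zero_ract]; rfl, fun x => by
        rw [zero_Ψ, zero_ract]; rfl⟩
    | add x y _ _ hx hy =>
      refine ⟨fun n => ?_, fun v => ?_⟩
      · rw [add_Ψ, hx.1, hy.1, add_ract, Prod.mk_add_mk, add_zero]
      · rw [add_Ψ, Prod.snd_add, hx.2, hy.2, add_ract]
    | neg x _ hx =>
      refine ⟨fun n => ?_, fun v => ?_⟩
      · rw [neg_Ψ, hx.1, neg_ract, Prod.neg_mk, neg_zero]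
      · rw [neg_Ψ, Prod.snd_neg, hx.2, neg_ract]
  -- The derivation of the section `m ↦ (0, m)`; the sign is the one in the action `r (n, m) = (r n
  -- - d(r)(m), r m)`.
  let D : ModDer M N := ⟨fun b m => -(Ψ b.unop (0, m)).1, by
    have e1 : ∀ (r s : B) (m : M), -(Ψ (r + s) (0, m)).1 =
        -(Ψ r (0, m)).1 + -(Ψ s (0, m)).1 := fun r s m => by
      rw [add_Ψ, Prod.fst_add, neg_add]
    have e2 : ∀ (r : B) (m m' : M), -(Ψ r (0, m + m')).1 =
        -(Ψ r (0, m)).1 + -(Ψ r (0, m')).1 := fun r m m' => by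
      have : ((0, m + m') : N × M) = (0, m) + (0, m') := by simp
      rw [this, Ψ_add, Prod.fst_add, neg_add]
    have e3 : ∀ (r s : B) (m : M), -(Ψ (s * r) (0, m)).1 =
        -(Ψ r (0, ract M s m)).1 + ract N r (-(Ψ s (0, m)).1) := fun r s m => by
      have : Ψ s (0, m) = ((Ψ s (0, m)).1, 0) + (0, ract M s m) :=
        Prod.ext (by simp) (by simp [(hsub s).2])
      rw [mul_Ψ]
      conv_lhs => rw [this]
      rw [Ψ_add, (hsub r).1, Prod.fst_add, ract_neg, neg_add, add_comm]
    exact ⟨fun r s m => e1 r.unop s.unop m, fun r => e2 r.unop, fun r s m => e3 r.unop s.unop m⟩⟩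
  refine ⟨D, ext_aval fun X m => ?_, fun g m => ?_⟩
  · change -(Ψ (P.incl X) (0, m)).1 = _
    rw [Ψ_incl, ract_zero, zero_sub, neg_neg]
  · change -(Ψ (P.unit g : B) (0, m)).1 = _
    rw [Ψ_unit, ract_zero, zero_sub, neg_neg]

end Extend

/-! ### Normalised values, and surjectivity of restriction onto the invariants. -/

section Lifting

variable (d : ModDer ((pull P.incl).obj M) ((pull P.incl).obj N))

/-- The new map is the value at `T_g T_g'` that the Leibniz rule dictates; the two conjugations are
carried out one after the other. -/
theorem IsValue.mul {g g' : G} {h h' : M →+ N} (hh : P.IsValue d g h) (hh' : P.IsValue d g' h') :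
    P.IsValue d (g * g') ((ractHom N (P.unit g' : B)).comp h +
      h'.comp (ractHom M (P.unit g : B))) := by
  intro X m
  simp only [AddMonoidHom.add_apply, AddMonoidHom.comp_apply, ractHom_apply]
  have e1 := hh (P.conj g' X) m
  have e2 := hh' X (ract M (P.unit g : B) m)
  rw [map_mul, map_mul, Units.val_mul, ← ract_ract, ← ract_ract, AlgEquiv.mul_apply, ← ract_conj,
    ract_add, ract_conj, add_assoc, e2, ← add_assoc, add_right_comm, ← ract_add, e1, ract_add]
  abel

/-- Two values at `T_g` differ by an `A`-linear map followed by `g`. -/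
theorem IsValue.sub_linear {g : G} {h h' : M →+ N} (hh : P.IsValue d g h) (hh' : P.IsValue d g h')
    (X : A) (m : M) :
    (ractHom N ((P.unit g)⁻¹ : Bˣ)).comp (h - h') (ract M (P.incl X) m) =
      ract N (P.incl X) ((ractHom N ((P.unit g)⁻¹ : Bˣ)).comp (h - h') m) := by
  -- Subtracting the identities of `h` and `h'` at `Y` cancels `d` and leaves `(h - h')(m) Y = (h -
  -- h')(m (g Y g⁻¹))`; applying `g⁻¹` turns this into linearity for `X = g Y g⁻¹`.
  obtain ⟨Y, rfl⟩ := (P.conj g).surjective X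
  have e1 := hh Y m
  have e2 := hh' Y m
  simp only [AddMonoidHom.comp_apply, ractHom_apply, AddMonoidHom.sub_apply]
  rw [ract_conj_inv]
  congr 1
  rw [ract_sub]
  have : ract N (P.incl Y) (h m) - ract N (P.incl Y) (h' m) =
      h (ract M (P.incl (P.conj g Y)) m) - h' (ract M (P.incl (P.conj g Y)) m) := by
    rw [sub_eq_sub_iff_add_eq_add]
    have := congrArg₂ (· - ·) e1 e2
    simp only [add_sub_add_right_eq_sub] at this
    rw [sub_eq_sub_iff_add_eq_add] at this
    exact this
  exact this.symm

/-- A value may be changed by an `A`-linear map followed by `g`. -/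
theorem IsValue.sub {g : G} {h k : M →+ N} (hh : P.IsValue d g h)
    (hk : ∀ X m, k (ract M (P.incl X) m) = ract N (P.incl X) (k m)) :
    P.IsValue d g (h - (ractHom N (P.unit g : B)).comp k) := by
  intro X m
  have e1 := hh X m
  simp only [AddMonoidHom.comp_apply, ractHom_apply, AddMonoidHom.sub_apply]
  rw [hk, ← ract_conj, ract_sub, sub_add_eq_add_sub, e1]
  abel

/-- The element `T_t` lies in `A`, where `a_t X = (t X t⁻¹) a_t`; expanding `d` on both sides gives
the identity. -/
theorem IsCrossed.isValue_a (hP : P.IsCrossed z a) (t : Z) :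
    P.IsValue d (z t) (AddMonoidHom.mk' (P.aval d (a t)) (P.aval_add d (a t))) := by
  intro X m
  have e1 := P.aval_mul d (a t) X m
  rw [hP.a_mul_comm, P.aval_mul, hP.incl_a] at e1
  simp only [AddMonoidHom.mk'_apply]
  rw [add_comm, ← e1]

variable {d} in
-- At a scalar `X` both terms with `d` vanish and conjugation does nothing. This is what permits the
-- projection to be applied to values, since its image is `A`-linear only on `C`-linear maps.
theorem IsValue.isScalarLinear (hd : ∀ c m, P.aval d (algebraMap C A c) m = 0) {g : G}
    {h : M →+ N} (hh : P.IsValue d g h) : IsScalarLinear C h := fun c m => by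
  have := hh (algebraMap C A c) m
  rw [AlgEquiv.commutes, hd, hd, ract_zero, add_zero, add_zero, AlgHom.commutes] at this
  exact this.symm

variable (Pi : P.EquivariantProjection M N)

/-- A value at an element of `Z` has no `A`-linear part, if the order of `Z` is invertible. -/
theorem IsCrossed.proj_aval (hP : P.IsCrossed z a)
    (hd : ∀ c m, P.aval d (algebraMap C A c) m = 0) [Finite Z] (hcard : (Nat.card Z : C) ≠ 0)
    (t : Z) : Pi.proj ((ractHom N ((P.unit (z t))⁻¹ : Bˣ)).comp
      (AddMonoidHom.mk' (P.aval d (a t)) (P.aval_add d (a t)))) = 0 := by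
  let e : Z → M →+ N := fun t => (ractHom N ((P.unit (z t))⁻¹ : Bˣ)).comp
      (AddMonoidHom.mk' (P.aval d (a t)) (P.aval_add d (a t)))
  -- By the Leibniz rule, `e(t) = d(a_t) t⁻¹` is a crossed homomorphism on `Z`.
  have he : ∀ t t', e (t * t') = e t + P.homAct (z t) (e t') := fun t t' => by
    ext m
    simp only [e, AddMonoidHom.comp_apply, AddMonoidHom.add_apply, ractHom_apply,
      AddMonoidHom.mk'_apply, homAct_apply]
    rw [hP.a_mul, P.aval_mul, map_mul, map_mul, mul_inv_rev, Units.val_mul, ← ract_ract, hP.incl_a,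
      hP.incl_a, ract_add, ract_add, ract_inv_ract, add_comm]
  -- After projection the action of `Z` is trivial, because an `A`-linear map commutes with `T_t =
  -- a_t`. The crossed homomorphism becomes a homomorphism, which the order of `Z` kills.
  let k : Z →* Multiplicative (M →+ N) :=
    { toFun := fun t => Multiplicative.ofAdd (Pi.proj (e t))
      map_one' := by
        have := he 1 1
        have e1 : e 1 = 0 := by
          ext m
          simp only [e, AddMonoidHom.comp_apply, ractHom_apply, AddMonoidHom.mk'_apply]
          rw [hP.a_one, P.aval_one, ract_zero]; rfl
        rw [e1, map_zero]; rfl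
      map_mul' := fun t t' => by
        have e1 : P.homAct (z t) (Pi.proj (e t')) = Pi.proj (e t') := by
          ext m
          rw [homAct_apply, ← hP.incl_a, Pi.linear _
            (((hP.isValue_a d t').isScalarLinear hd).ractHom_comp _), hP.incl_a, ract_inv_ract]
        rw [he, map_add, Pi.equivariant, e1]; rfl }
  have h1 : Nat.card Z • Pi.proj (e t) = 0 := by
    have := map_pow k t (Nat.card Z)
    rw [pow_card_eq_one', map_one] at this
    exact this.symm
  change Pi.proj (e t) = 0
  ext m
  have h2 : Nat.card Z • Pi.proj (e t) m = 0 := DFunLike.congr_fun h1 m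
  generalize Pi.proj (e t) m = n at h2
  -- Multiplication by the integer `c` is the action of a scalar of `C`, so the order of `Z` can be
  -- inverted on `N`.
  have h3 : ∀ c : ℕ, c • n = ract N (algebraMap C B c) n := fun c => by
    rw [map_natCast, ract, op_natCast, Nat.cast_smul_eq_nsmul]
  rw [h3] at h2
  have h4 := congrArg (ract N (algebraMap C B (Nat.card Z : C)⁻¹)) h2
  rw [ract_ract, ← map_mul, mul_inv_cancel₀ hcard, map_one, ract_one, ract_zero] at h4
  exact h4

/-- The restriction `Ext¹_B(M, N) → Ext¹_A(M, N)^G` is surjective, if the order of `Z` is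
invertible and there is an equivariant projection onto the `A`-linear maps. -/
theorem IsCrossed.range_extRes (hP : P.IsCrossed z a) [Finite Z] (hcard : (Nat.card Z : C) ≠ 0)
    (Pi : P.EquivariantProjection M N) :
    LinearMap.range (extRes P.incl M N) = P.extInvariants M N := by
  refine le_antisymm P.range_extRes_le fun x hx => ?_
  obtain ⟨d, hd0, rfl⟩ := ModDer.extClass_surjective C x
  have hd : ∀ c m, P.aval d (algebraMap C A c) m = 0 := fun c m => hd0 c m
  rw [mem_extInvariants] at hx
  -- The `A`-linear part of `h g⁻¹`. Values for which it vanishes are the normalised ones.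
  let norm : G → (M →+ N) → M →+ N := fun g h =>
    Pi.proj ((ractHom N ((P.unit g)⁻¹ : Bˣ)).comp h)
  have hlin : ∀ g h, P.IsValue d g h → ∀ X m,
      norm g h (ract M (P.incl X) m) = ract N (P.incl X) (norm g h m) := fun g h hh =>
    Pi.linear ((ractHom N ((P.unit g)⁻¹ : Bˣ)).comp h)
      (IsScalarLinear.ractHom_comp (hh.isScalarLinear hd) ((P.unit g)⁻¹ : Bˣ))
  -- Any value `h` becomes normalised on subtracting `k g` with `k` the `A`-linear part of `h g⁻¹`,
  -- since the projection fixes `k`.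
  have h1 : ∀ g, ∃ h : M →+ N, P.IsValue d g h ∧ norm g h = 0 := fun g => by
    obtain ⟨h, hh⟩ := (P.extAct_extClass_eq_iff g d).mp (hx g)
    refine ⟨_, hh.sub d (k := norm g h) (hlin g h hh), ?_⟩
    have : (ractHom N ((P.unit g)⁻¹ : Bˣ)).comp (h - (ractHom N (P.unit g : B)).comp (norm g h)) =
        (ractHom N ((P.unit g)⁻¹ : Bˣ)).comp h - norm g h := by
      ext m
      simp only [AddMonoidHom.comp_apply, ractHom_apply, AddMonoidHom.sub_apply, ract_sub,
        ract_inv_ract]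
    change Pi.proj _ = 0
    rw [this, map_sub, Pi.eq_self _ (hlin g h hh), sub_self]
  -- For two values, `(h - h') g⁻¹` is `A`-linear, hence equal to its projection, which is zero if
  -- both are normalised.
  have huniq : ∀ g (h h' : M →+ N), P.IsValue d g h → P.IsValue d g h' → norm g h = 0 →
      norm g h' = 0 → h = h' := fun g h h' hh hh' hn hn' => by
    have e1 := Pi.eq_self _ (hh.sub_linear d hh')
    have e2 : (ractHom N ((P.unit g)⁻¹ : Bˣ)).comp (h - h') =
        (ractHom N ((P.unit g)⁻¹ : Bˣ)).comp h - (ractHom N ((P.unit g)⁻¹ : Bˣ)).comp h' := by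
      ext m; simp
    rw [e2, map_sub] at e1
    have e3 : (ractHom N ((P.unit g)⁻¹ : Bˣ)).comp h = (ractHom N ((P.unit g)⁻¹ : Bˣ)).comp h' := by
      rw [← sub_eq_zero, ← e1]
      change norm g h - norm g h' = 0
      rw [hn, hn', sub_zero]
    ext m
    have e4 := congrArg (ract N (P.unit g : B)) (DFunLike.congr_fun e3 m)
    simpa using e4
  choose h hh hn using h1
  -- The right-hand side is a value at `g g'`. Multiplied by `(g g')⁻¹` it is `h_g g⁻¹` plus the
  -- `g`-translate of `h_g' g'⁻¹`, so equivariance shows that it is normalised, and uniqueness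
  -- identifies it.
  have hmul : ∀ g g', h (g * g') = (ractHom N (P.unit g' : B)).comp (h g) +
      (h g').comp (ractHom M (P.unit g : B)) := fun g g' => by
    refine huniq _ _ _ (hh _) ((hh g).mul d (hh g')) (hn _) ?_
    have e1 : (ractHom N ((P.unit (g * g'))⁻¹ : Bˣ)).comp
        ((ractHom N (P.unit g' : B)).comp (h g) + (h g').comp (ractHom M (P.unit g : B))) =
        (ractHom N ((P.unit g)⁻¹ : Bˣ)).comp (h g) +
          P.homAct g ((ractHom N ((P.unit g')⁻¹ : Bˣ)).comp (h g')) := by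
      ext m
      simp only [AddMonoidHom.comp_apply, ractHom_apply, AddMonoidHom.add_apply, homAct_apply]
      rw [map_mul, mul_inv_rev, Units.val_mul, ← ract_ract, ract_add, ract_add, ract_inv_ract]
    change Pi.proj _ = 0
    rw [e1, map_add, Pi.equivariant]
    have e2 : Pi.proj ((ractHom N ((P.unit g)⁻¹ : Bˣ)).comp (h g)) = 0 := hn g
    have e3 : Pi.proj ((ractHom N ((P.unit g')⁻¹ : Bˣ)).comp (h g')) = 0 := hn g'
    rw [e2, e3]
    ext m
    simp [homAct_apply, ract_zero]
  -- On `Z` the value `d(a_t)` is normalised by the averaging argument, so it is the chosen one.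
  have hz : ∀ t, h (z t) = AddMonoidHom.mk' (P.aval d (a t)) (P.aval_add d (a t)) := fun t =>
    huniq _ _ _ (hh _) (hP.isValue_a d t) (hn _) (hP.proj_aval d Pi hd hcard t)
  obtain ⟨D, hD, -⟩ := hP.exists_extension hh (fun g g' m => DFunLike.congr_fun (hmul g g') m)
    (fun t m => DFunLike.congr_fun (hz t) m)
  exact ⟨D.extClass, by rw [ModDer.extRes_extClass, hD]⟩

end Lifting

end ConjPair

end RightModules
end

noncomputable section

/-! ### The equivariant projection for modules spanned by eigenvectors -/

section RightModules

variable {C A B : Type u} [Field C] [Ring A] [Algebra C A] [Ring B] [Algebra C B]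

namespace ConjPair

variable {G : Type u} [Group G] (P : ConjPair C A B G) (M N : ModuleCat.{u} Bᵐᵒᵖ)

/-- The eigenspace of a character of `A` in a `B`-module. -/
def eigenspace (ψ : A →ₐ[C] C) : AddSubgroup M where
  carrier := {m | ∀ X, ract M (P.incl X) m = ract M (algebraMap C B (ψ X)) m}
  zero_mem' X := by rw [ract_zero, ract_zero]
  add_mem' h h' X := by rw [ract_add, ract_add, h, h']
  neg_mem' h X := by rw [ract_neg, ract_neg, h]

variable {M N}

theorem ract_mem_eigenspace (c : C) {ψ : A →ₐ[C] C} {m : M} (hm : m ∈ P.eigenspace M ψ) :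
    ract M (algebraMap C B c) m ∈ P.eigenspace M ψ := fun X => by
  rw [← ract_algebraMap_comm, hm X, ract_algebraMap_comm]

/-- The independence of characters. Applying `X - χ(X)` to the relation removes the `χ`-component
and multiplies the `ψ`-component by `ψ(X) - χ(X)`. By induction these multiples vanish, and some `X`
separates `ψ` from `χ`. -/
theorem eq_zero_of_sum_eigenspace (s : Finset (A →ₐ[C] C)) (m : (A →ₐ[C] C) → M)
    (hm : ∀ ψ, m ψ ∈ P.eigenspace M ψ) (h : ∑ ψ ∈ s, m ψ = 0) : ∀ ψ ∈ s, m ψ = 0 := by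
  classical
  induction s using Finset.induction_on generalizing m with
  | empty => simp
  | insert χ s hχ ih =>
    rw [Finset.sum_insert hχ] at h
    have h1 : ∀ X, ∀ ψ ∈ s, ract M (algebraMap C B (ψ X - χ X)) (m ψ) = 0 := fun X => by
      refine ih (fun ψ => ract M (algebraMap C B (ψ X - χ X)) (m ψ))
        (fun ψ => P.ract_mem_eigenspace _ (hm ψ)) ?_
      have e1 : ∀ ψ, ract M (algebraMap C B (ψ X - χ X)) (m ψ) =
          (ractHom M (P.incl X) - ractHom M (algebraMap C B (χ X))) (m ψ) := fun ψ => by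
        rw [AddMonoidHom.sub_apply, ractHom_apply, ractHom_apply, hm ψ X, map_sub, sub_eq_add_neg,
          add_ract, neg_ract, sub_eq_add_neg]
      simp only [e1]
      rw [← map_sum, eq_neg_of_add_eq_zero_right h, map_neg, ← e1, sub_self, map_zero, zero_ract,
        neg_zero]
    have h2 : ∀ ψ ∈ s, m ψ = 0 := fun ψ hψ => by
      have hne : ψ ≠ χ := fun e => hχ (e ▸ hψ)
      obtain ⟨X, hX⟩ : ∃ X, ψ X ≠ χ X := by
        by_contra! hcon
        exact hne (AlgHom.ext hcon)
      have := congrArg (ract M (algebraMap C B (ψ X - χ X)⁻¹)) (h1 X ψ hψ)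
      rwa [ract_ract, ← map_mul, mul_inv_cancel₀ (sub_ne_zero.mpr hX), map_one, ract_one,
        ract_zero] at this
    intro ψ hψ
    rcases Finset.mem_insert.mp hψ with rfl | hψ
    · rwa [Finset.sum_eq_zero h2, add_zero] at h
    · exact h2 ψ hψ

open Classical in
theorem eigenspace_sum_injective : Function.Injective
    (DFinsupp.sumAddHom fun ψ => (P.eigenspace M ψ).subtype) := by
  rw [injective_iff_map_eq_zero]
  intro x hx
  rw [DFinsupp.sumAddHom_apply, DFinsupp.sum] at hx
  ext ψ
  by_cases h : ψ ∈ x.support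
  · exact P.eq_zero_of_sum_eigenspace x.support (fun ψ => (x ψ : M)) (fun ψ => (x ψ).2) hx ψ h
  · rw [DFinsupp.notMem_support_iff.mp h]; rfl

open Classical in
/-- The decomposition of a module spanned by eigenvectors. -/
def eigenEquiv (hM : ⨆ ψ, P.eigenspace M ψ = ⊤) : (Π₀ ψ, P.eigenspace M ψ) ≃+ M :=
  AddEquiv.ofBijective (DFinsupp.sumAddHom fun ψ => (P.eigenspace M ψ).subtype)
    ⟨P.eigenspace_sum_injective, by
      rw [← AddMonoidHom.range_eq_top, eq_top_iff, ← hM, iSup_le_iff]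
      exact fun ψ m hm => ⟨DFinsupp.single ψ ⟨m, hm⟩, DFinsupp.sumAddHom_single _ ψ _⟩⟩

open Classical in
theorem eigenEquiv_symm (hM : ⨆ ψ, P.eigenspace M ψ = ⊤) {ψ : A →ₐ[C] C} {m : M}
    (hm : m ∈ P.eigenspace M ψ) :
    (P.eigenEquiv hM).symm m = DFinsupp.single ψ ⟨m, hm⟩ := by
  rw [AddEquiv.symm_apply_eq]
  exact (DFinsupp.sumAddHom_single (fun ψ => (P.eigenspace M ψ).subtype) ψ ⟨m, hm⟩).symm

/-- The projection onto an eigenspace. -/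
def eigenProj (hM : ⨆ ψ, P.eigenspace M ψ = ⊤) (ψ : A →ₐ[C] C) : M →+ M :=
  (P.eigenspace M ψ).subtype.comp
    ((DFinsupp.evalAddMonoidHom ψ).comp (P.eigenEquiv hM).symm.toAddMonoidHom)

theorem eigenProj_mem (hM : ⨆ ψ, P.eigenspace M ψ = ⊤) (ψ : A →ₐ[C] C) (m : M) :
    P.eigenProj hM ψ m ∈ P.eigenspace M ψ := ((P.eigenEquiv hM).symm m ψ).2

theorem eigenProj_self (hM : ⨆ ψ, P.eigenspace M ψ = ⊤) {ψ : A →ₐ[C] C} {m : M}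
    (hm : m ∈ P.eigenspace M ψ) : P.eigenProj hM ψ m = m := by
  classical
  have h : P.eigenProj hM ψ m = ((P.eigenEquiv hM).symm m ψ : M) := rfl
  rw [h, P.eigenEquiv_symm hM hm, DFinsupp.single_eq_same]

theorem eigenProj_ne (hM : ⨆ ψ, P.eigenspace M ψ = ⊤) {ψ χ : A →ₐ[C] C} (hne : χ ≠ ψ) {m : M}
    (hm : m ∈ P.eigenspace M χ) : P.eigenProj hM ψ m = 0 := by
  classical
  have h : P.eigenProj hM ψ m = ((P.eigenEquiv hM).symm m ψ : M) := rfl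
  rw [h, P.eigenEquiv_symm hM hm, DFinsupp.single_eq_of_ne hne.symm]; rfl

theorem hom_ext_eigenspace {M' : Type*} [AddCommGroup M'] (hM : ⨆ ψ, P.eigenspace M ψ = ⊤)
    {f f' : M →+ M'} (h : ∀ ψ, ∀ m ∈ P.eigenspace M ψ, f m = f' m) : f = f' := by
  have : ⊤ ≤ AddMonoidHom.eqLocus f f' := by
    rw [← hM]
    exact iSup_le fun ψ m hm => h ψ m hm
  exact AddMonoidHom.ext fun m => this (AddSubgroup.mem_top m)

/-- From `m g X = m (g X g⁻¹) g`: the group permutes the eigenspaces through its action on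
characters, which makes the block projection equivariant. -/
theorem ract_unit_mem (g : G) {ψ : A →ₐ[C] C} {m : M} (hm : m ∈ P.eigenspace M ψ) :
    ract M (P.unit g : B) m ∈ P.eigenspace M (ψ.comp (P.conj g : A →ₐ[C] A)) := fun X => by
  rw [ract_conj, hm, ract_algebraMap_comm]; rfl

/-- For `m` in the `χ`-eigenspace, `m g⁻¹` has the character `χ ∘ (g⁻¹ · g)`, which is `ψ` exactly
when `χ = ψ ∘ (g · g⁻¹)`. So both sides keep, or both kill, `m`. -/
theorem eigenProj_ract_inv (hM : ⨆ ψ, P.eigenspace M ψ = ⊤) (g : G) (ψ : A →ₐ[C] C) (m : M) :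
    P.eigenProj hM ψ (ract M ((P.unit g)⁻¹ : Bˣ) m) =
      ract M ((P.unit g)⁻¹ : Bˣ) (P.eigenProj hM (ψ.comp (P.conj g : A →ₐ[C] A)) m) := by
  have : (P.eigenProj hM ψ).comp (ractHom M ((P.unit g)⁻¹ : Bˣ)) =
      (ractHom M ((P.unit g)⁻¹ : Bˣ)).comp
        (P.eigenProj hM (ψ.comp (P.conj g : A →ₐ[C] A))) := by
    refine P.hom_ext_eigenspace hM fun χ m hm => ?_
    have hm' : ract M ((P.unit g)⁻¹ : Bˣ) m ∈
        P.eigenspace M (χ.comp (P.conj g⁻¹ : A →ₐ[C] A)) := by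
      have := P.ract_unit_mem g⁻¹ hm
      rwa [map_inv P.unit] at this
    have hconj : ∀ X, P.conj g⁻¹ (P.conj g X) = X ∧ P.conj g (P.conj g⁻¹ X) = X := fun X => by
      rw [← AlgEquiv.mul_apply, ← AlgEquiv.mul_apply, ← map_mul, ← map_mul]; simp
    simp only [AddMonoidHom.comp_apply, ractHom_apply]
    by_cases h : χ = ψ.comp (P.conj g : A →ₐ[C] A)
    · have h' : χ.comp (P.conj g⁻¹ : A →ₐ[C] A) = ψ := by
        ext X
        rw [h]
        exact congrArg ψ (hconj X).2
      rw [h'] at hm'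
      rw [P.eigenProj_self hM hm', P.eigenProj_self hM (h ▸ hm)]
    · have h' : χ.comp (P.conj g⁻¹ : A →ₐ[C] A) ≠ ψ := fun e => h (by
        ext X
        rw [← e]
        exact congrArg χ (hconj X).1.symm)
      rw [P.eigenProj_ne hM h' hm', P.eigenProj_ne hM h hm, ract_zero]
  exact DFunLike.congr_fun this m

theorem eigenProj_algebraMap (hM : ⨆ ψ, P.eigenspace M ψ = ⊤) (ψ : A →ₐ[C] C) (c : C) (m : M) :
    P.eigenProj hM ψ (ract M (algebraMap C B c) m) =
      ract M (algebraMap C B c) (P.eigenProj hM ψ m) := by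
  have : (P.eigenProj hM ψ).comp (ractHom M (algebraMap C B c)) =
      (ractHom M (algebraMap C B c)).comp (P.eigenProj hM ψ) := by
    refine P.hom_ext_eigenspace hM fun χ m hm => ?_
    simp only [AddMonoidHom.comp_apply, ractHom_apply]
    by_cases h : χ = ψ
    · subst h
      rw [P.eigenProj_self hM hm, P.eigenProj_self hM (P.ract_mem_eigenspace c hm)]
    · rw [P.eigenProj_ne hM h hm, P.eigenProj_ne hM h (P.ract_mem_eigenspace c hm), ract_zero]
  exact DFunLike.congr_fun this m

open Classical in
/-- The projection of the additive maps onto the `A`-linear maps, for modules spanned by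
eigenvectors of `A`: it keeps the components that preserve the eigencharacter. -/
def diagPart (hM : ⨆ ψ, P.eigenspace M ψ = ⊤) (hN : ⨆ ψ, P.eigenspace N ψ = ⊤) (f : M →+ N) :
    M →+ N :=
  (DFinsupp.sumAddHom fun ψ => (P.eigenProj hN ψ).comp (f.comp (P.eigenspace M ψ).subtype)).comp
    (P.eigenEquiv hM).symm.toAddMonoidHom

theorem diagPart_apply (hM : ⨆ ψ, P.eigenspace M ψ = ⊤) (hN : ⨆ ψ, P.eigenspace N ψ = ⊤)
    (f : M →+ N) {ψ : A →ₐ[C] C} {m : M} (hm : m ∈ P.eigenspace M ψ) :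
    P.diagPart hM hN f m = P.eigenProj hN ψ (f m) := by
  classical
  rw [diagPart, AddMonoidHom.comp_apply]
  change DFinsupp.sumAddHom _ ((P.eigenEquiv hM).symm m) = _
  rw [P.eigenEquiv_symm hM hm, DFinsupp.sumAddHom_single]; rfl

/-- The equivariant projection onto the `A`-linear maps, for modules spanned by eigenvectors. -/
def diagProjection (hM : ⨆ ψ, P.eigenspace M ψ = ⊤) (hN : ⨆ ψ, P.eigenspace N ψ = ⊤) :
    P.EquivariantProjection M N where
  proj := AddMonoidHom.mk' (P.diagPart hM hN) fun f f' => P.hom_ext_eigenspace hM fun ψ m hm => by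
    rw [AddMonoidHom.add_apply, P.diagPart_apply hM hN _ hm, P.diagPart_apply hM hN _ hm,
      P.diagPart_apply hM hN _ hm, AddMonoidHom.add_apply, map_add]
  -- On the `ψ`-eigenspace, `X` acts as the scalar `ψ(X)` both on `m` and on the projected image;
  -- `C`-linearity of `f` moves this scalar across.
  linear f hf X m := by
    have : (P.diagPart hM hN f).comp (ractHom M (P.incl X)) =
        (ractHom N (P.incl X)).comp (P.diagPart hM hN f) := by
      refine P.hom_ext_eigenspace hM fun ψ m hm => ?_
      simp only [AddMonoidHom.comp_apply, ractHom_apply]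
      rw [hm X, P.diagPart_apply hM hN f hm,
        P.diagPart_apply hM hN f (P.ract_mem_eigenspace _ hm), hf, P.eigenProj_mem hN ψ (f m) X,
        P.eigenProj_algebraMap]
    exact DFunLike.congr_fun this m
  -- An `A`-linear map, being `C`-linear, already sends each eigenspace into the eigenspace of the
  -- same character.
  eq_self f hf := P.hom_ext_eigenspace hM fun ψ m hm => by
    have hC : IsScalarLinear C f := fun c m => by
      rw [← AlgHom.commutes P.incl, hf]
    refine (P.diagPart_apply hM hN f hm).trans (P.eigenProj_self hN fun X => ?_)
    rw [← hf, hm X, hC]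
  equivariant g f := P.hom_ext_eigenspace hM fun ψ m hm => by
    change P.diagPart hM hN _ m = P.homAct g (P.diagPart hM hN f) m
    rw [P.diagPart_apply hM hN _ hm, homAct_apply,
      homAct_apply, P.diagPart_apply hM hN _ (P.ract_unit_mem g hm), eigenProj_ract_inv]

end ConjPair

end RightModules
end

noncomputable section

/-! ### The generic algebra is generated by the affine subalgebra and `Ω(1)` -/

namespace GenericDatum

variable {C Bs Waff Ω Zk W1 : Type u} [Field C] [Group Waff] [Group Ω] [CommGroup Zk] [Group W1]
  (D : GenericDatum C Bs Waff Ω Zk W1)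

/-- Elements of `Ω(1)` have trivial component in `W_aff`, so their image in `Ω` determines their
image in `W`, and the fibres of `W(1) → W` are cosets of `Z_κ`. -/
theorem exists_z_mul_of_toOmega_eq {o o' : W1} (ho : o ∈ D.Omega1) (ho' : o' ∈ D.Omega1)
    (h : D.toOmega o = D.toOmega o') : ∃ t, o = D.z t * o' := by
  apply D.exists_z_mul
  ext
  · rw [D.mem_Omega1.mp ho, D.mem_Omega1.mp ho']
  · exact h

/-! ### Maps out of the algebras spanned by the products `T_x T_o`. -/

section Extension

variable (K : Subgroup W1) (hK : K ≤ D.Omega1) (hz : ∀ t, D.z t ∈ K) {E : Type*} [Ring E]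
  [Algebra C E] (φ : D.aff →ₐ[C] E) (τ : K →* E)

open Classical in
/-- The linear map `T_x T_o ↦ φ(T_x) τ(o)`. -/
def extLin : D.Hecke →ₗ[C] E :=
  D.basis.constr C fun w =>
    if h : ∃ o : K, ∃ x : D.Waff1, w = x * o then
      φ (D.affT h.choose_spec.choose) * τ h.choose
    else 0

variable {K φ τ}

include hK in
-- The factorisation `w = x o` used to define the map is an arbitrary choice. Two factorisations
-- differ by moving an element of `Z_κ` from one factor to the other, and `hτ` says that this leaves
-- the value unchanged.
theorem extLin_T (hτ : ∀ t, τ ⟨D.z t, hz t⟩ = φ (D.affT ⟨D.z t, D.z_mem_Waff1 t⟩))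
    (x : D.Waff1) (o : K) : D.extLin K φ τ (D.T (x * o)) = φ (D.affT x) * τ o := by
  have h : ∃ o' : K, ∃ x' : D.Waff1, (x * o : W1) = x' * o' := ⟨o, x, rfl⟩
  rw [extLin, ← basis_apply, Module.Basis.constr_basis, dif_pos h]
  set o' := h.choose
  set x' := h.choose_spec.choose
  have hx : (x * o : W1) = x' * o' := h.choose_spec.choose_spec
  obtain ⟨t, ht⟩ := D.exists_z_mul_of_toOmega_eq (hK o.2) (hK o'.2) (by
    have h3 := congrArg D.toOmega hx
    rwa [map_mul, map_mul, D.mem_Waff1.mp x.2, D.mem_Waff1.mp x'.2, one_mul, one_mul] at h3)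
  have e1 : o = ⟨D.z t, hz t⟩ * o' := Subtype.ext ht
  have e2 : x' = x * ⟨D.z t, D.z_mem_Waff1 t⟩ := by
    ext
    rw [ht, ← mul_assoc] at hx
    exact (mul_right_cancel hx).symm
  have e3 : D.affT x' = D.affT x * D.affT ⟨D.z t, D.z_mem_Waff1 t⟩ := by
    rw [e2]
    ext
    simp only [affT, MulMemClass.mk_mul_mk, Subgroup.coe_mul]
    exact (D.T_mul_Omega1 (D.z_mem_Omega1 t) x).symm
  rw [e3, congrArg τ e1, map_mul, map_mul, hτ, mul_assoc]

include hK in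
theorem extLin_mul_T (hτ : ∀ t, τ ⟨D.z t, hz t⟩ = φ (D.affT ⟨D.z t, D.z_mem_Waff1 t⟩))
    (X : D.aff) (o : K) : D.extLin K φ τ ((X : D.Hecke) * D.T o) = φ X * τ o := by
  obtain ⟨X, hX⟩ := X
  have hX' : X ∈ Submodule.span C (D.T '' (D.Waff1 : Set W1)) := hX
  induction hX' using Submodule.span_induction with
  | mem x h =>
    obtain ⟨w, hw, rfl⟩ := h
    have := D.extLin_T hK hz hτ ⟨w, hw⟩ o
    rw [← D.T_mul_Omega1 (hK o.2)] at this
    exact this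
  | zero =>
    have : (⟨0, hX⟩ : D.aff) = 0 := rfl
    rw [this]; simp
  | add x y hx hy h1 h2 =>
    have : (⟨x + y, hX⟩ : D.aff) = ⟨x, hx⟩ + ⟨y, hy⟩ := rfl
    rw [this, map_add, add_mul, ← h1 hx, ← h2 hy, ← map_add, ← add_mul]; rfl
  | smul a x hx h =>
    have : (⟨a • x, hX⟩ : D.aff) = a • ⟨x, hx⟩ := rfl
    rw [this, map_smul, smul_mul_assoc, ← h hx, ← map_smul, ← smul_mul_assoc]; rfl

include hK in
-- By bilinearity it suffices to treat `T_x T_o T_y T_o' = T_x T_{o y o⁻¹} T_{o o'}`, and `hcomm` is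
-- the image of this commutation.
theorem extLin_mul (hτ : ∀ t, τ ⟨D.z t, hz t⟩ = φ (D.affT ⟨D.z t, D.z_mem_Waff1 t⟩))
    (hcomm : ∀ (o : K) (y : D.Waff1), τ o * φ (D.affT y) = φ (D.affT (D.cnj o y)) * τ o)
    {x y : D.Hecke} (hx : x ∈ D.sub (D.Waff1 ⊔ K) le_sup_left)
    (hy : y ∈ D.sub (D.Waff1 ⊔ K) le_sup_left) :
    D.extLin K φ τ (x * y) = D.extLin K φ τ x * D.extLin K φ τ y := by
  have hx' : x ∈ Submodule.span C (D.T '' ((D.Waff1 ⊔ K : Subgroup W1) : Set W1)) := hx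
  have hy' : y ∈ Submodule.span C (D.T '' ((D.Waff1 ⊔ K : Subgroup W1) : Set W1)) := hy
  clear hx hy
  induction hx', hy' using Submodule.span_induction₂ with
  | mem_mem x y hx hy =>
    obtain ⟨v, hv, rfl⟩ := hx
    obtain ⟨w, hw, rfl⟩ := hy
    rw [SetLike.mem_coe, Subgroup.mem_sup_of_normal_left] at hv hw
    obtain ⟨x, hx, o, ho, rfl⟩ := hv
    obtain ⟨y, hy, o', ho', rfl⟩ := hw
    have hO := hK ho
    have hO' := hK ho'
    have e1 := D.extLin_T hK hz hτ ⟨x, hx⟩ ⟨o, ho⟩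
    have e2 := D.extLin_T hK hz hτ ⟨y, hy⟩ ⟨o', ho'⟩
    have e3 : D.T (x * o) * D.T (y * o') =
        ((D.affT ⟨x, hx⟩ * D.affT (D.cnj o ⟨y, hy⟩) : D.aff) : D.Hecke) * D.T (o * o') := by
      have : ((D.affT ⟨x, hx⟩ * D.affT (D.cnj o ⟨y, hy⟩) : D.aff) : D.Hecke) =
        D.T x * D.T (o * y * o⁻¹) := rfl
      rw [this, mul_assoc, D.T_mul_Omega1 (mul_mem hO hO'), ← D.T_mul_Omega1 hO, mul_assoc,
        D.T_Omega1_mul hO]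
      congr 2; group
    have e4 := D.extLin_mul_T hK hz hτ (D.affT ⟨x, hx⟩ * D.affT (D.cnj o ⟨y, hy⟩))
      (⟨o, ho⟩ * ⟨o', ho'⟩)
    have e5 := hcomm ⟨o, ho⟩ ⟨y, hy⟩
    rw [e3, e1, e2]
    refine e4.trans ?_
    rw [map_mul, map_mul, mul_assoc, mul_assoc, ← mul_assoc (τ _) (φ _), e5, mul_assoc]
  | zero_left => simp
  | zero_right => simp
  | add_left x y z _ _ _ h1 h2 => rw [add_mul, map_add, h1, h2, map_add, add_mul]
  | add_right x y z _ _ _ h1 h2 => rw [mul_add, map_add, h1, h2, map_add, mul_add]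
  | smul_left a x y _ _ h => rw [smul_mul_assoc, map_smul, h, map_smul, smul_mul_assoc]
  | smul_right a x y _ _ h => rw [mul_smul_comm, map_smul, h, map_smul, mul_smul_comm]

end Extension

/-- The elements of `Z_κ`, in a subgroup of `W(1)`. -/
def zHom (K : Subgroup W1) (hz : ∀ t, D.z t ∈ K) : Zk →* K := D.z.codRestrict K hz

/-- A subalgebra of `ℋ` spanned by the `T_x T_o` with `x ∈ W^aff(1)` and `o` in a subgroup of `Ω(1)`
is generated by `ℋ^aff` and this subgroup. -/
theorem isCrossed_of_span {K : Subgroup W1} (hK : K ≤ D.Omega1) (hz : ∀ t, D.z t ∈ K) {S : Type u}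
    [Ring S] [Algebra C S] (P : ConjPair C D.aff S K) (j : S →ₐ[C] D.Hecke)
    (hj : Function.Injective j) (hincl : ∀ X, j (P.incl X) = X)
    (hunit : ∀ o, j (P.unit o : S) = D.T o)
    (hspan : ∀ b, j b ∈ D.sub (D.Waff1 ⊔ K) le_sup_left) :
    P.IsCrossed (D.zHom K hz) (fun t => D.affT ⟨D.z t, D.z_mem_Waff1 t⟩) where
  incl_a t := hj (by rw [hincl, hunit]; rfl)
  injective X Y h := Subtype.ext (by rw [← hincl, ← hincl, h])
  span b := by
    have key : ∀ x ∈ Submodule.span C (D.T '' ((D.Waff1 ⊔ K : Subgroup W1) : Set W1)),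
        ∃ b ∈ AddSubgroup.closure {b : S | ∃ X g, b = P.incl X * P.unit g}, j b = x := by
      intro x hx
      induction hx using Submodule.span_induction with
      | mem x hx =>
        obtain ⟨w, hw, rfl⟩ := hx
        rw [SetLike.mem_coe, Subgroup.mem_sup_of_normal_left] at hw
        obtain ⟨x, hx, o, ho, rfl⟩ := hw
        refine ⟨P.incl (D.affT ⟨x, hx⟩) * P.unit ⟨o, ho⟩,
          AddSubgroup.subset_closure ⟨_, _, rfl⟩, ?_⟩
        rw [map_mul, hincl, hunit]
        exact D.T_mul_Omega1 (hK ho) x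
      | zero => exact ⟨0, zero_mem _, map_zero j⟩
      | add x y _ _ hx hy =>
        obtain ⟨b, hb, rfl⟩ := hx
        obtain ⟨b', hb', rfl⟩ := hy
        exact ⟨b + b', add_mem hb hb', map_add j b b'⟩
      -- The closure is only additive, but a scalar can be absorbed into the factor from `ℋ^aff`.
      | smul c x hx0 hx =>
        obtain ⟨b, hb, rfl⟩ := hx
        clear hx0
        refine ⟨c • b, ?_, map_smul j c b⟩
        induction hb using AddSubgroup.closure_induction with
        | mem b hb =>
          obtain ⟨X, g, rfl⟩ := hb
          exact AddSubgroup.subset_closure ⟨c • X, g, by rw [map_smul, smul_mul_assoc]⟩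
        | zero => rw [smul_zero]; exact zero_mem _
        | add x y _ _ hx hy => rw [smul_add]; exact add_mem hx hy
        | neg x _ hx => rw [smul_neg]; exact neg_mem hx
    obtain ⟨b', hb', h⟩ := key (j b) (hspan b)
    exact hj h ▸ hb'
  lift E _ _ φ τ hcomm hτ := by
    have hconj : ∀ (o : K) (y : D.Waff1), P.conj o (D.affT y) = D.affT (D.cnj o y) := fun o y => by
      apply Subtype.ext
      rw [← hincl (P.conj o _), P.compat, map_mul, map_mul, hincl, ← map_inv, hunit, hunit]
      exact D.T_conj (hK o.2) y
    have hc : ∀ (o : K) (y : D.Waff1), τ o * φ (D.affT y) = φ (D.affT (D.cnj o y)) * τ o :=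
      fun o y => by rw [hcomm, hconj]
    have hincl' : ∀ X, D.extLin K φ τ (X : D.aff) = φ X := fun X => by
      have := D.extLin_mul_T hK hz hτ X 1
      rwa [map_one, mul_one, Subgroup.coe_one, D.T_one, mul_one] at this
    refine ⟨AlgHom.ofLinearMap ((D.extLin K φ τ).comp j.toLinearMap) ?_ ?_, fun X => ?_,
      fun o => ?_⟩
    · have := hincl' 1
      rw [map_one] at this
      change D.extLin K φ τ (j 1) = 1
      rw [map_one]
      exact this
    · intro x y
      change D.extLin K φ τ (j (x * y)) = _
      rw [map_mul]
      exact D.extLin_mul hK hz hτ hc (hspan x) (hspan y)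
    · change D.extLin K φ τ (j (P.incl X)) = φ X
      rw [hincl, hincl']
    · change D.extLin K φ τ (j (P.unit o : S)) = τ o
      have := D.extLin_mul_T hK hz hτ 1 o
      rw [map_one, one_mul] at this
      rw [hunit, ← this]
      congr 1
      exact (one_mul _).symm

/-- Every `w` in `W(1)` is a product from `W^aff(1)` and `Ω(1)`: the second factor is any lift of
its image in `Ω`. -/
theorem mem_sub_Omega1 (x : D.Hecke) : x ∈ D.sub (D.Waff1 ⊔ D.Omega1) le_sup_left := by
  have h : D.Waff1 ⊔ D.Omega1 = ⊤ := by
    refine eq_top_iff.mpr fun w _ => ?_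
    obtain ⟨g, hg⟩ := D.toOmega_surjective (D.toOmega w)
    have h1 : w * (g : W1)⁻¹ ∈ D.Waff1 := by
      rw [mem_Waff1, map_mul, map_inv, hg, mul_inv_cancel]
    have := Subgroup.mul_mem_sup h1 g.2
    rwa [inv_mul_cancel_right] at this
  have h2 : x ∈ Submodule.span C (D.T '' ((D.Waff1 ⊔ D.Omega1 : Subgroup W1) : Set W1)) := by
    rw [h, Subgroup.coe_top, Set.image_univ]
    exact D.T_span trivial
  exact h2

theorem isCrossed_pair : D.pair.IsCrossed (D.zHom D.Omega1 D.z_mem_Omega1)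
    (fun t => D.affT ⟨D.z t, D.z_mem_Waff1 t⟩) :=
  D.isCrossed_of_span le_rfl D.z_mem_Omega1 D.pair (AlgHom.id C D.Hecke) Function.injective_id
    (fun _ => rfl) (fun _ => rfl) D.mem_sub_Omega1

variable (Xi Xi' : D.aff →ₐ[C] C)

/-- In the basis `T_w`, the support of an element of the intersection lies in both `W^aff(1) Ω(1)_Ξ`
and `W^aff(1) Ω(1)_Ξ'`. The two resulting factors from `Ω(1)` differ by an element of `Z_κ`, which
lies in both stabilizers, so the first factor lies in `Ω(1)_{Ξ,Ξ'}`. -/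
theorem HXi2_le : D.HXi2 Xi Xi' ≤ D.sub (D.Waff1 ⊔ D.stab2 Xi Xi') le_sup_left := by
  intro x hx
  have h1 : x ∈ Submodule.span C (D.T '' ((D.Waff1 ⊔ D.stab Xi : Subgroup W1) : Set W1)) :=
    D.HXi_le Xi hx.1
  have h2 : x ∈ Submodule.span C (D.T '' ((D.Waff1 ⊔ D.stab Xi' : Subgroup W1) : Set W1)) :=
    D.HXi_le Xi' hx.2
  have hb : D.T = D.basis := funext fun w => (D.basis_apply w).symm
  have h3 : x ∈ Submodule.span C
      (D.T '' ((D.Waff1 ⊔ D.stab2 Xi Xi' : Subgroup W1) : Set W1)) := by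
    rw [hb, Module.Basis.mem_span_image] at h1 h2 ⊢
    intro w hw
    have hw1 := h1 hw
    have hw2 := h2 hw
    rw [SetLike.mem_coe, Subgroup.mem_sup_of_normal_left] at hw1 hw2
    obtain ⟨x, hx, o, ho, rfl⟩ := hw1
    obtain ⟨x', hx', o', ho', h⟩ := hw2
    obtain ⟨t, ht⟩ := D.exists_z_mul_of_toOmega_eq ho.1 ho'.1 (by
      have h3 := congrArg D.toOmega h
      rw [map_mul, map_mul, D.mem_Waff1.mp hx, D.mem_Waff1.mp hx', one_mul, one_mul] at h3
      exact h3.symm)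
    refine Subgroup.mul_mem_sup hx ⟨ho, ?_⟩
    rw [ht]
    exact mul_mem (D.z_mem_stab Xi' t) ho'
  exact h3

theorem z_mem_stab2 (t : Zk) : D.z t ∈ D.stab2 Xi Xi' := ⟨D.z_mem_stab Xi t, D.z_mem_stab Xi' t⟩

theorem isCrossed_pair2 : (D.pair2 Xi Xi').IsCrossed
    (D.zHom (D.stab2 Xi Xi') (D.z_mem_stab2 Xi Xi'))
    (fun t => D.affT ⟨D.z t, D.z_mem_Waff1 t⟩) :=
  D.isCrossed_of_span (inf_le_left.trans (D.stab_le Xi)) (D.z_mem_stab2 Xi Xi') (D.pair2 Xi Xi')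
    (D.HXi2 Xi Xi').val Subtype.val_injective (fun _ => rfl) (fun _ => rfl)
    (fun b => D.HXi2_le Xi Xi' b.2)

/-! ### The modules `Ξ ⊗ V` and `π` are spanned by eigenvectors -/

section Modules

variable {V : Type u} [AddCommGroup V] [Module C V] (ρ : Representation C (D.stab Xi)ᵐᵒᵖ V)
  (hρ : D.Compatible Xi ρ)

theorem ract_xiMod (X : D.aff) (v : D.xiMod Xi ρ hρ) :
    ract (D.xiMod Xi ρ hρ) (Subalgebra.inclusion (D.aff_le_HXi Xi) X) v =
      (show D.xiMod Xi ρ hρ from Xi X • (show V from v)) := by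
  have h := D.xiMod_apply Xi ρ hρ X 1 v
  have e : (⟨X * D.T (1 : D.stab Xi), mul_mem (D.aff_le_HXi Xi X.2)
      (D.T_mem_HXi Xi (1 : D.stab Xi).2)⟩ : D.HXi Xi) = Subalgebra.inclusion (D.aff_le_HXi Xi) X :=
    Subtype.ext (by
      change (X : D.Hecke) * D.T ((1 : D.stab Xi) : W1) = X
      rw [Subgroup.coe_one, D.T_one, mul_one])
  rw [e, op_one, map_one] at h
  exact h

theorem ract_xiMod_algebraMap (X : D.aff) (v : D.xiMod Xi ρ hρ) :
    ract (D.xiMod Xi ρ hρ) (Subalgebra.inclusion (D.aff_le_HXi Xi) X) v =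
      ract (D.xiMod Xi ρ hρ) (algebraMap C _ (Xi X)) v := by
  have h := D.ract_xiMod Xi ρ hρ (algebraMap C D.aff (Xi X)) v
  rw [AlgHom.commutes, AlgHom.commutes] at h
  rw [h, ract_xiMod]; rfl

/-- Since `ℋ` is the sum of the `ℋ^aff T_g`, the module is spanned by the `T_g ⊗ n`. As `T_g X = (g
X g⁻¹) T_g` and the left factor passes through the tensor sign, these are eigenvectors for the
conjugates of `Ξ`. -/
theorem piMod_eigenspace : ⨆ ψ, D.pair.eigenspace (D.piMod Xi ρ hρ) ψ = ⊤ := by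
  let R : Submodule D.Heckeᵐᵒᵖ (D.Hecke ⊗[ℤ] D.xiMod Xi ρ hρ) := Submodule.span _
    {x | ∃ (a : D.HXi Xi) (b : D.Hecke) (n : D.xiMod Xi ρ hρ),
      x = ((a : D.Hecke) * b) ⊗ₜ[ℤ] n - b ⊗ₜ[ℤ] ract (D.xiMod Xi ρ hρ) a n}
  let mk : D.Hecke → D.xiMod Xi ρ hρ → D.piMod Xi ρ hρ := fun b n => R.mkQ (b ⊗ₜ[ℤ] n)
  have mk_rel : ∀ (a : D.HXi Xi) b n,
      mk ((a : D.Hecke) * b) n = mk b (ract (D.xiMod Xi ρ hρ) a n) := fun a b n => by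
    refine (Submodule.Quotient.eq R).mpr (Submodule.subset_span ⟨a, b, n, rfl⟩)
  have ract_mk : ∀ b b' n, ract (D.piMod Xi ρ hρ) b' (mk b n) = mk (b * b') n := fun b b' n => rfl
  have mk_add : ∀ b b' n, mk (b + b') n = mk b n + mk b' n := fun b b' n => by
    change R.mkQ ((b + b') ⊗ₜ[ℤ] n) = _
    rw [TensorProduct.add_tmul, map_add]; rfl
  have mk_zero : ∀ n, mk 0 n = 0 := fun n => by
    simpa using mk_add 0 0 n
  have hT : ∀ (g : D.Omega1) n, mk (D.T g) n ∈ ⨆ ψ, D.pair.eigenspace (D.piMod Xi ρ hρ) ψ :=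
    fun g n => by
      -- The eigencharacter of `T_g ⊗ n` is `X ↦ Ξ(T_g X T_g⁻¹)`.
      refine AddSubgroup.mem_iSup_of_mem (Xi.comp (D.affConj g : D.aff →ₐ[C] D.aff)) fun X => ?_
      have e1 : D.T (g : W1) * (D.pair.incl X : D.Hecke) =
          (Subalgebra.inclusion (D.aff_le_HXi Xi) (D.affConj g X) : D.Hecke) * D.T g := by
        have h := D.pair.compat g X
        have h2 : D.pair.incl (D.pair.conj g X) * D.T g = D.T (g : W1) * D.pair.incl X := by
          rw [h, mul_assoc]
          have h3 : ((D.pair.unit g)⁻¹ : D.Heckeˣ) * D.T (g : W1) = 1 := Units.inv_mul _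
          rw [h3, mul_one]; rfl
        exact h2.symm
      have e2 : ∀ c : C, D.T (g : W1) * algebraMap C D.Hecke c =
          (algebraMap C (D.HXi Xi) c : D.Hecke) * D.T g := fun c => (Algebra.commutes c _).symm
      rw [ract_mk, ract_mk, e1, e2, mk_rel, mk_rel, ract_xiMod_algebraMap]; rfl
  refine eq_top_iff.mpr fun x _ => ?_
  have hx : ∀ y : D.Hecke ⊗[ℤ] D.xiMod Xi ρ hρ,
      R.mkQ y ∈ (⨆ ψ, D.pair.eigenspace (D.piMod Xi ρ hρ) ψ : AddSubgroup (D.piMod Xi ρ hρ)) := by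
    intro y
    induction y using TensorProduct.induction_on with
    | zero => rw [map_zero]; exact zero_mem _
    | add y y' h h' => rw [map_add]; exact add_mem h h'
    | tmul b n =>
      change mk b n ∈ _
      induction D.isCrossed_pair.span b using AddSubgroup.closure_induction with
      | mem b hb =>
        obtain ⟨X, g, rfl⟩ := hb
        have := mk_rel (Subalgebra.inclusion (D.aff_le_HXi Xi) X) (D.T g) n
        exact this.symm ▸ hT g _
      | zero => rw [mk_zero]; exact zero_mem _
      | add x y _ _ hx hy => rw [mk_add]; exact add_mem hx hy
      | neg x _ hx =>
        have : mk (-x) n = -mk x n := by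
          rw [eq_neg_iff_add_eq_zero, ← mk_add, neg_add_cancel, mk_zero]
        rw [this]; exact neg_mem hx
  obtain ⟨y, rfl⟩ := R.mkQ_surjective x
  exact hx y

theorem xiMod_eigenspace (Xi₁ Xi₂ : D.aff →ₐ[C] C) (h : D.HXi2 Xi₁ Xi₂ ≤ D.HXi Xi) :
    ⨆ ψ, (D.pair2 Xi₁ Xi₂).eigenspace ((pull (Subalgebra.inclusion h)).obj (D.xiMod Xi ρ hρ)) ψ =
      ⊤ :=
  eq_top_iff.mpr fun v _ => AddSubgroup.mem_iSup_of_mem Xi fun X =>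
    D.ract_xiMod_algebraMap Xi ρ hρ X v

end Modules

end GenericDatum
end

noncomputable section

/-! ### The inflation map -/

theorem exists_linearMap_comp_eq {C U V X : Type*} [Field C] [AddCommGroup U] [Module C U]
    [AddCommGroup V] [Module C V] [AddCommGroup X] [Module C X] (f : U →ₗ[C] V)
    (hf : Function.Surjective f) (L : U →ₗ[C] X) (h : ∀ u, L u = 0 ↔ f u = 0) :
    ∃ ι : V →ₗ[C] X, (∀ u, ι (f u) = L u) ∧ Function.Injective ι := by
  have hle : LinearMap.ker f ≤ LinearMap.ker L := fun u hu => (h u).mpr hu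
  let ι : V →ₗ[C] X := ((LinearMap.ker f).liftQ L hle).comp
    (f.quotKerEquivOfSurjective hf).symm.toLinearMap
  have hι : ∀ u, ι (f u) = L u := fun u => by
    have : (f.quotKerEquivOfSurjective hf).symm (f u) = Submodule.Quotient.mk u := by
      rw [LinearEquiv.symm_apply_eq]; rfl
    change (LinearMap.ker f).liftQ L hle ((f.quotKerEquivOfSurjective hf).symm (f u)) = _
    rw [this]
    rfl
  refine ⟨ι, hι, ?_⟩
  rw [injective_iff_map_eq_zero]
  intro v hv
  obtain ⟨u, rfl⟩ := hf v
  rw [hι] at hv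
  exact (h u).mp hv

/-- Vector spaces split: the kernel of `f` is the copy of `U`, and a complement maps isomorphically
onto the range. -/
theorem nonempty_equiv_prod_of_exact {C U V X : Type*} [Field C] [AddCommGroup U] [Module C U]
    [AddCommGroup V] [Module C V] [AddCommGroup X] [Module C X] (ι : U →ₗ[C] V) (f : V →ₗ[C] X)
    (hι : Function.Injective ι) (hr : LinearMap.range ι = LinearMap.ker f) :
    Nonempty (V ≃ₗ[C] U × LinearMap.range f) := by
  obtain ⟨q, hq⟩ := Submodule.exists_isCompl (LinearMap.ker f)
  exact ⟨(Submodule.prodEquivOfIsCompl _ q hq).symm.trans (LinearEquiv.prodCongr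
    (((LinearEquiv.ofInjective ι hι).trans (LinearEquiv.ofEq _ _ hr)).symm)
    ((Submodule.quotientEquivOfIsCompl _ q hq).symm.trans f.quotKerEquivRange))⟩

namespace GenericDatum

open Abelian

variable {C Bs Waff Ω Zk W1 : Type u} [Field C] [Group Waff] [Group Ω] [CommGroup Zk] [Group W1]
  (D : GenericDatum C Bs Waff Ω Zk W1) {M N : ModuleCat.{u} D.Heckeᵐᵒᵖ}

/-- An `ℋ^aff`-linear map, as an additive map between `ℋ`-modules. -/
def addHom (f : (pull D.pair.incl).obj M ⟶ (pull D.pair.incl).obj N) : M →+ N :=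
  AddMonoidHom.mk' (D.pair.mapFun (M := M) (N := N) f) (fun x y => map_add f.hom x y)

theorem addHom_linear (f : (pull D.pair.incl).obj M ⟶ (pull D.pair.incl).obj N) (X : D.aff)
    (m : M) : D.addHom f (ract M (D.pair.incl X) m) = ract N (D.pair.incl X) (D.addHom f m) :=
  f.hom.map_smul (op X) m

theorem addHom_homRep (g : D.Omega1) (f : (pull D.pair.incl).obj M ⟶ (pull D.pair.incl).obj N)
    (m : M) : D.addHom (D.pair.homRep M N g f) m =
      ract N ((D.pair.unit g)⁻¹ : D.Heckeˣ) (D.addHom f (ract M (D.pair.unit g : D.Hecke) m)) :=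
  D.pair.homRep_apply M N g f m

variable {D} in
theorem addHom_injective {f f' : (pull D.pair.incl).obj M ⟶ (pull D.pair.incl).obj N}
    (h : ∀ m, D.addHom f m = D.addHom f' m) : f = f' := by
  ext m
  exact h m

/-- The morphism attached to an `ℋ^aff`-linear additive map. -/
def ofAddHom (f : M →+ N)
    (hf : ∀ X m, f (ract M (D.pair.incl X) m) = ract N (D.pair.incl X) (f m)) :
    (pull D.pair.incl).obj M ⟶ (pull D.pair.incl).obj N :=
  ModuleCat.ofHom (X := (pull D.pair.incl).obj M) (Y := (pull D.pair.incl).obj N)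
    { toFun := fun m => f m
      map_add' := map_add f
      map_smul' := fun r m => hf r.unop m }

theorem addHom_ofAddHom (f : M →+ N)
    (hf : ∀ X m, f (ract M (D.pair.incl X) m) = ract N (D.pair.incl X) (f m)) (m : M) :
    D.addHom (D.ofAddHom f hf) m = f m := rfl

/-! ### Cocycles of `Ω` and derivations that vanish on `ℋ^aff`. -/

section Cocycles

variable (M N) in
/-- The cocycles of `Ω` with values in `Hom_{ℋ^aff}(M, N)`. -/
abbrev Cocycles : Type u := groupCohomology.cocycles₁ (Rep.of (D.omegaRep M N))

/-- The value of a cocycle, as an additive map. -/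
def cocycleFun (z : D.Cocycles M N) (o : Ω) : M →+ N := D.addHom (z o)

theorem cocycleFun_mul (z : D.Cocycles M N) (g g' : D.Omega1) (m : M) :
    D.cocycleFun z (D.toOmega (g * g' : D.Omega1)) m =
      ract N ((D.pair.unit g)⁻¹ : D.Heckeˣ) (D.cocycleFun z (D.toOmega g')
        (ract M (D.pair.unit g : D.Hecke) m)) + D.cocycleFun z (D.toOmega g) m := by
  have h : z (D.toOmega g * D.toOmega g') = D.omegaRep M N (D.toOmega g) (z (D.toOmega g')) +
    z (D.toOmega g) := (groupCohomology.mem_cocycles₁_iff _).mp z.2 (D.toOmega g) (D.toOmega g')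
  rw [omegaRep_toOmega] at h
  have h2 := congrArg (fun f => D.addHom f m) h
  rw [Subgroup.coe_mul, map_mul]
  refine h2.trans ?_
  change D.addHom (D.pair.homRep M N g (z (D.toOmega g'))) m + D.addHom (z (D.toOmega g)) m = _
  rw [addHom_homRep]; rfl

theorem cocycleFun_one (z : D.Cocycles M N) (m : M) : D.cocycleFun z 1 m = 0 := by
  have h := groupCohomology.cocycles₁_map_one z
  exact congrArg (fun f => D.addHom f m) h

/-- The zero derivation of `ℋ^aff` is extended with the values `m ↦ z_g(m) g`. These are values
because `z_g` is `ℋ^aff`-linear, they multiply correctly by the cocycle identity, and they vanish on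
`Z_κ` because `z_1 = 0`. -/
theorem exists_infl (z : D.Cocycles M N) :
    ∃ E : ModDer M N, E.restrict D.pair.incl = 0 ∧ ∀ g m, E.val (D.pair.unit g : D.Hecke) m =
      ract N (D.pair.unit g : D.Hecke) (D.cocycleFun z (D.toOmega g) m) := by
  refine D.isCrossed_pair.exists_extension (d := 0) (h := fun g =>
    (ractHom N (D.pair.unit g : D.Hecke)).comp (D.cocycleFun z (D.toOmega g)))
    (fun g X m => ?_) (fun g g' m => ?_) (fun t m => ?_)
  · simp only [AddMonoidHom.comp_apply, ractHom_apply]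
    have h0 : ∀ X (m : M), D.pair.aval (M := M) (N := N) 0 X m = 0 := fun _ _ => rfl
    rw [h0, h0, ConjPair.ract_conj, cocycleFun, addHom_linear, ract_zero]
  · simp only [AddMonoidHom.comp_apply, ractHom_apply]
    rw [cocycleFun_mul, ract_add, map_mul, Units.val_mul, ← ract_ract, ract_ract_inv, ← ract_ract,
      add_comm]
  · simp only [AddMonoidHom.comp_apply, ractHom_apply]
    have h1 : D.toOmega (D.zHom D.Omega1 D.z_mem_Omega1 t) = 1 :=
      D.mem_Waff1.mp (D.z_mem_Waff1 t)
    rw [h1, cocycleFun_one, ract_zero]; rfl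

/-- The derivation attached to a cocycle. -/
def inflDer (z : D.Cocycles M N) : ModDer M N := (D.exists_infl z).choose

theorem inflDer_restrict (z : D.Cocycles M N) : (D.inflDer z).restrict D.pair.incl = 0 :=
  (D.exists_infl z).choose_spec.1

theorem inflDer_incl (z : D.Cocycles M N) (X : D.aff) (m : M) :
    (D.inflDer z).val (D.pair.incl X) m = 0 := by
  rw [← D.pair.aval_restrict, inflDer_restrict]; rfl

theorem inflDer_unit (z : D.Cocycles M N) (g : D.Omega1) (m : M) :
    (D.inflDer z).val (D.pair.unit g : D.Hecke) m =
      ract N (D.pair.unit g : D.Hecke) (D.cocycleFun z (D.toOmega g) m) :=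
  (D.exists_infl z).choose_spec.2 g m

theorem eq_inflDer {z : D.Cocycles M N} {E : ModDer M N}
    (h1 : ∀ X m, E.val (D.pair.incl X) m = 0)
    (h2 : ∀ g m, E.val (D.pair.unit g : D.Hecke) m =
      ract N (D.pair.unit g : D.Hecke) (D.cocycleFun z (D.toOmega g) m)) : E = D.inflDer z :=
  D.isCrossed_pair.der_ext (fun X m => by rw [h1, inflDer_incl])
    (fun g m => by rw [h2, inflDer_unit])

theorem inflDer_add (z z' : D.Cocycles M N) :
    D.inflDer (z + z') = D.inflDer z + D.inflDer z' := by
  have h : ∀ b m, (D.inflDer z + D.inflDer z').val b m =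
    (D.inflDer z).val b m + (D.inflDer z').val b m := fun _ _ => rfl
  refine (D.eq_inflDer (fun X m => ?_) (fun g m => ?_)).symm
  · rw [h, inflDer_incl, inflDer_incl, add_zero]
  · rw [h, inflDer_unit, inflDer_unit, ← ract_add]; rfl

theorem inflDer_smul (c : C) (z : D.Cocycles M N) :
    D.inflDer (c • z) = (D.inflDer z).postcomp (c • 𝟙 N) := by
  have h : ∀ b m, ((D.inflDer z).postcomp (c • 𝟙 N)).val b m =
    ract N (algebraMap C D.Hecke c) ((D.inflDer z).val b m) := fun _ _ => rfl
  have h2 : ∀ o m, D.cocycleFun (c • z) o m =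
    ract N (algebraMap C D.Hecke c) (D.cocycleFun z o m) := fun _ _ => rfl
  refine (D.eq_inflDer (fun X m => ?_) (fun g m => ?_)).symm
  · rw [h, inflDer_incl, ract_zero]
  · rw [h, inflDer_unit, ConjPair.ract_algebraMap_comm, h2]

variable (M N) in
/-- The class of the extension attached to a cocycle. -/
def inflLin : D.Cocycles M N →ₗ[C] Ext.{u} M N 1 where
  toFun z := (D.inflDer z).extClass
  map_add' z z' := by rw [inflDer_add, ModDer.extClass_add]
  map_smul' c z := by
    rw [inflDer_smul, ModDer.extClass_postcomp, ← Ext.smul_eq_comp_mk₀, RingHom.id_apply]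

/-- Suppose the inflated derivation is inner, given by `f`. Its vanishing on `ℋ^aff` says that `f`
is `ℋ^aff`-linear, and its value at `T_g` then says that `z_g = g f - f`. The converse reverses
this. -/
theorem inflLin_eq_zero_iff (z : D.Cocycles M N) : D.inflLin M N z = 0 ↔
    (groupCohomology.H1π (Rep.of (D.omegaRep M N))).hom z = 0 := by
  refine Iff.trans ?_ (groupCohomology.H1π_eq_zero_iff z).symm
  change (D.inflDer z).extClass = 0 ↔ _
  rw [ModDer.extClass_eq_zero_iff_val]
  constructor
  · rintro ⟨f, hf⟩
    have hlin : ∀ X m, f (ract M (D.pair.incl X) m) = ract N (D.pair.incl X) (f m) :=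
      fun X m => by
        rw [← sub_eq_zero, ← hf, inflDer_incl]
    refine ⟨D.ofAddHom f hlin, funext fun o => ?_⟩
    obtain ⟨g, rfl⟩ := D.toOmega_surjective o
    change D.omegaRep M N (D.toOmega g) (D.ofAddHom f hlin) - D.ofAddHom f hlin = z (D.toOmega g)
    rw [omegaRep_toOmega]
    refine addHom_injective fun m => ?_
    have h1 := hf (D.pair.unit g : D.Hecke) m
    rw [inflDer_unit] at h1
    have h2 := congrArg (ract N ((D.pair.unit g)⁻¹ : D.Heckeˣ)) h1
    rw [ract_inv_ract, ract_sub, ract_inv_ract] at h2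
    refine Eq.trans ?_ h2.symm
    change D.addHom (D.pair.homRep M N g (D.ofAddHom f hlin)) m - f m = _
    rw [addHom_homRep, addHom_ofAddHom]
  · rintro ⟨f, hf⟩
    let f : (pull D.pair.incl).obj M ⟶ (pull D.pair.incl).obj N := f
    refine ⟨D.addHom f, fun b m => ?_⟩
    have : ModDer.inner (D.addHom f) = D.inflDer z := by
      refine D.eq_inflDer (fun X m => ?_) (fun g m => ?_)
      · rw [ModDer.inner_val, addHom_linear, sub_self]
      · have h1 : D.omegaRep M N (D.toOmega g) f - f = z (D.toOmega g) :=
          congrFun hf (D.toOmega g)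
        rw [omegaRep_toOmega] at h1
        have h2 : D.addHom (D.pair.homRep M N g f) m - D.addHom f m =
          D.cocycleFun z (D.toOmega g) m := congrArg (fun f => D.addHom f m) h1
        rw [ModDer.inner_val, ← h2, addHom_homRep, ract_sub, ract_ract_inv]
    rw [← this, ModDer.inner_val]

/-- A derivation of `ℋ` that vanishes on `ℋ^aff` comes from a cocycle. -/
theorem exists_eq_inflDer {E : ModDer M N} (hE : E.restrict D.pair.incl = 0) :
    ∃ z, E = D.inflDer z := by
  have h0 : ∀ X m, E.val (D.pair.incl X) m = 0 := fun X m => by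
    rw [← D.pair.aval_restrict, hE]; rfl
  let e : D.Omega1 → M →+ N := fun g => (ractHom N ((D.pair.unit g)⁻¹ : D.Heckeˣ)).comp
    (AddMonoidHom.mk' (E.val (D.pair.unit g : D.Hecke)) (E.val_add _))
  have he : ∀ g m, E.val (D.pair.unit g : D.Hecke) m = ract N (D.pair.unit g : D.Hecke) (e g m) :=
    fun g m => (ract_ract_inv N _ _).symm
  have hlin : ∀ g X m, e g (ract M (D.pair.incl X) m) = ract N (D.pair.incl X) (e g m) :=
    fun g X m => by
      -- For the zero derivation of `ℋ^aff`, the map `0` is another value at `T_g`, so the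
      -- difference of two values is the value of `E` itself.
      have h := (D.pair.isValue_of_der E g).sub_linear _
        (h' := 0) (fun X m => by
          have h0 : ∀ X (m : M), D.pair.aval (E.restrict D.pair.incl) X m = 0 := h0
          rw [h0, h0, ract_zero]
          simp [ract_zero]) X m
      rw [sub_zero] at h
      exact h
  have hmul : ∀ (g g' : D.Omega1) m, e (g * g') m = ract N ((D.pair.unit g)⁻¹ : D.Heckeˣ)
      (e g' (ract M (D.pair.unit g : D.Hecke) m)) + e g m := fun g g' m => by
    simp only [e, AddMonoidHom.comp_apply, ractHom_apply, AddMonoidHom.mk'_apply]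
    rw [map_mul, Units.val_mul, ModDer.val_mul, mul_inv_rev, Units.val_mul, ← ract_ract, ract_add,
      ract_add, ract_inv_ract]
  have hz : ∀ t m, e (D.zHom D.Omega1 D.z_mem_Omega1 t) m = 0 := fun t m => by
    simp only [e, AddMonoidHom.comp_apply, ractHom_apply, AddMonoidHom.mk'_apply]
    rw [← D.isCrossed_pair.incl_a, h0, ract_zero]
  -- The map `e` vanishes on `Z_κ` and takes `ℋ^aff`-linear values, so the cocycle rule shows that
  -- it is constant on cosets of `Z_κ` and descends to `Ω`.
  have hcongr : ∀ g g' : D.Omega1, D.toOmega g = D.toOmega g' → e g = e g' := fun g g' h => by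
    obtain ⟨t, ht⟩ := D.exists_z_mul_of_toOmega_eq g.2 g'.2 h
    have ht' : g = D.zHom D.Omega1 D.z_mem_Omega1 t * g' := Subtype.ext ht
    ext m
    rw [ht', hmul, hz, ← D.isCrossed_pair.incl_a, hlin, D.isCrossed_pair.incl_a, ract_inv_ract,
      add_zero]
  let z0 : Ω → ((pull D.pair.incl).obj M ⟶ (pull D.pair.incl).obj N) := fun o =>
    D.ofAddHom (e (D.liftOmega o)) (hlin _)
  have hz0 : ∀ (g : D.Omega1) m, D.addHom (z0 (D.toOmega g)) m = e g m := fun g m => by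
    rw [addHom_ofAddHom, hcongr _ _ (D.toOmega_liftOmega _)]
  let z : D.Cocycles M N := ⟨z0, by
    rw [groupCohomology.mem_cocycles₁_iff]
    intro o o'
    obtain ⟨g, rfl⟩ := D.toOmega_surjective o
    obtain ⟨g', rfl⟩ := D.toOmega_surjective o'
    change z0 (D.toOmega g * D.toOmega g') =
      D.omegaRep M N (D.toOmega g) (z0 (D.toOmega g')) + z0 (D.toOmega g)
    rw [omegaRep_toOmega]
    refine addHom_injective fun m => ?_
    change D.addHom (z0 (D.toOmega g * D.toOmega g')) m =
      D.addHom (D.pair.homRep M N g (z0 (D.toOmega g'))) m + D.addHom (z0 (D.toOmega g)) m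
    rw [← map_mul, ← Subgroup.coe_mul, hz0, addHom_homRep, hz0, hz0, hmul]⟩
  refine ⟨z, D.eq_inflDer h0 fun g m => ?_⟩
  rw [he]
  congr 1
  exact (hz0 g m).symm

/-- If the restriction to `ℋ^aff` is inner, given by an additive `f`, the same `f` defines an inner
derivation of all of `ℋ`. Subtracting it keeps the class and leaves a derivation that vanishes on
`ℋ^aff`, hence one from a cocycle. -/
theorem range_inflLin : LinearMap.range (D.inflLin M N) = LinearMap.ker (D.resAff M N) := by
  refine le_antisymm ?_ fun x hx => ?_
  · rintro _ ⟨z, rfl⟩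
    rw [LinearMap.mem_ker]
    refine (ModDer.extRes_extClass _ _).trans ?_
    rw [inflDer_restrict, ModDer.extClass_zero]
  · obtain ⟨E, -, rfl⟩ := ModDer.extClass_surjective C x
    rw [LinearMap.mem_ker, resAff, ModDer.extRes_extClass, ← ModDer.extClass_zero,
      ConjPair.extClass_eq_iff_aval] at hx
    obtain ⟨f, hf⟩ := hx
    have h : (E - ModDer.inner f).restrict D.pair.incl = 0 := ConjPair.ext_aval fun X m => by
      have h1 : D.pair.aval ((E - ModDer.inner f).restrict D.pair.incl) X m =
        E.val (D.pair.incl X) m - (ModDer.inner f).val (D.pair.incl X) m := rfl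
      have h2 : D.pair.aval (M := M) (N := N) 0 X m = 0 := rfl
      have h3 := hf X m
      rw [h2, sub_zero, ConjPair.aval_restrict] at h3
      rw [h1, h2, ModDer.inner_val, h3, sub_self]
    obtain ⟨z, hz⟩ := D.exists_eq_inflDer h
    refine ⟨z, ?_⟩
    change (D.inflDer z).extClass = _
    have h4 : (ModDer.inner f).extClass = 0 :=
      (ModDer.extClass_eq_zero_iff_val _).mpr ⟨f, fun _ _ => rfl⟩
    rw [← hz, ModDer.extClass_sub, h4, sub_zero]

/-- The derivation of the section `σ` vanishes on `ℋ^aff` because `σ` is linear there, and the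
condition on `σ`, multiplied by `T_g`, gives its value at `T_g`. These two data determine a
derivation of `ℋ`. -/
theorem extClass_of_section (z : D.Cocycles M N)
    (E : ModuleCat.{u} D.Heckeᵐᵒᵖ) (i : N ⟶ E) (p : E ⟶ M) (w : i ≫ p = 0)
    (hS : (ShortComplex.mk i p w).ShortExact)
    (σ : (pull D.pair.incl).obj M ⟶ (pull D.pair.incl).obj E)
    (hσ : σ ≫ (pull D.pair.incl).map p = 𝟙 _)
    (h : ∀ (g : D.Omega1) (m : M),
      ract E (D.T (g : W1)⁻¹) (D.pair.mapFun σ (ract M (D.T (g : W1)) m)) =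
        D.pair.mapFun σ m + i.hom (D.pair.mapFun (M := M) (N := N) (z (D.toOmega g)) m)) :
    (D.inflDer z).extClass = hS.extClass := by
  have hs : ∀ m m', D.addHom σ (m + m') = D.addHom σ m + D.addHom σ m' := map_add _
  have hp : ∀ m, p (D.addHom σ m) = m := fun m => congrArg (fun f => f.hom m) hσ
  obtain ⟨F, hF⟩ := ModDer.exists_of_section hS (D.addHom σ) hs hp
  rw [← ModDer.extClass_eq hS F (D.addHom σ) hs hp hF]
  let F : ModDer M N := F
  have hF' : ∀ b m, D.addHom σ (ract M b m) - ract E b (D.addHom σ m) = i (F.val b m) :=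
    fun b m => hF (op b) m
  have hinj : Function.Injective i := (ModuleCat.mono_iff_injective _).mp hS.mono_f
  change _ = F.extClass
  rw [D.eq_inflDer (z := z) (E := F) (fun X m => hinj ?_) (fun g m => hinj ?_)]
  · rw [← hF', addHom_linear, sub_self, map_zero]
  · have h1 : ract E ((D.pair.unit g)⁻¹ : D.Heckeˣ)
        (D.addHom σ (ract M (D.pair.unit g : D.Hecke) m)) =
          D.addHom σ m + i (D.cocycleFun z (D.toOmega g) m) := h g m
    have h2 := congrArg (ract E (D.pair.unit g : D.Hecke)) h1
    rw [ract_ract_inv, ract_add] at h2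
    rw [← hF', h2, add_sub_cancel_left]
    exact (map_smul i.hom (op (D.pair.unit g : D.Hecke)) _).symm

end Cocycles

variable (M N) in
/-- The inflation map exists, is injective, and its image is the kernel of restriction. -/
theorem exists_inflation : ∃ ι : D.H1Omega M N →ₗ[C] Ext.{u} M N 1, D.IsInflation M N ι ∧
    Function.Injective ι ∧ LinearMap.range ι = LinearMap.ker (D.resAff M N) := by
  have hsurj : Function.Surjective (groupCohomology.H1π (Rep.of (D.omegaRep M N))).hom :=
    (ModuleCat.epi_iff_surjective _).mp inferInstance
  -- The cocycles with trivial inflated class are exactly the coboundaries, so the map descends to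
  -- `H¹` and is injective there.
  obtain ⟨ι, hι, hinj⟩ := exists_linearMap_comp_eq
    (groupCohomology.H1π (Rep.of (D.omegaRep M N))).hom hsurj (D.inflLin M N)
    D.inflLin_eq_zero_iff
  refine ⟨ι, fun z E i p w hS σ hσ h => ?_, hinj, ?_⟩
  · rw [hι]
    exact D.extClass_of_section z E i p w hS σ hσ h
  · rw [← range_inflLin]
    refine le_antisymm ?_ ?_
    · rintro _ ⟨v, rfl⟩
      obtain ⟨z, rfl⟩ := hsurj v
      exact ⟨z, (hι z).symm⟩
    · rintro _ ⟨z, rfl⟩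
      exact ⟨_, hι z⟩

end GenericDatum

end

theorem mainTheorem3 {C B Waff Ω Zk W1 : Type u} [Field C] (p : ℕ) [Fact p.Prime] [CharP C p]
    [Group Waff] [Group Ω] [CommGroup Zk] [Finite Zk] [Group W1]
    (D : GenericDatum C B Waff Ω Zk W1)
    (hq : ∀ i : B, D.q i = 0) (hZ : (Nat.card Zk).Coprime p)
    (Xi Xi' : D.aff →ₐ[C] C)
    {V V' : Type u} [AddCommGroup V] [Module C V] [AddCommGroup V'] [Module C V']
    (ρ : Representation C (D.stab Xi)ᵐᵒᵖ V) (ρ' : Representation C (D.stab Xi')ᵐᵒᵖ V')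
    (hρ : D.Compatible Xi ρ) (hρ' : D.Compatible Xi' ρ')
    (hirr : ρ.IsIrreducible) (hirr' : ρ'.IsIrreducible) :
    (LinearMap.range (extRes (D.pair2 Xi Xi').incl
        ((pull (Subalgebra.inclusion inf_le_left)).obj (D.xiMod Xi ρ hρ))
        ((pull (Subalgebra.inclusion inf_le_right)).obj (D.xiMod Xi' ρ' hρ'))) =
      (D.pair2 Xi Xi').extInvariants
        ((pull (Subalgebra.inclusion inf_le_left)).obj (D.xiMod Xi ρ hρ))
        ((pull (Subalgebra.inclusion inf_le_right)).obj (D.xiMod Xi' ρ' hρ'))) ∧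
    (∃ ι : D.H1Omega (D.piMod Xi ρ hρ) (D.piMod Xi' ρ' hρ') →ₗ[C]
        Abelian.Ext.{u} (D.piMod Xi ρ hρ) (D.piMod Xi' ρ' hρ') 1,
      D.IsInflation (D.piMod Xi ρ hρ) (D.piMod Xi' ρ' hρ') ι ∧
      Function.Injective ι ∧
      LinearMap.range ι = LinearMap.ker (D.resAff (D.piMod Xi ρ hρ) (D.piMod Xi' ρ' hρ')) ∧
      LinearMap.range (D.resAff (D.piMod Xi ρ hρ) (D.piMod Xi' ρ' hρ')) =
        D.pair.extInvariants (D.piMod Xi ρ hρ) (D.piMod Xi' ρ' hρ')) ∧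
    Nonempty (Abelian.Ext.{u} (D.piMod Xi ρ hρ) (D.piMod Xi' ρ' hρ') 1 ≃ₗ[C]
      D.H1Omega (D.piMod Xi ρ hρ) (D.piMod Xi' ρ' hρ') ×
        D.pair.extInvariants (D.piMod Xi ρ hρ) (D.piMod Xi' ρ' hρ')) := by
  have hcard : (Nat.card Zk : C) ≠ 0 := by
    rw [Ne, CharP.cast_eq_zero_iff C p]
    exact ((Fact.out : p.Prime).coprime_iff_not_dvd).mp hZ.symm
  -- Both surjectivity statements are the same theorem on crossed pairs. Here each module is a
  -- single eigenspace of `ℋ^aff`; for `π` and `π'` conjugate characters occur.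
  have h1 := (D.isCrossed_pair2 Xi Xi').range_extRes hcard ((D.pair2 Xi Xi').diagProjection
    (D.xiMod_eigenspace Xi ρ hρ Xi Xi' inf_le_left)
    (D.xiMod_eigenspace Xi' ρ' hρ' Xi Xi' inf_le_right))
  have h2 := D.isCrossed_pair.range_extRes hcard (D.pair.diagProjection
    (D.piMod_eigenspace Xi ρ hρ) (D.piMod_eigenspace Xi' ρ' hρ'))
  obtain ⟨ι, hι, hinj, hr⟩ := D.exists_inflation (D.piMod Xi ρ hρ) (D.piMod Xi' ρ' hρ')
  obtain ⟨e⟩ := nonempty_equiv_prod_of_exact ι _ hinj hr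
  exact ⟨h1, ⟨ι, hι, hinj, hr, h2⟩,
    ⟨e.trans (LinearEquiv.prodCongr (LinearEquiv.refl C _) (LinearEquiv.ofEq _ _ h2))⟩⟩
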